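/- **Conventions.** Let $R$ be a commutative artinian ring all of whose residue fields $R/\mathfrak m$ ($\mathfrak m$ maximal) are algebraically closed, and let $\Lambda$ be an artin $R$-algebra, i.e. an $R$-algebra that is finitely generated as an $R$-module. All modules are finitely generated right $\Lambda$-modules; $l(M)$, $\mathrm{rad}(M)$, $\mathrm{soc}(M)$ denote length, radical and socle, and $\mathrm{rad}^0(M)=M$, $\mathrm{rad}^{i+1}(M)=\mathrm{rad}(\mathrm{rad}^i(M))$. A module is *uniserial* ($1$-factor serial) if its submodules are totally ordered by inclusion, *local* if it has exactly one maximal submodule, *colocal* if its socle is simple. For $n>1$, a module $M$ of length $l\ge n$ is *$n$-factor serial* if $M/\mathrm{rad}^{l-n}(M)$ is uniserial and $M/\mathrm{rad}^{l-n+1}(M)$ is not. $\Lambda$ is *right $n$-Nakayama* if every indecomposable module is $i$-factor serial for some $1\le i\le n$ and some indecomposable module is $n$-factor serial. **Theorem.** Let $\Lambda$ be right $4$-Nakayama and let $M$ be an indecomposable right $\Lambda$-module. **(a)** If $M$ is $4$-factor serial, then one of the following holds. (i) $M$ is local and colocal; $\mathrm{rad}(M)$ is indecomposable, non-local and $4$-factor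 serial; there are indecomposable submodules $M_1,M_2$ of length $3$, with $M_1$ uniserial and $M_2$ non-local and $3$-factor serial, and distinct (indecomposable) uniserial submodules $N_1,N_2$ of length $2$ with $N_1\subseteq M_1\cap M_2$ and $N_2\subseteq M_2$. Every submodule of $M$ is one of $0,\ \mathrm{soc}(M),\ N_1,\ N_2,\ M_1,\ M_2,\ \mathrm{rad}(M),\ M$. (ii) $M$ is local and non-colocal; $\mathrm{rad}(M)=N\oplus S_1$ with $N$ uniserial of length $3$ and $S_1$ simple; there is a uniserial submodule $N_1\subseteq N$ of length $2$; $\mathrm{soc}(M)=S_1\oplus S_2$ with $S_2=\mathrm{soc}(N)$ simple. Every submodule of $M$ is one of $0,\ S_1,\ S_2,\ \mathrm{soc}(M),\ N_1,\ N_1\oplus S_1,\ N,\ \mathrm{rad}(M),\ M$, or is isomorphic to $S_1$. (iii) $M$ is local and non-colocal; $\mathrm{rad}(M)=N_1\oplus N_2$ with $N_1,N_2$ uniserial of length $2$; $\mathrm{soc}(M)=S_1\oplus S_2$ with $S_i=\mathrm{soc}(N_i)$ simple. Every submodule of $M$ is one of $0,\ S_1,\ S_2,\ \mathrm{soc}(M),\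 N_1,\ N_2,\ N_1\oplus S_2,\ S_1\oplus N_2,\ \mathrm{rad}(M),\ M$, or is isomorphic to $N_1$ or to $N_2$. (iv) $M$ is non-local of length $4$ and $\mathrm{soc}(M)$ is simple; there are submodules $M_1,M_2$ of length $3$, with $M_1$ uniserial and $M_2$ non-local and $3$-factor serial, and distinct (indecomposable) uniserial submodules $N_1,N_2$ of length $2$ with $N_1\subseteq M_1\cap M_2$ and $N_2\subseteq M_2$. Every submodule of $M$ is one of $0,\ \mathrm{soc}(M),\ N_1,\ N_2,\ M_1,\ M_2,\ M$, or is isomorphic to $M_1$. (v) $M$ is non-local of length $4$ and $\mathrm{soc}(M)$ is not simple; there are an indecomposable $2$-factor serial submodule $N_1$ of length $3$ and an (indecomposable) uniserial submodule $N_2$ of length $2$; $\mathrm{soc}(M)=S_1\oplus S_2$ with $S_1,S_2$ simple and $\mathrm{soc}(N_2)=S_2$. Every submodule of $M$ is one of $0,\ S_1,\ S_2,\ \mathrm{soc}(M),\ N_2,\ N_2\oplus S_1,\ N_1,\ M$, or is isomorphic to $N_2$. **(b)** If $M$ is $3$-factor serial, then one of the following holds. (i) $M$ is local and colocal; $\mathrm{rad}(M)$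 is non-local, $3$-factor serial, of length $3$; there are distinct uniserial submodules $N_1,N_2$ of length $2$. Every submodule of $M$ is one of $0,\ \mathrm{soc}(M),\ N_1,\ N_2,\ \mathrm{rad}(M),\ M$. (ii) $M$ is local and $\mathrm{soc}(M)$ is not simple; $\mathrm{rad}(M)=N\oplus S_1$ with $N$ uniserial of length $2$ and $S_1$ simple; $\mathrm{soc}(M)=S_1\oplus S_2$ with $S_2=\mathrm{soc}(N)$ simple. Every submodule of $M$ is one of $0,\ S_1,\ S_2,\ \mathrm{soc}(M),\ N,\ \mathrm{rad}(M),\ M$, or is isomorphic to $S_1$. (iii) $M$ is non-local of length $3$ and $\mathrm{soc}(M)$ is simple; there are distinct uniserial submodules $N_1,N_2$ of length $2$. Every submodule of $M$ is one of $0,\ \mathrm{soc}(M),\ N_1,\ N_2,\ M$. **(c)** If $M$ is $2$-factor serial and local, then $\mathrm{rad}(M)=\mathrm{soc}(M)=S_1\oplus S_2$ with $S_1,S_2$ simple, and every submodule of $M$ is one of $0,\ S_1,\ S_2,\ \mathrm{rad}(M),\ M$. -/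

import Mathlib

/-! Notions for (left) modules over a ring `A`. Right `Λ`-modules are modules over `Λᵐᵒᵖ`. -/

universe u v

/-- The lattice of submodules is totally ordered. -/
def IsUniserial (A : Type u) [Ring A] (M : Type v) [AddCommGroup M] [Module A M] : Prop :=
  ∀ X Y : Submodule A M, X ≤ Y ∨ Y ≤ X

/-- A nonzero module that is not the direct sum of two nonzero submodules. -/
def IsIndecomposableModule (A : Type u) [Ring A] (M : Type v) [AddCommGroup M] [Module A M] :
    Prop :=
  Nontrivial M ∧ ∀ X Y : Submodule A M, IsCompl X Y → X = ⊥ ∨ Y = ⊥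

/-- A module with a unique maximal submodule (used for finitely generated modules only). -/
def IsLocalModule (A : Type u) [Ring A] (M : Type v) [AddCommGroup M] [Module A M] : Prop :=
  ∃! X : Submodule A M, IsCoatom X

/-- The socle: the sum of all simple submodules. -/
def socle (A : Type u) [Ring A] (M : Type v) [AddCommGroup M] [Module A M] : Submodule A M :=
  sSup {X : Submodule A M | IsSimpleModule A X}

/-- A module whose socle is simple. -/
def IsColocalModule (A : Type u) [Ring A] (M : Type v) [AddCommGroup M] [Module A M] : Prop :=
  IsSimpleModule A (socle A M)

/-- The socle of a submodule `X` of `M`, as a submodule of `M`. -/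
def socleOf (A : Type u) [Ring A] {M : Type v} [AddCommGroup M] [Module A M]
    (X : Submodule A M) : Submodule A M :=
  (socle A X).map X.subtype

/-- The radical series: `rad⁰ M = M` and `radⁱ⁺¹ M = rad (radⁱ M)`, where the radical of a module
is the intersection of its maximal submodules. -/
def radPow (A : Type u) [Ring A] (M : Type v) [AddCommGroup M] [Module A M] :
    ℕ → Submodule A M
  | 0 => ⊤
  | i + 1 => (Module.jacobson A (radPow A M i)).map (radPow A M i).subtype

/-- `M` is `n`-factor serial. For `n = 1` this means uniserial. For `n > 1` it means that `M` has
finite length `l ≥ n`, that `M / rad^(l-n) M` is uniserial and that `M / rad^(l-n+1) M` is not;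
here `k` stands for `l - n`. -/
def IsFactorSerial (n : ℕ) (A : Type u) [Ring A] (M : Type v) [AddCommGroup M] [Module A M] :
    Prop :=
  (n = 1 ∧ IsUniserial A M) ∨
    (1 < n ∧ ∃ k : ℕ, Module.length A M = ((k + n : ℕ) : ℕ∞) ∧
      IsUniserial A (M ⧸ radPow A M k) ∧ ¬ IsUniserial A (M ⧸ radPow A M (k + 1)))

/-- `Λ` is right `n`-Nakayama: every finitely generated indecomposable right `Λ`-module is
`i`-factor serial for some `1 ≤ i ≤ n`, and at least one of them is `n`-factor serial. (Every
finitely generated module is isomorphic to one in the universe of `Λ`.) -/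
def IsRightNakayama (n : ℕ) (Λ : Type u) [Ring Λ] : Prop :=
  (∀ (M : Type u) [AddCommGroup M] [Module Λᵐᵒᵖ M], Module.Finite Λᵐᵒᵖ M →
      IsIndecomposableModule Λᵐᵒᵖ M →
      ∃ i : ℕ, 1 ≤ i ∧ i ≤ n ∧ IsFactorSerial i Λᵐᵒᵖ M) ∧
  ∃ (M : Type u) (_ : AddCommGroup M) (_ : Module Λᵐᵒᵖ M), Module.Finite Λᵐᵒᵖ M ∧
      IsIndecomposableModule Λᵐᵒᵖ M ∧ IsFactorSerial n Λᵐᵒᵖ M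

set_option linter.unusedSectionVars false

/-! Two facts about Λᵐᵒᵖ carry everything (`IsFourNakayama`): indecomposable modules are i-factor
serial with i ≤ 4, and endomorphisms of simple modules are multiplications by central elements. The
second holds because the endomorphism ring of a simple module is a domain, integral over an
algebraically closed residue field of R.

For i ≥ 2, a non-local i-factor serial module has length i. Hence every non-local module of length
at least five decomposes (`exists_decomposition`). The proof keeps building such modules as
pushouts, fibre products and amalgams. Then either the decomposition splits a map, which yields an
extension, a lift or a section, or the lengths of the two summands do not add up.

Pushouts give an extension theorem (`exists_extension`). From it, a local module with local radical
is uniserial, so for n ≥ 2 an n-factor serial module is either non-local of length n or local, not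
uniserial and of length n + 1 (`IsFourNakayama.isFactorSerial_cases`). Gluing two copies of a local
module along their radicals (`false_of_glue`) shows that the radical has at most two maximal
submodules (`jacobson_coatom`). Central scalars enter here: a map from a local module to its own top
lifts to an endomorphism that is central multiplication, so it respects all submodules.

What remains are non-local modules of length 3 and 4 and local modules of length 3, 4 and 5. A
non-local indecomposable of length 3 is colocal with exactly two maximal submodules
(`nonlocal_len_three`); one of length 4 has top of length 2 (`jacobson_eq_inf`). If the latter has
simple socle S, then M/S decomposes, so M = M₁ + N₂ with M₁ ∩ N₂ = S (`colocal_len_four`). Otherwise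
M/U decomposes for some simple U (`exists_atom_decomposable`), which determines the submodules
(`noncolocal_len_four`). For a local module, the non-local results apply to the radical if it is
indecomposable. If not, the radical is a sum of two local modules and the bound on its maximal
submodules controls everything. -/

namespace NakayamaFour

/-! ### Length -/

/-- The length of a module, as a natural number (junk value for modules of infinite length). -/
noncomputable def len (A : Type u) [Ring A] (M : Type v) [AddCommGroup M] [Module A M] : ℕ :=
  (Module.length A M).toNat

section Length

variable {A : Type u} [Ring A] [IsArtinianRing A]
variable {M : Type v} [AddCommGroup M] [Module A M] [Module.Finite A M]
variable {N : Type v} [AddCommGroup N] [Module A N] [Module.Finite A N]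

theorem coe_len : (len A M : ℕ∞) = Module.length A M :=
  ENat.natCast_toNat Module.length_ne_top

theorem length_eq_iff {n : ℕ} : Module.length A M = n ↔ len A M = n := by
  rw [← coe_len]; exact Nat.cast_inj

theorem len_congr (e : M ≃ₗ[A] N) : len A M = len A N := by
  simp only [len, e.length_eq]

theorem len_of_exact {L : Type v} [AddCommGroup L] [Module A L] [Module.Finite A L]
    (f : L →ₗ[A] M) (g : M →ₗ[A] N) (hf : Function.Injective f) (hg : Function.Surjective g)
    (H : Function.Exact f g) : len A M = len A L + len A N := by
  have := Module.length_eq_add_of_exact f g hf hg H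
  rw [← coe_len, ← coe_len, ← coe_len] at this
  exact_mod_cast this

theorem len_prod : len A (M × N) = len A M + len A N := by
  have := Module.length_prod (R := A) M N
  rw [← coe_len, ← coe_len, ← coe_len] at this
  exact_mod_cast this

theorem len_quot_add (X : Submodule A M) : len A (M ⧸ X) + len A X = len A M := by
  rw [add_comm]
  refine (len_of_exact X.subtype X.mkQ X.injective_subtype X.mkQ_surjective ?_).symm
  exact LinearMap.exact_subtype_mkQ X

theorem len_top : len A (⊤ : Submodule A M) = len A M := by simp [len]

theorem len_bot : len A (⊥ : Submodule A M) = 0 := by simp [len]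

theorem len_eq_zero_iff : len A M = 0 ↔ Subsingleton M := by
  rw [← length_eq_iff]; simpa using Module.length_eq_zero_iff

theorem len_eq_one_iff : len A M = 1 ↔ IsSimpleModule A M := by
  rw [← length_eq_iff]; simpa using Module.length_eq_one_iff

theorem len_simple [IsSimpleModule A M] : len A M = 1 := len_eq_one_iff.2 inferInstance

theorem len_sub_eq_zero_iff {X : Submodule A M} : len A X = 0 ↔ X = ⊥ := by
  rw [len_eq_zero_iff, Submodule.subsingleton_iff_eq_bot]

theorem len_pos_of_ne_bot {X : Submodule A M} (h : X ≠ ⊥) : 1 ≤ len A X :=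
  Nat.one_le_iff_ne_zero.2 fun h0 => h (len_sub_eq_zero_iff.1 h0)

theorem len_range_add_ker (f : M →ₗ[A] N) :
    len A (LinearMap.range f) + len A (LinearMap.ker f) = len A M := by
  rw [← len_congr f.quotKerEquivRange, len_quot_add]

theorem len_map_of_injective {f : M →ₗ[A] N} (hf : Function.Injective f) (X : Submodule A M) :
    len A (X.map f) = len A X :=
  (len_congr (Submodule.equivMapOfInjective f hf X)).symm

theorem len_map_add (f : M →ₗ[A] N) (X : Submodule A M) :
    len A (X.map f) + len A (LinearMap.ker f ⊓ X : Submodule A M) = len A X := by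
  have h := len_range_add_ker (f.comp X.subtype)
  rw [LinearMap.range_comp, Submodule.range_subtype, LinearMap.ker_comp] at h
  rw [← h, inf_comm, ← Submodule.map_comap_subtype, len_map_of_injective X.injective_subtype]

theorem len_le_of_injective {f : M →ₗ[A] N} (hf : Function.Injective f) : len A M ≤ len A N := by
  have h := Module.length_le_of_injective f hf
  rw [← coe_len, ← coe_len] at h
  exact_mod_cast h

theorem len_mono {X Y : Submodule A M} (h : X ≤ Y) : len A X ≤ len A Y :=
  len_le_of_injective (Submodule.inclusion_injective h)

theorem len_map_le (f : M →ₗ[A] N) (X : Submodule A M) : len A (X.map f) ≤ len A X := by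
  have := len_map_add f X; omega

theorem len_le (X : Submodule A M) : len A X ≤ len A M := by
  have := len_quot_add X; omega

theorem len_sup_add_inf (X Y : Submodule A M) :
    len A (X ⊔ Y : Submodule A M) + len A (X ⊓ Y : Submodule A M) = len A X + len A Y := by
  have h1 := len_map_add Y.mkQ X
  have h2 := len_map_add Y.mkQ (X ⊔ Y)
  rw [Submodule.ker_mkQ] at h1 h2
  rw [inf_eq_left.2 (le_sup_right : Y ≤ X ⊔ Y), Submodule.map_sup,
    LinearMap.le_ker_iff_map.1 (le_of_eq (Submodule.ker_mkQ Y).symm), sup_bot_eq] at h2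
  rw [inf_comm] at h1
  omega

theorem eq_of_le_of_len_le {X Y : Submodule A M} (h : X ≤ Y) (hl : len A Y ≤ len A X) : X = Y := by
  have h1 := len_map_add X.mkQ Y
  rw [Submodule.ker_mkQ, inf_eq_left.2 h] at h1
  have h2 : len A (Y.map X.mkQ) = 0 := by omega
  rw [len_sub_eq_zero_iff, ← LinearMap.le_ker_iff_map, Submodule.ker_mkQ] at h2
  exact le_antisymm h h2

theorem len_lt_of_lt {X Y : Submodule A M} (h : X < Y) : len A X < len A Y := by
  by_contra hl
  exact h.ne (eq_of_le_of_len_le h.le (not_lt.1 hl))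

theorem eq_top_of_len {X : Submodule A M} (hl : len A M ≤ len A X) : X = ⊤ :=
  eq_of_le_of_len_le le_top (by rwa [len_top])

theorem len_lt_of_ne_top {X : Submodule A M} (h : X ≠ ⊤) : len A X < len A M := by
  by_contra hl
  exact h (eq_top_of_len (not_lt.1 hl))

theorem isAtom_iff_len {X : Submodule A M} : IsAtom X ↔ len A X = 1 := by
  rw [len_eq_one_iff, isSimpleModule_iff_isAtom]

theorem isCoatom_iff_len {X : Submodule A M} : IsCoatom X ↔ len A X + 1 = len A M := by
  rw [← isSimpleModule_iff_isCoatom, ← len_eq_one_iff, ← len_quot_add X]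
  omega

theorem bijective_of_injective_of_len {f : M →ₗ[A] N} (hf : Function.Injective f)
    (h : len A N ≤ len A M) : Function.Bijective f := by
  refine ⟨hf, LinearMap.range_eq_top.1 (eq_top_of_len ?_)⟩
  have := len_range_add_ker f
  rw [LinearMap.ker_eq_bot.2 hf, len_bot] at this
  omega

theorem bijective_of_surjective_of_len {f : M →ₗ[A] N} (hf : Function.Surjective f)
    (h : len A M ≤ len A N) : Function.Bijective f := by
  refine ⟨LinearMap.ker_eq_bot.1 (len_sub_eq_zero_iff.1 ?_), hf⟩
  have := len_range_add_ker f
  rw [LinearMap.range_eq_top.2 hf, len_top] at this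
  omega

theorem len_comap {f : M →ₗ[A] N} (hf : Function.Surjective f) (Y : Submodule A N) :
    len A (Y.comap f) = len A Y + len A (LinearMap.ker f) := by
  have h := len_map_add f (Y.comap f)
  rw [Submodule.map_comap_eq_of_surjective hf, inf_eq_left.2 (LinearMap.ker_le_comap f)] at h
  exact h.symm

theorem len_mapQ_add {K X : Submodule A M} (h : K ≤ X) :
    len A (X.map K.mkQ) + len A K = len A X := by
  have := len_map_add K.mkQ X
  rwa [Submodule.ker_mkQ, inf_eq_left.2 h] at this

theorem exists_atom_le {X : Submodule A M} (h : X ≠ ⊥) : ∃ Z ≤ X, len A Z = 1 := by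
  obtain ⟨Z, hZ, hZX⟩ := (eq_bot_or_exists_atom_le X).resolve_left h
  exact ⟨Z, hZX, isAtom_iff_len.1 hZ⟩

theorem exists_coatom_ge {X : Submodule A M} (h : X ≠ ⊤) :
    ∃ C, X ≤ C ∧ len A C + 1 = len A M := by
  obtain ⟨C, hC, hXC⟩ := (eq_top_or_exists_le_coatom X).resolve_left h
  exact ⟨C, hXC, isCoatom_iff_len.1 hC⟩

theorem disjoint_or_le {Z X : Submodule A M} (hZ : len A Z = 1) : Z ⊓ X = ⊥ ∨ Z ≤ X := by
  rcases (isAtom_iff_len.2 hZ).le_iff.1 (inf_le_left : Z ⊓ X ≤ Z) with h | h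
  · exact Or.inl h
  · exact Or.inr (inf_eq_left.1 h)

end Length

open Module (jacobson)

section Notions

variable {A : Type u} [Ring A] [IsArtinianRing A]
variable {M : Type v} [AddCommGroup M] [Module A M] [Module.Finite A M]
variable {N : Type v} [AddCommGroup N] [Module A N] [Module.Finite A N]

/-! ### Radical -/

theorem jacobson_le_of_len {C : Submodule A M} (h : len A C + 1 = len A M) : jacobson A M ≤ C :=
  sInf_le (isCoatom_iff_len.2 h)

theorem eq_top_of_sup_jacobson {X Y : Submodule A M} (hY : Y ≤ jacobson A M) (h : X ⊔ Y = ⊤) :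
    X = ⊤ := by
  by_contra hX
  obtain ⟨C, hXC, hC⟩ := exists_coatom_ge hX
  refine (isCoatom_iff_len.2 hC).1 (top_le_iff.1 (h ▸ sup_le hXC (hY.trans ?_)))
  exact jacobson_le_of_len hC

theorem jacobson_ne_top [Nontrivial M] : jacobson A M ≠ ⊤ := (Module.jacobson_lt_top A M).ne

theorem exists_coatom_not_le {X : Submodule A M} (h : ¬ X ≤ jacobson A M) :
    ∃ C : Submodule A M, len A C + 1 = len A M ∧ ¬ X ≤ C := by
  by_contra! hC
  exact h (le_sInf fun C hc => hC C (isCoatom_iff_len.1 hc))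

theorem jacobson_eq_bot_iff : jacobson A M = ⊥ ↔ IsSemisimpleModule A M :=
  (IsArtinian.isSemisimpleModule_iff_jacobson A M).symm

theorem map_jacobson_eq_bot [IsSemisimpleModule A N] (f : M →ₗ[A] N) {x : M}
    (hx : x ∈ jacobson A M) : f x = 0 := by
  have h := Module.map_jacobson_le f (Submodule.mem_map_of_mem hx)
  rw [jacobson_eq_bot_iff.2 inferInstance] at h
  simpa using h

/-- A simple submodule outside the radical has a complement. -/
theorem exists_isCompl_of_not_le_jacobson {Z : Submodule A M} (hZ : len A Z = 1)
    (h : ¬ Z ≤ jacobson A M) : ∃ C : Submodule A M, len A C + 1 = len A M ∧ IsCompl C Z := by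
  obtain ⟨C, hC, hZC⟩ := exists_coatom_not_le h
  refine ⟨C, hC, ?_⟩
  have h1 := (disjoint_or_le (X := C) hZ).resolve_right hZC
  rw [inf_comm] at h1
  refine ⟨disjoint_iff.2 h1, codisjoint_iff.2 (eq_top_of_len ?_)⟩
  have := len_sup_add_inf C Z
  rw [h1, len_bot] at this
  omega

/-! ### Local modules -/

theorem isLocal_iff : IsLocalModule A M ↔
    ∃ J : Submodule A M, J ≠ ⊤ ∧ ∀ Y : Submodule A M, Y ≠ ⊤ → Y ≤ J := by
  constructor
  · rintro ⟨J, hJ, hu⟩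
    refine ⟨J, hJ.1, fun Y hY => ?_⟩
    obtain ⟨C, hC, hYC⟩ := (eq_top_or_exists_le_coatom Y).resolve_left hY
    exact hu C hC ▸ hYC
  · rintro ⟨J, hJ, hu⟩
    refine ⟨J, ⟨hJ, fun Y hY => ?_⟩, fun C hC => ?_⟩
    · by_contra h; exact (hu Y h).not_gt hY
    · exact (hC.le_iff_eq hJ).1 (hu C hC.1) |>.symm

theorem jacobson_eq_of_forall_le {J : Submodule A M} (hJ : J ≠ ⊤)
    (h : ∀ Y : Submodule A M, Y ≠ ⊤ → Y ≤ J) : jacobson A M = J := by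
  have hc : IsCoatom J := ⟨hJ, fun Y hY => by by_contra h'; exact (h Y h').not_gt hY⟩
  refine le_antisymm (sInf_le hc) (le_sInf fun C hC => ?_)
  exact ((hC.le_iff_eq hJ).1 (h C hC.1)).le

theorem le_jacobson_of_isLocal (hM : IsLocalModule A M) {X : Submodule A M} (hX : X ≠ ⊤) :
    X ≤ jacobson A M := by
  obtain ⟨J, hJ, h⟩ := isLocal_iff.1 hM
  rw [jacobson_eq_of_forall_le hJ h]
  exact h X hX

theorem nontrivial_of_isLocal (hM : IsLocalModule A M) : Nontrivial M := by
  obtain ⟨J, hJ, h⟩ := isLocal_iff.1 hM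
  by_contra hn
  rw [not_nontrivial_iff_subsingleton] at hn
  exact hJ (Subsingleton.elim _ _)

theorem len_jacobson_of_isLocal (hM : IsLocalModule A M) :
    len A (jacobson A M) + 1 = len A M := by
  have := nontrivial_of_isLocal hM
  refine isCoatom_iff_len.1 ⟨jacobson_ne_top, fun Y hY => ?_⟩
  by_contra h
  exact (le_jacobson_of_isLocal hM h).not_gt hY

theorem isLocal_of_forall_coatom {J : Submodule A M} (hJ : len A J + 1 = len A M)
    (h : ∀ C : Submodule A M, len A C + 1 = len A M → C = J) : IsLocalModule A M :=
  ⟨J, isCoatom_iff_len.2 hJ, fun C hC => h C (isCoatom_iff_len.1 hC)⟩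

theorem exists_coatoms_of_not_isLocal [Nontrivial M] (h : ¬ IsLocalModule A M) :
    ∃ C D : Submodule A M, len A C + 1 = len A M ∧ len A D + 1 = len A M ∧ C ≠ D := by
  obtain ⟨C, -, hC⟩ := exists_coatom_ge (bot_ne_top (α := Submodule A M))
  by_contra! hD
  exact h (isLocal_of_forall_coatom hC fun D h' => (hD C D hC h').symm)

theorem coatom_eq_jacobson (hM : IsLocalModule A M) {C : Submodule A M}
    (hC : len A C + 1 = len A M) : C = jacobson A M := by
  have := len_jacobson_of_isLocal hM
  refine eq_of_le_of_len_le (le_jacobson_of_isLocal hM fun h => ?_) (by omega)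
  subst h
  rw [len_top] at hC
  omega

theorem not_isLocal_of_coatoms {C D : Submodule A M} (hC : len A C + 1 = len A M)
    (hD : len A D + 1 = len A M) (h : C ≠ D) : ¬ IsLocalModule A M := fun hM =>
  h ((coatom_eq_jacobson hM hC).trans (coatom_eq_jacobson hM hD).symm)

theorem isLocal_of_surjective {f : M →ₗ[A] N} (hf : Function.Surjective f) [Nontrivial N]
    (hM : IsLocalModule A M) : IsLocalModule A N := by
  refine isLocal_iff.2 ⟨(jacobson A M).map f, fun h => ?_, fun Y hY => ?_⟩
  · have h1 := h ▸ Module.map_jacobson_le f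
    exact jacobson_ne_top (top_le_iff.1 h1)
  · rw [← Submodule.map_comap_eq_of_surjective hf Y]
    refine Submodule.map_mono (le_jacobson_of_isLocal hM fun h => hY ?_)
    rw [← Submodule.map_comap_eq_of_surjective hf Y, h, Submodule.map_top,
      LinearMap.range_eq_top.2 hf]

theorem range_eq_top_of_not_le_jacobson (hN : IsLocalModule A N) {f : M →ₗ[A] N}
    (h : ¬ LinearMap.range f ≤ jacobson A N) : Function.Surjective f := by
  rw [← LinearMap.range_eq_top]
  by_contra h'
  exact h (le_jacobson_of_isLocal hN h')

theorem atom_le_jacobson_of_isLocal (hM : IsLocalModule A M) (h2 : 2 ≤ len A M)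
    {Z : Submodule A M} (hZ : len A Z = 1) : Z ≤ jacobson A M := by
  refine le_jacobson_of_isLocal hM fun h => ?_
  rw [h, len_top] at hZ
  omega

/-! ### Uniserial modules -/

theorem isUniserial_sub_iff {X : Submodule A M} : IsUniserial A X ↔
    ∀ Y ≤ X, ∀ Z ≤ X, Y ≤ Z ∨ Z ≤ Y := by
  constructor
  · intro h Y hY Z hZ
    rw [← inf_eq_right.2 hY, ← inf_eq_right.2 hZ, ← Submodule.map_comap_subtype,
      ← Submodule.map_comap_subtype]
    exact (h (Y.comap X.subtype) (Z.comap X.subtype)).imp (Submodule.map_mono ·)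
      (Submodule.map_mono ·)
  · intro h Y Z
    have := h _ (X.map_subtype_le Y) _ (X.map_subtype_le Z)
    simpa only [Submodule.map_le_map_iff_of_injective X.injective_subtype] using this

theorem isUniserial_quot_iff {K : Submodule A M} : IsUniserial A (M ⧸ K) ↔
    ∀ Y, K ≤ Y → ∀ Z, K ≤ Z → Y ≤ Z ∨ Z ≤ Y := by
  constructor
  · intro h Y hY Z hZ
    have := h (Y.map K.mkQ) (Z.map K.mkQ)
    simpa [Submodule.map_le_iff_le_comap, Submodule.comap_map_mkQ, hY, hZ] using this
  · intro h Y Z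
    have := h (Y.comap K.mkQ) (K.le_comap_mkQ Y) (Z.comap K.mkQ) (K.le_comap_mkQ Z)
    simpa [Submodule.comap_le_comap_iff_of_surjective K.mkQ_surjective] using this

theorem isUniserial_of_surjective {f : M →ₗ[A] N} (hf : Function.Surjective f)
    (h : IsUniserial A M) : IsUniserial A N := by
  intro X Y
  have := h (X.comap f) (Y.comap f)
  simpa [Submodule.comap_le_comap_iff_of_surjective hf] using this

theorem isUniserial_of_injective {f : M →ₗ[A] N} (hf : Function.Injective f)
    (h : IsUniserial A N) : IsUniserial A M := by
  intro X Y
  have := h (X.map f) (Y.map f)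
  simpa [Submodule.map_le_map_iff_of_injective hf] using this

theorem isUniserial_of_le {X Y : Submodule A M} (h : X ≤ Y) (hY : IsUniserial A Y) :
    IsUniserial A X :=
  isUniserial_of_injective (Submodule.inclusion_injective h) hY

theorem eq_of_isUniserial (h : IsUniserial A M) {Y Z : Submodule A M}
    (hl : len A Y = len A Z) : Y = Z := by
  rcases h Y Z with h | h
  · exact eq_of_le_of_len_le h hl.ge
  · exact (eq_of_le_of_len_le h hl.le).symm

theorem eq_of_isUniserial_of_len {X Y Z : Submodule A M} (h : IsUniserial A X) (hY : Y ≤ X)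
    (hZ : Z ≤ X) (hl : len A Y = len A Z) : Y = Z := by
  rcases isUniserial_sub_iff.1 h Y hY Z hZ with h | h
  · exact eq_of_le_of_len_le h hl.ge
  · exact (eq_of_le_of_len_le h hl.le).symm

theorem isLocal_of_isUniserial [Nontrivial M] (h : IsUniserial A M) : IsLocalModule A M := by
  obtain ⟨C, -, hC⟩ := exists_coatom_ge (bot_ne_top (α := Submodule A M))
  exact isLocal_of_forall_coatom hC fun D hD => eq_of_isUniserial h (by omega)

theorem isUniserial_of_jacobson (hM : IsLocalModule A M) (h : IsUniserial A (jacobson A M)) :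
    IsUniserial A M := by
  intro X Y
  by_cases hX : X = ⊤
  · exact Or.inr (hX ▸ le_top)
  by_cases hY : Y = ⊤
  · exact Or.inl (hY ▸ le_top)
  exact isUniserial_sub_iff.1 h X (le_jacobson_of_isLocal hM hX) Y (le_jacobson_of_isLocal hM hY)

theorem isUniserial_of_len_le_one (h : len A M ≤ 1) : IsUniserial A M := by
  intro X Y
  by_cases hX : X = ⊤
  · exact Or.inr (hX ▸ le_top)
  have h1 := len_lt_of_ne_top hX
  exact Or.inl ((len_sub_eq_zero_iff.1 (by omega : len A X = 0)) ▸ bot_le)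

theorem isUniserial_of_isLocal_of_len_two (hM : IsLocalModule A M) (h : len A M ≤ 2) :
    IsUniserial A M := by
  have := len_jacobson_of_isLocal hM
  exact isUniserial_of_jacobson hM (isUniserial_of_len_le_one (by omega))

/-- A module of length two with at most one simple submodule is uniserial. -/
theorem isUniserial_of_len_two {X S : Submodule A M} (hX : len A X = 2)
    (h : ∀ Z ≤ X, len A Z = 1 → Z = S) : IsUniserial A X := by
  rw [isUniserial_sub_iff]
  have key : ∀ Y ≤ X, Y = ⊥ ∨ Y = S ∨ Y = X := by
    intro Y hY
    have h1 := len_mono hY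
    rcases (by omega : len A Y = 0 ∨ len A Y = 1 ∨ 2 ≤ len A Y) with h2 | h2 | h2
    · exact Or.inl (len_sub_eq_zero_iff.1 h2)
    · exact Or.inr (Or.inl (h Y hY h2))
    · exact Or.inr (Or.inr (eq_of_le_of_len_le hY (by omega)))
  intro Y hY Z hZ
  rcases key Y hY with rfl | rfl | rfl
  · exact Or.inl bot_le
  · rcases key Z hZ with rfl | rfl | rfl
    · exact Or.inr bot_le
    · exact Or.inl le_rfl
    · exact Or.inl hY
  · exact Or.inr hZ

/-! ### Indecomposable modules -/

theorem isIndecomposable_of_isLocal (hM : IsLocalModule A M) : IsIndecomposableModule A M := by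
  have := nontrivial_of_isLocal hM
  refine ⟨this, fun X Y h => ?_⟩
  by_cases hX : X = ⊤
  · exact Or.inr (by simpa [hX] using h.inf_eq_bot)
  by_cases hY : Y = ⊤
  · exact Or.inl (by simpa [hY] using h.inf_eq_bot)
  have := h.sup_eq_top
  exact absurd (top_le_iff.1 (this ▸ sup_le (le_jacobson_of_isLocal hM hX)
    (le_jacobson_of_isLocal hM hY))) jacobson_ne_top

theorem isIndecomposable_sub_iff {X : Submodule A M} : IsIndecomposableModule A X ↔
    X ≠ ⊥ ∧ ∀ Y Z, Y ⊔ Z = X → Y ⊓ Z = ⊥ → Y = ⊥ ∨ Z = ⊥ := by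
  unfold IsIndecomposableModule
  refine and_congr Submodule.nontrivial_iff_ne_bot ⟨fun h Y Z hs hi => ?_, fun h Y Z hc => ?_⟩
  · have hY : Y ≤ X := hs ▸ le_sup_left
    have hZ : Z ≤ X := hs ▸ le_sup_right
    have h1 : (Y.comap X.subtype).map X.subtype = Y := by
      rw [Submodule.map_comap_subtype, inf_eq_right.2 hY]
    have h2 : (Z.comap X.subtype).map X.subtype = Z := by
      rw [Submodule.map_comap_subtype, inf_eq_right.2 hZ]
    have inj := Submodule.map_injective_of_injective X.injective_subtype
    refine (h (Y.comap X.subtype) (Z.comap X.subtype) ⟨?_, ?_⟩).imp ?_ ?_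
    · rw [disjoint_iff, ← Submodule.comap_inf, hi, Submodule.comap_bot, Submodule.ker_subtype]
    · rw [codisjoint_iff]
      apply inj
      rw [Submodule.map_sup, h1, h2, hs, Submodule.map_top, Submodule.range_subtype]
    · intro h; rw [← h1, h, Submodule.map_bot]
    · intro h; rw [← h2, h, Submodule.map_bot]
  · refine (h (Y.map X.subtype) (Z.map X.subtype) ?_ ?_).imp ?_ ?_
    · rw [← Submodule.map_sup, hc.sup_eq_top, Submodule.map_top, Submodule.range_subtype]
    · rw [← Submodule.map_inf _ X.injective_subtype, hc.inf_eq_bot, Submodule.map_bot]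
    · exact fun h => Submodule.map_injective_of_injective X.injective_subtype (by simpa using h)
    · exact fun h => Submodule.map_injective_of_injective X.injective_subtype (by simpa using h)

theorem exists_of_not_isIndecomposable [Nontrivial M] (h : ¬ IsIndecomposableModule A M) :
    ∃ X Y : Submodule A M, X ⊔ Y = ⊤ ∧ X ⊓ Y = ⊥ ∧ X ≠ ⊥ ∧ Y ≠ ⊥ := by
  unfold IsIndecomposableModule at h
  push Not at h
  obtain ⟨X, Y, hc, hX, hY⟩ := h inferInstance
  exact ⟨X, Y, hc.sup_eq_top, hc.inf_eq_bot, hX, hY⟩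

theorem exists_of_not_isIndecomposable_sub {X : Submodule A M} (hX : X ≠ ⊥)
    (h : ¬ IsIndecomposableModule A X) :
    ∃ Y Z : Submodule A M, Y ⊔ Z = X ∧ Y ⊓ Z = ⊥ ∧ Y ≠ ⊥ ∧ Z ≠ ⊥ := by
  rw [isIndecomposable_sub_iff] at h
  push Not at h
  exact h hX

theorem exists_of_not_isIndecomposable_quot {K : Submodule A M} (hK : K ≠ ⊤)
    (h : ¬ IsIndecomposableModule A (M ⧸ K)) :
    ∃ Y Z : Submodule A M, Y ⊔ Z = ⊤ ∧ Y ⊓ Z = K ∧ Y ≠ K ∧ Z ≠ K := by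
  have : Nontrivial (M ⧸ K) := Submodule.Quotient.nontrivial_iff.2 hK
  obtain ⟨X, Y, hs, hi, hX, hY⟩ := exists_of_not_isIndecomposable h
  have key : ∀ X : Submodule A (M ⧸ K), X ≠ ⊥ → X.comap K.mkQ ≠ K := by
    intro X hX h
    rw [← Submodule.map_comap_eq_of_surjective K.mkQ_surjective X, h] at hX
    simp at hX
  refine ⟨X.comap K.mkQ, Y.comap K.mkQ, ?_, ?_, key X hX, key Y hY⟩
  · have h1 := Submodule.comap_map_eq K.mkQ (X.comap K.mkQ ⊔ Y.comap K.mkQ)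
    rw [Submodule.map_sup, Submodule.map_comap_eq_of_surjective K.mkQ_surjective,
      Submodule.map_comap_eq_of_surjective K.mkQ_surjective, hs, Submodule.comap_top,
      Submodule.ker_mkQ, sup_assoc, sup_eq_left.2 (K.le_comap_mkQ Y)] at h1
    exact h1.symm
  · rw [← Submodule.comap_inf, hi, Submodule.comap_bot, Submodule.ker_mkQ]

theorem not_isCompl_of_isIndecomposable (hM : IsIndecomposableModule A M) {X Y : Submodule A M}
    (hX : X ≠ ⊥) (hY : Y ≠ ⊥) (hs : X ⊔ Y = ⊤) (hi : X ⊓ Y = ⊥) : False :=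
  (hM.2 X Y ⟨disjoint_iff.2 hi, codisjoint_iff.2 hs⟩).elim hX hY

/-- A simple submodule outside some maximal submodule is a complement of it, which is impossible in
an indecomposable module of length at least two. -/
theorem atom_le_jacobson_of_isIndecomposable (hM : IsIndecomposableModule A M)
    (h2 : 2 ≤ len A M) {Z : Submodule A M} (hZ : len A Z = 1) : Z ≤ jacobson A M := by
  by_contra h
  obtain ⟨C, hC, hc⟩ := exists_isCompl_of_not_le_jacobson hZ h
  rcases hM.2 _ _ hc with h | h
  · rw [h, len_bot] at hC; omega
  · rw [h, len_bot] at hZ; omega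

/-! ### Socle -/

theorem le_socle_of_len {Z : Submodule A M} (hZ : len A Z = 1) : Z ≤ socle A M :=
  le_sSup (len_eq_one_iff.1 hZ)

theorem socle_le {X : Submodule A M} (h : ∀ Z : Submodule A M, len A Z = 1 → Z ≤ X) :
    socle A M ≤ X :=
  sSup_le fun Z hZ => h Z (len_eq_one_iff.2 hZ)

theorem isSemisimple_socle : IsSemisimpleModule A (socle A M) := by
  unfold socle
  rw [sSup_eq_iSup]
  exact isSemisimpleModule_biSup_of_isSemisimpleModule_submodule
    fun X (hX : IsSimpleModule A X) => inferInstance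

theorem le_socle_of_isSemisimple (X : Submodule A M) [IsSemisimpleModule A X] :
    X ≤ socle A M := by
  have h := congrArg (Submodule.map X.subtype) (IsSemisimpleModule.sSup_simples_eq_top A X)
  rw [Submodule.map_top, Submodule.range_subtype, sSup_eq_iSup, Submodule.map_iSup] at h
  rw [← h]
  refine iSup_le fun Z => ?_
  rw [Submodule.map_iSup]
  refine iSup_le fun (hZ : IsSimpleModule A Z) => le_socle_of_len ?_
  rw [len_map_of_injective X.injective_subtype, len_simple]

theorem isSemisimple_of_le {X Y : Submodule A M} (h : X ≤ Y) [IsSemisimpleModule A Y] :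
    IsSemisimpleModule A X :=
  IsSemisimpleModule.of_injective _ (Submodule.inclusion_injective h)

theorem map_socle_le (f : M →ₗ[A] N) : (socle A M).map f ≤ socle A N := by
  have : IsSemisimpleModule A (socle A M) := isSemisimple_socle
  have : IsSemisimpleModule A ((socle A M).map f) :=
    IsSemisimpleModule.of_surjective (f.submoduleMap _) (f.submoduleMap_surjective _)
  exact le_socle_of_isSemisimple _

theorem socle_eq_of_forall {S : Submodule A M} (hS : len A S = 1)
    (h : ∀ Z : Submodule A M, len A Z = 1 → Z = S) : socle A M = S :=
  le_antisymm (socle_le fun Z hZ => (h Z hZ).le) (le_socle_of_len hS)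

theorem socleOf_eq_of_forall {X S : Submodule A M} (hS : len A S = 1) (hSX : S ≤ X)
    (h : ∀ Z ≤ X, len A Z = 1 → Z = S) : socleOf A X = S := by
  have inj := X.injective_subtype
  have h1 : (S.comap X.subtype).map X.subtype = S := by
    rw [Submodule.map_comap_subtype, inf_eq_right.2 hSX]
  unfold socleOf
  rw [socle_eq_of_forall (S := S.comap X.subtype), h1]
  · rw [← len_map_of_injective inj, h1, hS]
  · intro Z hZ
    apply Submodule.map_injective_of_injective inj
    rw [h1]
    exact h _ (X.map_subtype_le Z) (by rw [len_map_of_injective inj, hZ])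

theorem socleOf_eq_of_isUniserial {X S : Submodule A M} (hS : len A S = 1) (hSX : S ≤ X)
    (h : IsUniserial A X) : socleOf A X = S :=
  socleOf_eq_of_forall hS hSX fun _ hZ hl => eq_of_isUniserial_of_len h hZ hSX (hl.trans hS.symm)

theorem isSemisimple_of_len_one {X : Submodule A M} (h : len A X = 1) :
    IsSemisimpleModule A X := by
  have := len_eq_one_iff.1 h
  infer_instance

/-- Central elements act by endomorphisms. -/
noncomputable def centralMul (M : Type v) [AddCommGroup M] [Module A M]
    (a : Subsemiring.center A) : M →ₗ[A] M where
  toFun x := a • x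
  map_add' := smul_add a
  map_smul' r x := smul_comm a r x

@[simp] theorem centralMul_apply (a : Subsemiring.center A) (x : M) :
    centralMul M a x = a • x := rfl

theorem map_central_smul (f : M →ₗ[A] N) (a : Subsemiring.center A) (x : M) :
    f (a • x) = a • f x := f.map_smul (a : A) x

theorem central_smul_mem (X : Submodule A M) (a : Subsemiring.center A) {x : M} (hx : x ∈ X) :
    a • x ∈ X := X.smul_mem (a : A) hx

end Notions

/-- The two properties of the base ring that the classification uses: modules are factor serial
of index at most four, and endomorphisms of simple modules are multiplications by central
elements. -/
structure IsFourNakayama (A : Type u) [Ring A] : Prop where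
  factorSerial : ∀ (M : Type u) [AddCommGroup M] [Module A M], Module.Finite A M →
    IsIndecomposableModule A M → ∃ i : ℕ, 1 ≤ i ∧ i ≤ 4 ∧ IsFactorSerial i A M
  scalar : ∀ (T : Type u) [AddCommGroup T] [Module A T] [IsSimpleModule A T] (f : T →ₗ[A] T),
    ∃ a : Subsemiring.center A, ∀ t, f t = a • t

/-! ### Factor serial modules over an artinian ring. -/

section FactorSerial

variable {A : Type u} [Ring A] [IsArtinianRing A]
variable {M : Type v} [AddCommGroup M] [Module A M] [Module.Finite A M]

theorem radPow_succ (i : ℕ) :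
    radPow A M (i + 1) = (jacobson A (radPow A M i)).map (radPow A M i).subtype := rfl

theorem radPow_one : radPow A M 1 = jacobson A M :=
  Module.map_jacobson_of_bijective (f := (⊤ : Submodule A M).subtype)
    ⟨Submodule.injective_subtype _, fun x => ⟨⟨x, trivial⟩, rfl⟩⟩

theorem radPow_succ_le (i : ℕ) : radPow A M (i + 1) ≤ radPow A M i := Submodule.map_subtype_le _ _

theorem radPow_antitone : Antitone (radPow A M) := antitone_nat_of_succ_le radPow_succ_le

theorem not_isUniserial_quot {K C D : Submodule A M} (hC : K ≤ C) (hD : K ≤ D)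
    (hl : len A C = len A D) (h : C ≠ D) : ¬ IsUniserial A (M ⧸ K) := fun hu =>
  (isUniserial_quot_iff.1 hu C hC D hD).elim (fun h' => h (eq_of_le_of_len_le h' hl.ge))
    fun h' => h (eq_of_le_of_len_le h' hl.le).symm

/-- Here k = 0: the module modulo rad⁰ is zero, while the top has two maximal submodules. -/
theorem isFactorSerial_of_not_isLocal [Nontrivial M] {n : ℕ} (hn : 2 ≤ n)
    (hM : ¬ IsLocalModule A M) (hl : len A M = n) : IsFactorSerial n A M := by
  refine Or.inr ⟨hn, 0, ?_, ?_, ?_⟩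
  · rw [zero_add, length_eq_iff, hl]
  · exact isUniserial_quot_iff.2 fun Y _ Z hZ => Or.inl (le_top.trans hZ)
  · obtain ⟨C, D, hC, hD, h⟩ := exists_coatoms_of_not_isLocal hM
    rw [radPow_one]
    exact not_isUniserial_quot (jacobson_le_of_len hC) (jacobson_le_of_len hD) (by omega) h

/-- For k = 0 the first condition is empty and the second says that the top is not simple. For k ≥ 1
the top is a quotient of a uniserial module, so the module is local. -/
theorem isFactorSerial_cases [Nontrivial M] {n : ℕ} (hn : 2 ≤ n) (h : IsFactorSerial n A M) :
    (¬ IsLocalModule A M ∧ len A M = n) ∨ (IsLocalModule A M ∧ ¬ IsUniserial A M ∧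
      ∃ k, 1 ≤ k ∧ len A M = k + n ∧ IsUniserial A (M ⧸ radPow A M k)) := by
  rcases h with ⟨rfl, -⟩ | ⟨-, k, hl, h1, h2⟩
  · omega
  rw [length_eq_iff] at hl
  rcases Nat.eq_zero_or_pos k with rfl | hk
  · left
    refine ⟨fun hM => h2 ?_, by omega⟩
    have := len_quot_add (jacobson A M)
    have := len_jacobson_of_isLocal hM
    rw [radPow_one]
    exact isUniserial_of_len_le_one (by omega)
  · refine Or.inr ⟨?_, fun hu => h2 (isUniserial_of_surjective (Submodule.mkQ_surjective _) hu),
      k, hk, hl, h1⟩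
    by_contra hM
    obtain ⟨C, D, hC, hD, h⟩ := exists_coatoms_of_not_isLocal hM
    have hJ : radPow A M k ≤ jacobson A M := radPow_one (A := A) (M := M) ▸ radPow_antitone hk
    exact not_isUniserial_quot (hJ.trans (jacobson_le_of_len hC))
      (hJ.trans (jacobson_le_of_len hD)) (by omega) h h1

theorem exists_coatoms_sub_of_not_isLocal {X : Submodule A M} (hX : X ≠ ⊥)
    (h : ¬ IsLocalModule A X) : ∃ C ≤ X, ∃ D ≤ X, len A C + 1 = len A X ∧
      len A D + 1 = len A X ∧ C ≠ D := by
  have : Nontrivial X := Submodule.nontrivial_iff_ne_bot.2 hX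
  obtain ⟨C, D, hC, hD, hne⟩ := exists_coatoms_of_not_isLocal h
  have inj := X.injective_subtype
  refine ⟨_, X.map_subtype_le C, _, X.map_subtype_le D, ?_, ?_,
    fun h => hne (Submodule.map_injective_of_injective inj h)⟩
  · rwa [len_map_of_injective inj]
  · rwa [len_map_of_injective inj]

theorem len_comap_subtype {X Y : Submodule A M} (h : Y ≤ X) :
    len A (Y.comap X.subtype) = len A Y := by
  rw [← len_map_of_injective X.injective_subtype, Submodule.map_comap_subtype, inf_eq_right.2 h]

theorem not_isLocal_sub {X C D : Submodule A M} (hC : C ≤ X) (hD : D ≤ X)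
    (hCl : len A C + 1 = len A X) (hDl : len A D + 1 = len A X) (h : C ≠ D) :
    ¬ IsLocalModule A X := by
  refine not_isLocal_of_coatoms (C := C.comap X.subtype) (D := D.comap X.subtype) ?_ ?_ ?_
  · rwa [len_comap_subtype hC]
  · rwa [len_comap_subtype hD]
  · intro h'
    have := congrArg (Submodule.map X.subtype) h'
    rw [Submodule.map_comap_subtype, Submodule.map_comap_subtype, inf_eq_right.2 hC,
      inf_eq_right.2 hD] at this
    exact h this

theorem radPow_two_le {C : Submodule A M} (hC : C ≤ jacobson A M)
    (hCl : len A C + 1 = len A (jacobson A M)) : radPow A M 2 ≤ C := by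
  rw [radPow_succ, radPow_one, Submodule.map_le_iff_le_comap]
  refine jacobson_le_of_len ?_
  rwa [len_comap_subtype hC]

/-- Here k = 1: the top is simple, and two maximal submodules of the radical, both containing rad²,
survive modulo rad². -/
theorem isFactorSerial_of_isLocal {n : ℕ} (hn : 2 ≤ n) (hM : IsLocalModule A M)
    (hJ : ¬ IsLocalModule A (jacobson A M)) (hl : len A M = n + 1) : IsFactorSerial n A M := by
  have hlJ := len_jacobson_of_isLocal hM
  refine Or.inr ⟨hn, 1, ?_, ?_, ?_⟩
  · rw [length_eq_iff]; omega
  · rw [radPow_one]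
    have := len_quot_add (jacobson A M)
    exact isUniserial_of_len_le_one (by omega)
  · have hb : jacobson A M ≠ ⊥ := fun h => by rw [h, len_bot] at hlJ; omega
    obtain ⟨C, hC, D, hD, hCl, hDl, hne⟩ := exists_coatoms_sub_of_not_isLocal hb hJ
    exact not_isUniserial_quot (radPow_two_le hC hCl) (radPow_two_le hD hDl) (by omega) hne

end FactorSerial

/-! ### Decomposing long non-local modules, and extending homomorphisms. -/

section Extension

variable {A : Type u} [Ring A] [IsArtinianRing A]

/-- For a non-local indecomposable module the factor serial index is the length, so the bound on the
index becomes a bound on the length. -/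
theorem IsFourNakayama.len_le_of_not_isLocal (hA : IsFourNakayama A) {M : Type u}
    [AddCommGroup M] [Module A M] [Module.Finite A M] (hM : IsIndecomposableModule A M)
    (h : ¬ IsLocalModule A M) : len A M ≤ 4 := by
  have := hM.1
  obtain ⟨i, hi, hi4, hs⟩ := hA.factorSerial M inferInstance hM
  rcases (by omega : i = 1 ∨ 2 ≤ i) with rfl | hi
  · rcases hs with ⟨-, hu⟩ | ⟨hi, -⟩
    · exact absurd (isLocal_of_isUniserial hu) h
    · omega
  · rcases isFactorSerial_cases hi hs with h' | h'
    · omega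
    · exact absurd h'.1 h

/-- Over a four-Nakayama ring long modules with two maximal submodules decompose. -/
theorem IsFourNakayama.exists_decomposition (hA : IsFourNakayama A) {M : Type u}
    [AddCommGroup M] [Module A M] [Module.Finite A M] (hl : 5 ≤ len A M)
    (h : ¬ IsLocalModule A M) :
    ∃ X Y : Submodule A M, X ⊔ Y = ⊤ ∧ X ⊓ Y = ⊥ ∧ X ≠ ⊥ ∧ Y ≠ ⊥ := by
  have : Nontrivial M := by
    by_contra hn
    rw [not_nontrivial_iff_subsingleton, ← len_eq_zero_iff (A := A)] at hn
    omega
  refine exists_of_not_isIndecomposable fun hM => ?_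
  have := hA.len_le_of_not_isLocal hM h
  omega

variable {M N : Type u} [AddCommGroup M] [Module A M] [Module.Finite A M]
  [AddCommGroup N] [Module A N] [Module.Finite A N]

theorem len_range_of_injective {f : M →ₗ[A] N} (hf : Function.Injective f) :
    len A (LinearMap.range f) = len A M := by
  rw [LinearMap.range_eq_map, len_map_of_injective hf, len_top]

theorem map_inf_comap (f : M →ₗ[A] N) (X : Submodule A M) (Y : Submodule A N) :
    (X ⊓ Y.comap f).map f = X.map f ⊓ Y := by
  refine le_antisymm (le_inf (Submodule.map_mono inf_le_left) ?_) ?_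
  · exact (Submodule.map_mono inf_le_right).trans (Submodule.map_comap_le f Y)
  · rintro _ ⟨⟨x, hx, rfl⟩, hy⟩
    exact ⟨x, ⟨hx, hy⟩, rfl⟩

theorem len_add_of_isCompl {X Y : Submodule A M} (hs : X ⊔ Y = ⊤) (hi : X ⊓ Y = ⊥) :
    len A X + len A Y = len A M := by
  rw [← len_sup_add_inf, hs, hi, len_top, len_bot, add_zero]

theorem exists_projections {X Y : Submodule A M} (hs : X ⊔ Y = ⊤) (hi : X ⊓ Y = ⊥) :
    ∃ p q : M →ₗ[A] M, (∀ m, p m ∈ X) ∧ (∀ m, q m ∈ Y) ∧ (∀ m, p m + q m = m) ∧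
      (∀ m ∈ X, p m = m ∧ q m = 0) ∧ (∀ m ∈ Y, p m = 0 ∧ q m = m) := by
  have h : IsCompl X Y := ⟨disjoint_iff.2 hi, codisjoint_iff.2 hs⟩
  refine ⟨X.projection Y h, Y.projection X h.symm, Submodule.projection_apply_mem h,
    Submodule.projection_apply_mem h.symm, Submodule.projection_add_projection_eq_self h,
    fun m hm => ⟨Submodule.projection_apply_of_mem_left h hm, ?_⟩,
    fun m hm => ⟨?_, Submodule.projection_apply_of_mem_left h.symm hm⟩⟩
  · exact Submodule.projection_apply_right h.symm ⟨m, hm⟩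
  · exact Submodule.projection_apply_right h ⟨m, hm⟩

theorem not_le_jacobson_of_isCompl {X Y : Submodule A M} (hs : X ⊔ Y = ⊤) (hi : X ⊓ Y = ⊥)
    (hX : X ≠ ⊥) : ¬ X ≤ jacobson A M := fun h => by
  have := eq_top_of_sup_jacobson h (sup_comm X Y ▸ hs)
  rw [this, inf_top_eq] at hi
  exact hX hi

/-- A homomorphism from a uniserial module is injective if it is so on a simple submodule. -/
theorem injective_of_comp_injective {S : Type u} [AddCommGroup S] [Module A S]
    [Module.Finite A S] (hM : IsUniserial A M) (hS : len A S = 1) {j : S →ₗ[A] M}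
    (hj : Function.Injective j) {f : M →ₗ[A] N} (hf : Function.Injective (f.comp j)) :
    Function.Injective f := by
  rw [← LinearMap.ker_eq_bot]
  by_contra h
  obtain ⟨Z, hZ, hZl⟩ := exists_atom_le h
  have h1 : len A (LinearMap.range j) = 1 := (len_range_of_injective hj).trans hS
  have h2 : Z = LinearMap.range j := eq_of_isUniserial hM (hZl.trans h1.symm)
  have h3 : (⊤ : Submodule A S) = ⊥ := by
    rw [← LinearMap.ker_eq_bot.2 hf, eq_comm, eq_top_iff]
    intro s _
    exact hZ (h2 ▸ LinearMap.mem_range_self j s)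
  rw [← len_top, h3, len_bot] at hS
  omega

/-- An epimorphism with simple kernel onto a local module splits unless its source is local. -/
theorem isLocal_or_exists_section (hN : IsLocalModule A N) {f : M →ₗ[A] N}
    (hf : Function.Surjective f) (hk : len A (LinearMap.ker f) = 1) :
    IsLocalModule A M ∨ ∃ σ : N →ₗ[A] M, ∀ n, f (σ n) = n := by
  by_contra! h
  obtain ⟨hM, hσ⟩ := h
  have hlN := len_jacobson_of_isLocal hN
  have hlM := len_range_add_ker f
  rw [LinearMap.range_eq_top.2 hf, len_top] at hlM
  refine hM (isLocal_of_forall_coatom (J := (jacobson A N).comap f) ?_ fun K hK => ?_)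
  · rw [len_comap hf]; omega
  rcases disjoint_or_le (X := K) hk with h | h
  · exfalso
    have hinj : Function.Injective (f.comp K.subtype) := by
      rw [← LinearMap.ker_eq_bot, LinearMap.ker_comp, ← Submodule.disjoint_iff_comap_eq_bot,
        disjoint_iff, inf_comm, h]
    have hb := bijective_of_injective_of_len hinj (by omega)
    obtain ⟨n, hn⟩ := hσ (K.subtype.comp (LinearEquiv.ofBijective _ hb).symm.toLinearMap)
    exact hn ((LinearEquiv.ofBijective _ hb).apply_symm_apply n)
  · rw [← coatom_eq_jacobson hN (C := K.map f), Submodule.comap_map_eq_self h]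
    have := len_map_add f K
    rw [inf_eq_left.2 h] at this
    omega

/-- Extension of homomorphisms along the socle of a uniserial module `Q` of length two, into a
local module whose radical has no bad decomposition. -/
theorem IsFourNakayama.exists_extension (hA : IsFourNakayama A) {Q S : Type u}
    [AddCommGroup Q] [Module A Q] [Module.Finite A Q]
    [AddCommGroup S] [Module A S] [Module.Finite A S]
    (hM : IsLocalModule A M) (hl : 4 ≤ len A M) (hQl : len A Q = 2)
    (hS : len A S = 1) (i : S →ₗ[A] M) (hi : Function.Injective i) (j : S →ₗ[A] Q)
    (hj : Function.Injective j)
    (hdec : ∀ Y₁ Y₂ : Submodule A M, Y₁ ⊔ Y₂ = jacobson A M → Y₁ ⊓ Y₂ = ⊥ → Y₁ ≠ ⊥ → Y₂ ≠ ⊥ →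
      (LinearMap.range i ≤ Y₁ ∧ 2 ≤ len A Y₁) ∨ (LinearMap.range i ≤ Y₂ ∧ 2 ≤ len A Y₂)) :
    ∃ h : Q →ₗ[A] M, ∀ s, h (j s) = i s := by
  have hlJ := len_jacobson_of_isLocal hM
  have hri : len A (LinearMap.range i) = 1 := (len_range_of_injective hi).trans hS
  have hiJ : LinearMap.range i ≤ jacobson A M := atom_le_jacobson_of_isLocal hM (by omega) hri
  -- the pushout
  let W : Submodule A (M × Q) := LinearMap.range (i.prod (-j))
  have hWl : len A W = 1 := by
    refine (len_range_of_injective fun a b hab => ?_).trans hS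
    exact hi (congrArg Prod.fst hab)
  let X := (M × Q) ⧸ W
  let ι₁ : M →ₗ[A] X := W.mkQ.comp (LinearMap.inl A M Q)
  let ι₂ : Q →ₗ[A] X := W.mkQ.comp (LinearMap.inr A M Q)
  have hXl : len A X = len A M + 1 := by
    have h1 := len_quot_add W
    rw [len_prod, hWl, hQl] at h1
    have h2 : len A X = len A ((M × Q) ⧸ W) := rfl
    omega
  have hι : ∀ s, ι₁ (i s) = ι₂ (j s) := fun s => by
    refine (Submodule.Quotient.eq W).2 ⟨s, ?_⟩
    simp
  have hιeq : ∀ m q, ι₁ m = ι₂ q → ∃ s, m = i s ∧ q = j s := fun m q h => by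
    obtain ⟨s, hs⟩ := (Submodule.Quotient.eq W).1 h
    refine ⟨s, ?_, ?_⟩
    · simpa using (congrArg Prod.fst hs).symm
    · simpa using (congrArg Prod.snd hs).symm
  have hι₁ : Function.Injective ι₁ := by
    rw [injective_iff_map_eq_zero]
    intro m hm
    obtain ⟨s, rfl, hs⟩ := hιeq m 0 (by rw [hm, map_zero])
    rw [hj (by rw [← hs, map_zero] : j s = j 0), map_zero]
  have hι₂ : Function.Injective ι₂ := by
    rw [injective_iff_map_eq_zero]
    intro q hq
    obtain ⟨s, hs, rfl⟩ := hιeq 0 q (by rw [hq, map_zero])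
    rw [hi (by rw [← hs, map_zero] : i s = i 0), map_zero]
  have hsurj : LinearMap.range ι₁ ⊔ LinearMap.range ι₂ = ⊤ := by
    rw [eq_top_iff]
    rintro x -
    obtain ⟨⟨m, q⟩, rfl⟩ := W.mkQ_surjective x
    rw [Submodule.mem_sup]
    refine ⟨_, ⟨m, rfl⟩, _, ⟨q, rfl⟩, ?_⟩
    simp only [ι₁, ι₂, LinearMap.comp_apply, ← map_add]
    simp
  set R₁ := LinearMap.range ι₁ with hR₁
  set R₂ := LinearMap.range ι₂ with hR₂
  have hR₁l : len A R₁ = len A M := len_range_of_injective hι₁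
  have hR₂l : len A R₂ = 2 := (len_range_of_injective hι₂).trans hQl
  set U := (LinearMap.range i).map ι₁ with hU
  have hUl : len A U = 1 := by rw [hU, len_map_of_injective hι₁, hri]
  have hUR₂ : U ≤ R₂ := by
    rintro _ ⟨_, ⟨s, rfl⟩, rfl⟩
    exact ⟨j s, (hι s).symm⟩
  -- its radical
  set N := (jacobson A M).map ι₁ with hN
  have hNl : len A N + 1 = len A M := by rw [hN, len_map_of_injective hι₁, hlJ]
  have hUN : U ≤ N := Submodule.map_mono hiJ
  have hNR₁ : N ≤ R₁ := LinearMap.map_le_range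
  have hNR₂ : N ⊓ R₂ = U := by
    refine le_antisymm ?_ (le_inf hUN hUR₂)
    rintro _ ⟨⟨m, -, rfl⟩, ⟨q, hq⟩⟩
    obtain ⟨s, rfl, -⟩ := hιeq m q hq.symm
    exact ⟨_, ⟨s, rfl⟩, rfl⟩
  have hC : len A (N ⊔ R₂ : Submodule A X) = len A M := by
    have := len_sup_add_inf N R₂
    rw [hNR₂] at this
    omega
  have hR₁C : R₁ ⊔ (N ⊔ R₂) = ⊤ := by rw [← sup_assoc, sup_eq_left.2 hNR₁, hsurj]
  -- The radical contains N because N is the image of a radical. It is contained in N because N is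
  -- the intersection of the two maximal submodules R₁ and N + R₂.
  have hJX : jacobson A X = N := by
    refine le_antisymm ?_ (Module.map_jacobson_le _)
    have h1 : len A (R₁ ⊓ (N ⊔ R₂) : Submodule A X) = len A N := by
      have := len_sup_add_inf R₁ (N ⊔ R₂)
      rw [hR₁C, len_top] at this
      omega
    rw [eq_of_le_of_len_le (le_inf hNR₁ le_sup_left) h1.le]
    exact le_inf (jacobson_le_of_len (by omega)) (jacobson_le_of_len (by omega))
  have hnl : ¬ IsLocalModule A X := by
    refine not_isLocal_of_coatoms (C := R₁) (D := N ⊔ R₂) (by omega) (by omega) fun h => ?_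
    rw [← h, sup_idem] at hR₁C
    rw [hR₁C, len_top] at hR₁l
    omega
  have hR₂N : ¬ R₂ ≤ N := fun h => by
    rw [sup_eq_left.2 h] at hC
    omega
  -- The pushout has length `len A M + 1`, which is at least five by `hl`.
  obtain ⟨X₁, X₂, hs, hd, hX₁, hX₂⟩ := hA.exists_decomposition (M := X) (by omega) hnl
  -- the induced decomposition of the radical
  have hY : ∀ X₁ X₂ : Submodule A X, X₁ ⊔ X₂ = ⊤ → X₁ ⊓ X₂ = ⊥ →
      (jacobson A M ⊓ X₁.comap ι₁) ⊔ (jacobson A M ⊓ X₂.comap ι₁) = jacobson A M ∧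
      (jacobson A M ⊓ X₁.comap ι₁) ⊓ (jacobson A M ⊓ X₂.comap ι₁) = ⊥ := by
    intro X₁ X₂ hs hd
    obtain ⟨p, q, hp, hq, hpq, -, -⟩ := exists_projections hs hd
    constructor
    · refine le_antisymm (sup_le inf_le_left inf_le_left) fun m hm => ?_
      have hmem : ∀ e : X →ₗ[A] X, ∃ y ∈ jacobson A M, ι₁ y = e (ι₁ m) := fun e => by
        have h1 : e (ι₁ m) ∈ jacobson A X :=
          Module.map_jacobson_le e (Submodule.mem_map_of_mem
            (Module.map_jacobson_le ι₁ (Submodule.mem_map_of_mem hm)))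
        rw [hJX] at h1
        exact h1
      obtain ⟨y, hy, hyp⟩ := hmem p
      obtain ⟨z, hz, hzq⟩ := hmem q
      refine Submodule.mem_sup.2 ⟨y, ⟨hy, ?_⟩, z, ⟨hz, ?_⟩, hι₁ ?_⟩
      · change ι₁ y ∈ X₁
        rw [hyp]
        exact hp _
      · change ι₁ z ∈ X₂
        rw [hzq]
        exact hq _
      · rw [map_add, hyp, hzq, hpq]
    · rw [eq_bot_iff]
      rintro m ⟨⟨-, h1⟩, -, h2⟩
      have h3 : ι₁ m ∈ X₁ ⊓ X₂ := ⟨h1, h2⟩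
      rw [hd, Submodule.mem_bot] at h3
      exact hι₁ (h3.trans (map_zero _).symm)
  -- If X₂ has no share of the radical of M, then it misses R₁, since every simple submodule of the
  -- local module M lies in the radical. As R₁ has colength one, X = R₁ ⊕ X₂, and the projection to
  -- R₁ ≅ M, restricted to Q, is the extension.
  have split : ∀ X₁ X₂ : Submodule A X, X₁ ⊔ X₂ = ⊤ → X₁ ⊓ X₂ = ⊥ → X₂ ≠ ⊥ →
      jacobson A M ⊓ X₂.comap ι₁ = ⊥ → ∃ h : Q →ₗ[A] M, ∀ s, h (j s) = i s := by
    intro X₁ X₂ hs hd hX₂ hb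
    have h1 : R₁ ⊓ X₂ = ⊥ := by
      by_contra h
      obtain ⟨Z, hZ, hZl⟩ := exists_atom_le h
      have h2 : (Z.comap ι₁).map ι₁ = Z := by
        rw [Submodule.map_comap_eq, inf_eq_right.2 (hZ.trans inf_le_left)]
      have h3 : len A (Z.comap ι₁) = 1 := by rw [← len_map_of_injective hι₁, h2, hZl]
      have h4 : Z.comap ι₁ ≤ ⊥ := hb ▸ le_inf (atom_le_jacobson_of_isLocal hM (by omega) h3)
        (Submodule.comap_mono (hZ.trans inf_le_right))
      rw [le_bot_iff.1 h4, len_bot] at h3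
      omega
    have h2 := len_sup_add_inf R₁ X₂
    rw [h1, len_bot] at h2
    have h3 := len_pos_of_ne_bot hX₂
    have h4 := len_le (R₁ ⊔ X₂)
    have hc : IsCompl R₁ X₂ :=
      ⟨disjoint_iff.2 h1, codisjoint_iff.2 (eq_top_of_len (by omega))⟩
    refine ⟨(LinearMap.linearProjOfIsCompl X₂ ι₁ hι₁ hc).comp ι₂, fun s => ?_⟩
    rw [LinearMap.comp_apply, ← hι, LinearMap.linearProjOfIsCompl_apply_left]
  by_cases hb₂ : jacobson A M ⊓ X₂.comap ι₁ = ⊥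
  · exact split X₁ X₂ hs hd hX₂ hb₂
  by_cases hb₁ : jacobson A M ⊓ X₁.comap ι₁ = ⊥
  · exact split X₂ X₁ (sup_comm X₁ X₂ ▸ hs) (inf_comm X₁ X₂ ▸ hd) hX₁ hb₁
  exfalso
  -- Now each summand is one longer than its share of the radical, so X₁ has length at least 3 and
  -- X₂ at least 2. As R₂ is not in the radical N, one of p(R₂), q(R₂) is not in N. Since N ∩ Xₖ is
  -- maximal in Xₖ, Nakayama's lemma makes that image the whole summand. But p(R₂) has length at
  -- most 2, and q(R₂) at most 1 because q kills U.
  have main : ∀ X₁ X₂ : Submodule A X, X₁ ⊔ X₂ = ⊤ → X₁ ⊓ X₂ = ⊥ → X₁ ≠ ⊥ → X₂ ≠ ⊥ →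
      jacobson A M ⊓ X₂.comap ι₁ ≠ ⊥ → LinearMap.range i ≤ jacobson A M ⊓ X₁.comap ι₁ →
      2 ≤ len A (jacobson A M ⊓ X₁.comap ι₁ : Submodule A M) → False := by
    intro X₁ X₂ hs hd hX₁ hX₂ hb hi₁ h2
    obtain ⟨hYs, hYd⟩ := hY X₁ X₂ hs hd
    have e1 := len_sup_add_inf (jacobson A M ⊓ X₁.comap ι₁) (jacobson A M ⊓ X₂.comap ι₁)
    rw [hYs, hYd, len_bot] at e1
    have e2 := len_add_of_isCompl hs hd
    have e3 := len_pos_of_ne_bot hb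
    have hmap : ∀ X' : Submodule A X, (jacobson A M ⊓ X'.comap ι₁).map ι₁ = N ⊓ X' := fun X' => by
      rw [map_inf_comap]
    have hlt : ∀ X' Y' : Submodule A X, X' ⊔ Y' = ⊤ → X' ⊓ Y' = ⊥ → X' ≠ ⊥ →
        len A (jacobson A M ⊓ X'.comap ι₁ : Submodule A M) < len A X' := fun X' Y' hs hd hX' => by
      rw [← len_map_of_injective hι₁, hmap]
      refine len_lt_of_lt (inf_le_right.lt_of_ne fun h => ?_)
      exact not_le_jacobson_of_isCompl hs hd hX' (hJX ▸ inf_eq_right.1 h)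
    have e4 := hlt X₁ X₂ hs hd hX₁
    have e5 := hlt X₂ X₁ (sup_comm X₁ X₂ ▸ hs) (inf_comm X₁ X₂ ▸ hd) hX₂
    obtain ⟨p, q, hp, hq, hpq, hpX, -⟩ := exists_projections hs hd
    by_cases hpN : R₂.map p ≤ N
    · have hqN : ¬ R₂.map q ≤ N := fun h => hR₂N fun x hx => by
        rw [← hpq x]
        exact N.add_mem (hpN ⟨x, hx, rfl⟩) (h ⟨x, hx, rfl⟩)
      have hU0 : U ≤ LinearMap.ker q := by
        rintro _ ⟨m, hm, rfl⟩
        exact (hpX _ (hi₁ hm).2).2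
      have e6 := len_map_add q R₂
      have e7 := len_mono (le_inf hU0 hUR₂)
      have hle : N ⊓ X₂ ⊔ R₂.map q = X₂ := by
        refine eq_of_le_of_len_le (sup_le inf_le_right ?_) ?_
        · rintro _ ⟨x, -, rfl⟩; exact hq x
        · have h8 := len_lt_of_lt (lt_of_le_of_ne (le_sup_left : N ⊓ X₂ ≤ N ⊓ X₂ ⊔ R₂.map q)
            fun h => hqN ((le_sup_right.trans h.ge).trans inf_le_left))
          rw [← hmap, len_map_of_injective hι₁, hmap] at h8
          omega
      have htop : (X₁ ⊔ R₂.map q) ⊔ N ⊓ X₂ = ⊤ := by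
        rw [sup_assoc, sup_comm (R₂.map q), hle, hs]
      have h9 := eq_top_of_sup_jacobson (hJX ▸ inf_le_left) htop
      have h10 := len_sup_add_inf X₁ (R₂.map q)
      rw [h9, len_top] at h10
      omega
    · have e6 := len_map_le p R₂
      have hle : N ⊓ X₁ ⊔ R₂.map p = X₁ := by
        refine eq_of_le_of_len_le (sup_le inf_le_right ?_) ?_
        · rintro _ ⟨x, -, rfl⟩; exact hp x
        · have h8 := len_lt_of_lt (lt_of_le_of_ne (le_sup_left : N ⊓ X₁ ≤ N ⊓ X₁ ⊔ R₂.map p)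
            fun h => hpN ((le_sup_right.trans h.ge).trans inf_le_left))
          rw [← hmap, len_map_of_injective hι₁, hmap] at h8
          omega
      have htop : (X₂ ⊔ R₂.map p) ⊔ N ⊓ X₁ = ⊤ := by
        rw [sup_assoc, sup_comm (R₂.map p), hle, sup_comm, hs]
      have h9 := eq_top_of_sup_jacobson (hJX ▸ inf_le_left) htop
      have h10 := len_sup_add_inf X₂ (R₂.map p)
      rw [h9, len_top] at h10
      omega
  obtain ⟨hYs, hYd⟩ := hY X₁ X₂ hs hd
  rcases hdec _ _ hYs hYd hb₁ hb₂ with ⟨h, h2⟩ | ⟨h, h2⟩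
  · exact main X₁ X₂ hs hd hX₁ hX₂ hb₂ h h2
  · exact main X₂ X₁ (sup_comm X₁ X₂ ▸ hs) (inf_comm X₁ X₂ ▸ hd) hX₂ hX₁ hb₁ h h2

end Extension

/-! ### Local modules: uniserial radicals, and the maximal submodules of the radical. -/

section LocalModules

variable {A : Type u} [Ring A] [IsArtinianRing A]
variable {M N : Type u} [AddCommGroup M] [Module A M] [Module.Finite A M]
  [AddCommGroup N] [Module A N] [Module.Finite A N]

/-- The map of subquotients `X/K → M/C` for `K ≤ C`. -/
noncomputable def subquotMap (K C X : Submodule A M) (h : K ≤ C) :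
    X.map K.mkQ →ₗ[A] M ⧸ C :=
  (Submodule.factor h).comp (X.map K.mkQ).subtype

theorem subquotMap_injective {K C X : Submodule A M} (h : K ≤ C) (hX : C ⊓ X ≤ K) :
    Function.Injective (subquotMap K C X h) := by
  rw [injective_iff_map_eq_zero]
  rintro ⟨_, x, hx, rfl⟩ h0
  have h1 : Submodule.factor h (K.mkQ x) = 0 := h0
  have h2 : x ∈ C := (Submodule.Quotient.mk_eq_zero C).1 h1
  ext
  exact (Submodule.Quotient.mk_eq_zero K).2 (hX ⟨h2, hx⟩)

theorem subquotMap_mem {K C X Y : Submodule A M} (h : K ≤ C) (hXY : X ≤ Y) (x : X.map K.mkQ) :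
    subquotMap K C X h x ∈ Y.map C.mkQ := by
  obtain ⟨_, x, hx, rfl⟩ := x
  exact ⟨x, hXY hx, rfl⟩

/-- A local module with local radical is uniserial. -/
theorem IsFourNakayama.isUniserial_of_isLocal_jacobson (hA : IsFourNakayama A) (n : ℕ) :
    ∀ (M : Type u) [AddCommGroup M] [Module A M] [Module.Finite A M], len A M = n →
      IsLocalModule A M → IsLocalModule A (jacobson A M) → IsUniserial A M := by
  induction n using Nat.strong_induction_on with
  | _ n ih =>
  intro M _ _ _ hn hM hJ
  have hlJ := len_jacobson_of_isLocal hM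
  by_cases hJu : IsUniserial A (jacobson A M)
  · exact isUniserial_of_jacobson hM hJu
  exfalso
  set J := jacobson A M with hJdef
  have hJJ : ¬ IsLocalModule A (jacobson A J) := fun h => hJu (ih _ (by omega) J rfl hJ h)
  have hlJJ := len_jacobson_of_isLocal hJ
  have hb : jacobson A J ≠ ⊥ := fun h => hJu
    (isUniserial_of_len_le_one (by rw [h, len_bot] at hlJJ; omega))
  obtain ⟨C', hC', D', hD', hC'l, hD'l, hne'⟩ := exists_coatoms_sub_of_not_isLocal hb hJJ
  have inj := J.injective_subtype
  -- everything as submodules of `M`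
  obtain ⟨L, hL⟩ : ∃ L, L = (jacobson A J).map J.subtype := ⟨_, rfl⟩
  obtain ⟨C, hC⟩ : ∃ C, C = C'.map J.subtype := ⟨_, rfl⟩
  obtain ⟨D, hD⟩ : ∃ D, D = D'.map J.subtype := ⟨_, rfl⟩
  have hLl : len A L = len A (jacobson A J) := by rw [hL, len_map_of_injective inj]
  have hCl : len A C = len A C' := by rw [hC, len_map_of_injective inj]
  have hDl : len A D = len A D' := by rw [hD, len_map_of_injective inj]
  have hCL : C ≤ L := by rw [hC, hL]; exact Submodule.map_mono hC'
  have hDL : D ≤ L := by rw [hD, hL]; exact Submodule.map_mono hD'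
  have hLJ : L ≤ J := hL ▸ J.map_subtype_le _
  have hne : C ≠ D := by
    rw [hC, hD]
    exact fun h => hne' (Submodule.map_injective_of_injective inj h)
  have hLmax : ∀ Y ≤ J, len A Y + 1 = len A J → Y = L := by
    intro Y hY hYl
    have h1 := coatom_eq_jacobson hJ (C := Y.comap J.subtype) (by rw [len_comap_subtype hY, hYl])
    rw [hL, ← h1, Submodule.map_comap_subtype, inf_eq_right.2 hY]
  -- Modulo K the module has length four, and L becomes the sum of the distinct simple modules C/K
  -- and D/K.
  set K := C ⊓ D with hK
  have hKC : K ≤ C := inf_le_left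
  have hKl : len A K + 2 = len A L := by
    have h1 := len_sup_add_inf C D
    have h2 := len_mono (sup_le hCL hDL)
    have h3 := len_lt_of_lt (left_lt_sup.2 fun h => hne
      (eq_of_le_of_len_le h (by omega)).symm : C < C ⊔ D)
    rw [← hK] at h1
    omega
  have hKJ : K ≤ J := hKC.trans (hCL.trans hLJ)
  have hPl := len_quot_add K
  have : Nontrivial (M ⧸ K) := Submodule.Quotient.nontrivial_iff.2 fun h => by
    rw [h, len_top] at hKl; omega
  have hP : IsLocalModule A (M ⧸ K) := isLocal_of_surjective K.mkQ_surjective hM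
  have hJP : jacobson A (M ⧸ K) = J.map K.mkQ := Module.jacobson_quotient_of_le hKJ
  have hQl := len_mapQ_add (hCL.trans hLJ)
  have hSl : len A (D.map K.mkQ) + len A K = len A D := len_mapQ_add inf_le_right
  have hJKl := len_mapQ_add hKJ
  have hind : IsIndecomposableModule A (J.map K.mkQ) := by
    have : Nontrivial (J.map K.mkQ) := Submodule.nontrivial_iff_ne_bot.2 fun h => by
      rw [h, len_bot] at hJKl; omega
    exact isIndecomposable_of_isLocal
      (isLocal_of_surjective (K.mkQ.submoduleMap_surjective J) hJ)
  have hQ : IsUniserial A (J.map C.mkQ) := by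
    have : Nontrivial (J.map C.mkQ) := Submodule.nontrivial_iff_ne_bot.2 fun h => by
      rw [h, len_bot] at hQl; omega
    exact isUniserial_of_isLocal_of_len_two
      (isLocal_of_surjective (C.mkQ.submoduleMap_surjective J) hJ) (by omega)
  let j : D.map K.mkQ →ₗ[A] J.map C.mkQ :=
    (subquotMap K C D hKC).codRestrict _ (subquotMap_mem hKC (hDL.trans hLJ))
  have hj : Function.Injective j := by
    have := subquotMap_injective hKC hK.ge
    exact fun a b hab => this (congrArg Subtype.val hab)
  -- The inclusion of D/K into M/K is extended along D/K → J/C, the socle of a uniserial module of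
  -- length two. The condition on decompositions is vacuous: J/K is local, hence indecomposable.
  obtain ⟨h, hh⟩ := hA.exists_extension (Q := J.map C.mkQ) hP (by omega) (by omega)
    (by omega) (D.map K.mkQ).subtype (D.map K.mkQ).injective_subtype j hj (by
      intro Y₁ Y₂ hs hd h1 h2
      rw [hJP] at hs
      exact absurd ((isIndecomposable_sub_iff.1 hind).2 Y₁ Y₂ hs hd) (by tauto))
  have hinj : Function.Injective h := by
    refine injective_of_comp_injective hQ (by omega : len A (D.map K.mkQ) = 1) hj ?_
    convert (D.map K.mkQ).injective_subtype using 1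
    exact funext hh
  have hYl := len_range_of_injective hinj
  set Y := LinearMap.range h with hY
  have hYJ : Y ≤ J.map K.mkQ := hJP ▸ le_jacobson_of_isLocal hP fun h => by
    rw [h, len_top] at hYl; omega
  have hY'l := len_comap K.mkQ_surjective Y
  rw [Submodule.ker_mkQ] at hY'l
  have hY'J : Y.comap K.mkQ ≤ J := by
    have := Submodule.comap_mono (f := K.mkQ) hYJ
    rwa [Submodule.comap_map_mkQ, sup_eq_right.2 hKJ] at this
  -- The preimage of the image Y is maximal in J, so it is L. Thus L/K = Y would be uniserial,
  -- although it contains two distinct simple submodules.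
  have hY'L := hLmax _ hY'J (by omega)
  have hYL : Y = L.map K.mkQ := by
    rw [← hY'L, Submodule.map_comap_eq_of_surjective K.mkQ_surjective]
  have hYu : IsUniserial A Y :=
    isUniserial_of_surjective h.surjective_rangeRestrict hQ
  have h1 := len_mapQ_add hKC
  have h2 := eq_of_isUniserial_of_len hYu (hYL ▸ Submodule.map_mono hCL)
    (hYL ▸ Submodule.map_mono hDL) (by omega : len A (C.map K.mkQ) = len A (D.map K.mkQ))
  have h3 := congrArg (Submodule.comap K.mkQ) h2
  rw [Submodule.comap_map_mkQ, Submodule.comap_map_mkQ, sup_eq_right.2 hKC,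
    sup_eq_right.2 (inf_le_right : K ≤ D)] at h3
  exact hne h3

theorem IsFourNakayama.not_isLocal_jacobson (hA : IsFourNakayama A) (hM : IsLocalModule A M)
    (hu : ¬ IsUniserial A M) : ¬ IsLocalModule A (jacobson A M) := fun h =>
  hu (hA.isUniserial_of_isLocal_jacobson _ M rfl hM h)

/-- Factor serial modules over a four-Nakayama ring. -/
theorem IsFourNakayama.isFactorSerial_cases (hA : IsFourNakayama A) [Nontrivial M] {n : ℕ}
    (hn : 2 ≤ n) (h : IsFactorSerial n A M) :
    (¬ IsLocalModule A M ∧ len A M = n) ∨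
      (IsLocalModule A M ∧ ¬ IsUniserial A M ∧ len A M = n + 1) := by
  rcases NakayamaFour.isFactorSerial_cases hn h with h | ⟨hM, hu, k, hk, hl, hs⟩
  · exact Or.inl h
  refine Or.inr ⟨hM, hu, ?_⟩
  rcases (by omega : k = 1 ∨ 2 ≤ k) with rfl | hk
  · omega
  -- For k ≥ 2 both maximal submodules of the radical contain radᵏ, and neither contains the other.
  exfalso
  have hlJ := len_jacobson_of_isLocal hM
  have hb : jacobson A M ≠ ⊥ := fun h => by rw [h, len_bot] at hlJ; omega
  obtain ⟨C, hC, D, hD, hCl, hDl, hne⟩ :=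
    exists_coatoms_sub_of_not_isLocal hb (hA.not_isLocal_jacobson hM hu)
  exact not_isUniserial_quot ((radPow_antitone hk).trans (radPow_two_le hC hCl))
    ((radPow_antitone hk).trans (radPow_two_le hD hDl)) (by omega) hne hs

/-- Companion of the bound for non-local modules: index at most four now means length at most five.
-/
theorem IsFourNakayama.len_le_of_isLocal (hA : IsFourNakayama A) (hM : IsLocalModule A M)
    (hu : ¬ IsUniserial A M) : len A M ≤ 5 := by
  have := nontrivial_of_isLocal hM
  obtain ⟨i, hi, hi4, hs⟩ :=
    hA.factorSerial M inferInstance (isIndecomposable_of_isLocal hM)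
  rcases (by omega : i = 1 ∨ 2 ≤ i) with rfl | hi
  · rcases hs with ⟨-, hs⟩ | ⟨hi, -⟩
    · exact absurd hs hu
    · omega
  · rcases hA.isFactorSerial_cases hi hs with h | h
    · exact absurd hM h.1
    · omega

/-! ### Gluing local modules along their radicals -/

theorem isSimple_quot_jacobson (hM : IsLocalModule A M) : IsSimpleModule A (M ⧸ jacobson A M) := by
  rw [isSimpleModule_iff_isCoatom, isCoatom_iff_len, len_jacobson_of_isLocal hM]

/-- Homomorphisms from a local module to its top are central multiples of the projection. -/
theorem IsFourNakayama.exists_scalar_top (hA : IsFourNakayama A) (hM : IsLocalModule A M)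
    (f : M →ₗ[A] M ⧸ jacobson A M) :
    ∃ a : Subsemiring.center A, ∀ m, f m = a • (jacobson A M).mkQ m := by
  have := isSimple_quot_jacobson hM
  obtain ⟨a, ha⟩ := hA.scalar _ ((jacobson A M).liftQ f fun x hx => map_jacobson_eq_bot f hx)
  exact ⟨a, fun m => ha ((jacobson A M).mkQ m)⟩

/-- A central element acts on a local module bijectively, or it maps the module to its radical. -/
theorem central_smul_cases (hM : IsLocalModule A M) (a : Subsemiring.center A) :
    (∀ m : M, a • m ∈ jacobson A M) ∨ Function.Bijective (centralMul M a) := by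
  by_cases h : LinearMap.range (centralMul M a) ≤ jacobson A M
  · exact Or.inl fun m => h ⟨m, rfl⟩
  · exact Or.inr (bijective_of_surjective_of_len (range_eq_top_of_not_le_jacobson hM h) le_rfl)

variable {M₁ M₂ V : Type u} [AddCommGroup M₁] [Module A M₁] [Module.Finite A M₁]
  [AddCommGroup M₂] [Module A M₂] [Module.Finite A M₂]
  [AddCommGroup V] [Module A V] [Module.Finite A V]

/-- Two local modules can be glued along homomorphisms from their radicals to a semisimple
module of length three only if some homomorphism to the result has small image. -/
theorem IsFourNakayama.false_of_glue (hA : IsFourNakayama A)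
    (hM₁ : IsLocalModule A M₁) (hM₂ : IsLocalModule A M₂) [IsSemisimpleModule A V]
    (hV : len A V = 3) (φ₁ : jacobson A M₁ →ₗ[A] V) (φ₂ : jacobson A M₂ →ₗ[A] V)
    (hφ : ∀ v, ∃ x y, φ₁ x + φ₂ y = v)
    (H₁ : ∀ (f₁ : M₁ →ₗ[A] M₁ ⧸ jacobson A M₁) (f₂ : M₁ →ₗ[A] M₂ ⧸ jacobson A M₂),
      ¬ (f₁ = 0 ∧ f₂ = 0) → ∃ (g₁ : M₁ →ₗ[A] M₁) (g₂ : M₁ →ₗ[A] M₂)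
        (h₁ : ∀ x ∈ jacobson A M₁, g₁ x ∈ jacobson A M₁)
        (h₂ : ∀ x ∈ jacobson A M₁, g₂ x ∈ jacobson A M₂),
        (∀ m, f₁ m = (jacobson A M₁).mkQ (g₁ m)) ∧ (∀ m, f₂ m = (jacobson A M₂).mkQ (g₂ m)) ∧
        2 ≤ len A (LinearMap.range (φ₁.comp (g₁.restrict h₁) + φ₂.comp (g₂.restrict h₂))))
    (H₂ : ∀ (f₁ : M₂ →ₗ[A] M₁ ⧸ jacobson A M₁) (f₂ : M₂ →ₗ[A] M₂ ⧸ jacobson A M₂),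
      ¬ (f₁ = 0 ∧ f₂ = 0) → ∃ (g₁ : M₂ →ₗ[A] M₁) (g₂ : M₂ →ₗ[A] M₂)
        (h₁ : ∀ x ∈ jacobson A M₂, g₁ x ∈ jacobson A M₁)
        (h₂ : ∀ x ∈ jacobson A M₂, g₂ x ∈ jacobson A M₂),
        (∀ m, f₁ m = (jacobson A M₁).mkQ (g₁ m)) ∧ (∀ m, f₂ m = (jacobson A M₂).mkQ (g₂ m)) ∧
        2 ≤ len A (LinearMap.range (φ₁.comp (g₁.restrict h₁) + φ₂.comp (g₂.restrict h₂)))) :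
    False := by
  have hl₁ := len_jacobson_of_isLocal hM₁
  have hl₂ := len_jacobson_of_isLocal hM₂
  have hT₁ := isSimple_quot_jacobson hM₁
  have hT₂ := isSimple_quot_jacobson hM₂
  -- X is M₁ × M₂ modulo the kernel of rad M₁ × rad M₂ → V. It contains a copy N of V, of length
  -- three, with quotient the two simple tops, so it has length five.
  let Φ := φ₁.coprod φ₂
  have hΦ : Function.Surjective Φ := fun v => by
    obtain ⟨x, y, h⟩ := hφ v
    exact ⟨(x, y), h⟩
  let s := (jacobson A M₁).subtype.prodMap (jacobson A M₂).subtype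
  have hs : Function.Injective s :=
    (jacobson A M₁).injective_subtype.prodMap (jacobson A M₂).injective_subtype
  let W : Submodule A (M₁ × M₂) := (LinearMap.ker Φ).map s
  let X := (M₁ × M₂) ⧸ W
  have hXl : len A X = 5 := by
    have h1 := len_quot_add W
    have h2 : len A W = len A (LinearMap.ker Φ) := len_map_of_injective hs _
    have h3 := len_range_add_ker Φ
    rw [LinearMap.range_eq_top.2 hΦ, len_top, hV, len_prod] at h3
    rw [len_prod] at h1
    change len A ((M₁ × M₂) ⧸ W) = 5
    omega
  let ι₁ : M₁ →ₗ[A] X := W.mkQ.comp (LinearMap.inl A M₁ M₂)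
  let ι₂ : M₂ →ₗ[A] X := W.mkQ.comp (LinearMap.inr A M₁ M₂)
  have hι : ∀ x y, ι₁ x + ι₂ y = W.mkQ (x, y) := fun x y => by
    simp only [ι₁, ι₂, LinearMap.comp_apply, ← map_add]
    simp
  let ψ := W.mkQ.comp s
  have hψ : ∀ x y, ψ (x, y) = ι₁ x + ι₂ y := fun x y => (hι _ _).symm
  have hψ0 : ∀ z, ψ z = 0 ↔ Φ z = 0 := fun z => by
    change W.mkQ (s z) = 0 ↔ _
    rw [Submodule.mkQ_apply, Submodule.Quotient.mk_eq_zero]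
    constructor
    · rintro ⟨z', hz', h⟩
      rwa [← hs h]
    · exact fun h => ⟨z, h, rfl⟩
  set N := LinearMap.range ψ with hN
  have hNss : IsSemisimpleModule A N := by
    have hk : LinearMap.ker ψ = LinearMap.ker Φ := by ext z; exact hψ0 z
    have e := (Φ.quotKerEquivOfSurjective hΦ).symm.trans
      ((Submodule.quotEquivOfEq _ _ hk.symm).trans ψ.quotKerEquivRange)
    exact IsSemisimpleModule.congr e.symm
  let r₁ : X →ₗ[A] M₁ ⧸ jacobson A M₁ :=
    W.liftQ ((jacobson A M₁).mkQ.comp (LinearMap.fst A M₁ M₂)) (by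
      rintro _ ⟨⟨x, y⟩, -, rfl⟩
      exact (Submodule.Quotient.mk_eq_zero _).2 x.2)
  let r₂ : X →ₗ[A] M₂ ⧸ jacobson A M₂ :=
    W.liftQ ((jacobson A M₂).mkQ.comp (LinearMap.snd A M₁ M₂)) (by
      rintro _ ⟨⟨x, y⟩, -, rfl⟩
      exact (Submodule.Quotient.mk_eq_zero _).2 y.2)
  have hr₁ : ∀ x y, r₁ (ι₁ x + ι₂ y) = (jacobson A M₁).mkQ x := fun x y => by rw [hι]; rfl
  have hr₂ : ∀ x y, r₂ (ι₁ x + ι₂ y) = (jacobson A M₂).mkQ y := fun x y => by rw [hι]; rfl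
  have hX : ∀ z, ∃ x y, z = ι₁ x + ι₂ y := fun z => by
    obtain ⟨⟨x, y⟩, rfl⟩ := W.mkQ_surjective z
    exact ⟨x, y, (hι x y).symm⟩
  have hrN : ∀ z, z ∈ N ↔ r₁ z = 0 ∧ r₂ z = 0 := fun z => by
    constructor
    · rintro ⟨⟨x, y⟩, rfl⟩
      rw [hψ, hr₁, hr₂]
      exact ⟨(Submodule.Quotient.mk_eq_zero _).2 x.2, (Submodule.Quotient.mk_eq_zero _).2 y.2⟩
    · obtain ⟨x, y, rfl⟩ := hX z
      rw [hr₁, hr₂]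
      rintro ⟨hx, hy⟩
      exact ⟨(⟨x, (Submodule.Quotient.mk_eq_zero _).1 hx⟩,
        ⟨y, (Submodule.Quotient.mk_eq_zero _).1 hy⟩), hψ _ _⟩
  have hr₁s : Function.Surjective r₁ := fun t => by
    obtain ⟨x, rfl⟩ := (jacobson A M₁).mkQ_surjective t
    exact ⟨ι₁ x + ι₂ 0, hr₁ _ _⟩
  have hr₂s : Function.Surjective r₂ := fun t => by
    obtain ⟨x, rfl⟩ := (jacobson A M₂).mkQ_surjective t
    exact ⟨ι₁ 0 + ι₂ x, hr₂ _ _⟩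
  have hNJ : N ≤ jacobson A X := by
    rintro _ ⟨⟨x, y⟩, rfl⟩
    rw [hψ]
    exact add_mem (Module.map_jacobson_le ι₁ (Submodule.mem_map_of_mem x.2))
      (Module.map_jacobson_le ι₂ (Submodule.mem_map_of_mem y.2))
  have hnl : ¬ IsLocalModule A X := by
    intro h
    have e : LinearMap.ker r₁ = LinearMap.ker r₂ := by
      rw [coatom_eq_jacobson h (isCoatom_iff_len.1 (LinearMap.isCoatom_ker_of_surjective hr₁s)),
        coatom_eq_jacobson h (isCoatom_iff_len.1 (LinearMap.isCoatom_ker_of_surjective hr₂s))]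
    have := IsSimpleModule.nontrivial A (M₁ ⧸ jacobson A M₁)
    obtain ⟨t, ht⟩ := exists_ne (0 : M₁ ⧸ jacobson A M₁)
    obtain ⟨x, rfl⟩ := (jacobson A M₁).mkQ_surjective t
    have h1 : ι₁ x + ι₂ 0 ∈ LinearMap.ker r₁ := by
      rw [e, LinearMap.mem_ker, hr₂, map_zero]
    rw [LinearMap.mem_ker, hr₁] at h1
    exact ht h1
  -- homomorphisms to `X` not landing in `N` have image of length at least three
  have key : ∀ {M' : Type u} [AddCommGroup M'] [Module A M'] [Module.Finite A M']
      (_ : IsLocalModule A M') (g : M' →ₗ[A] X) (_ : ¬ LinearMap.range g ≤ N)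
      (_ : ∀ (f₁ : M' →ₗ[A] M₁ ⧸ jacobson A M₁) (f₂ : M' →ₗ[A] M₂ ⧸ jacobson A M₂),
        ¬ (f₁ = 0 ∧ f₂ = 0) → ∃ (g₁ : M' →ₗ[A] M₁) (g₂ : M' →ₗ[A] M₂)
        (h₁ : ∀ x ∈ jacobson A M', g₁ x ∈ jacobson A M₁)
        (h₂ : ∀ x ∈ jacobson A M', g₂ x ∈ jacobson A M₂),
        (∀ m, f₁ m = (jacobson A M₁).mkQ (g₁ m)) ∧ (∀ m, f₂ m = (jacobson A M₂).mkQ (g₂ m)) ∧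
        2 ≤ len A (LinearMap.range (φ₁.comp (g₁.restrict h₁) + φ₂.comp (g₂.restrict h₂)))),
      3 ≤ len A (LinearMap.range g) := by
    intro M' _ _ _ hM' g hg H
    obtain ⟨g₁, g₂, h₁, h₂, hg₁, hg₂, hlen⟩ := H (r₁.comp g) (r₂.comp g) (by
      rintro ⟨h1, h2⟩
      refine hg ?_
      rintro _ ⟨m, rfl⟩
      exact (hrN _).2 ⟨LinearMap.congr_fun h1 m, LinearMap.congr_fun h2 m⟩)
    -- The difference lands in the semisimple module N, so it kills the radical of M'. There g is
    -- the lift supplied by `H`, whose image in N ≅ V has length at least two. As g itself leaves N,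
    -- its image has length at least three.
    let d := g - (ι₁.comp g₁ + ι₂.comp g₂)
    have hd : ∀ m, d m ∈ N := fun m => by
      have e : d m = g m - (ι₁ (g₁ m) + ι₂ (g₂ m)) := rfl
      rw [hrN, e, map_sub, map_sub, hr₁, hr₂, ← hg₁, ← hg₂]
      exact ⟨sub_self _, sub_self _⟩
    have hdJ : ∀ x ∈ jacobson A M', g x = ι₁ (g₁ x) + ι₂ (g₂ x) := fun x hx => by
      have h0 := congrArg Subtype.val (map_jacobson_eq_bot (d.codRestrict N hd) hx)
      exact sub_eq_zero.1 h0
    have hgJ : (jacobson A M').map g ≤ N := by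
      rintro _ ⟨x, hx, rfl⟩
      rw [hdJ x hx]
      exact ⟨(⟨g₁ x, h₁ x hx⟩, ⟨g₂ x, h₂ x hx⟩), hψ _ _⟩
    have h1 : len A ((jacobson A M').map g) =
        len A (LinearMap.range (φ₁.comp (g₁.restrict h₁) + φ₂.comp (g₂.restrict h₂))) := by
      have e1 := len_range_add_ker (g.comp (jacobson A M').subtype)
      have e2 := len_range_add_ker (φ₁.comp (g₁.restrict h₁) + φ₂.comp (g₂.restrict h₂))
      have e3 : LinearMap.ker (g.comp (jacobson A M').subtype) =
          LinearMap.ker (φ₁.comp (g₁.restrict h₁) + φ₂.comp (g₂.restrict h₂)) := by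
        ext x
        have h4 := hψ0 (g₁.restrict h₁ x, g₂.restrict h₂ x)
        rw [hψ] at h4
        rw [LinearMap.mem_ker, LinearMap.mem_ker, LinearMap.comp_apply, Submodule.subtype_apply,
          hdJ x x.2]
        exact h4
      rw [LinearMap.range_comp, Submodule.range_subtype, e3] at e1
      omega
    have h2 : (jacobson A M').map g < LinearMap.range g :=
      lt_of_le_of_ne LinearMap.map_le_range fun h => hg (h ▸ hgJ)
    have := len_lt_of_lt h2
    omega
  obtain ⟨X₁, X₂, hs', hd', hX₁, hX₂⟩ := hA.exists_decomposition (M := X) (by omega) hnl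
  -- A nonzero summand is not in the radical, hence not in N, so its projection composed with ι₁ or
  -- ι₂ leaves N. Two summands of length at least three do not fit into length five.
  have main : ∀ X₁ X₂ : Submodule A X, X₁ ⊔ X₂ = ⊤ → X₁ ⊓ X₂ = ⊥ → X₁ ≠ ⊥ →
      3 ≤ len A X₁ := by
    intro X₁ X₂ hs hd hX₁
    obtain ⟨p, q, hp, -, -, hpX, -⟩ := exists_projections hs hd
    have hXN : ¬ X₁ ≤ N := fun h => not_le_jacobson_of_isCompl hs hd hX₁ (h.trans hNJ)
    by_cases h1 : LinearMap.range (p.comp ι₁) ≤ N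
    · have h2 : ¬ LinearMap.range (p.comp ι₂) ≤ N := fun h2 => hXN fun z hz => by
        obtain ⟨x, y, rfl⟩ := hX z
        rw [← (hpX _ hz).1, map_add]
        exact add_mem (h1 ⟨x, rfl⟩) (h2 ⟨y, rfl⟩)
      refine (key hM₂ _ h2 H₂).trans (len_mono ?_)
      rintro _ ⟨x, rfl⟩
      exact hp _
    · refine (key hM₁ _ h1 H₁).trans (len_mono ?_)
      rintro _ ⟨x, rfl⟩
      exact hp _
  have h1 := main X₁ X₂ hs' hd' hX₁
  have h2 := main X₂ X₁ (sup_comm X₁ X₂ ▸ hs') (inf_comm X₁ X₂ ▸ hd') hX₂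
  have h3 := len_add_of_isCompl hs' hd'
  omega

/-- The radical of a local module has at most two maximal submodules. -/
theorem IsFourNakayama.jacobson_coatom (hA : IsFourNakayama A) (hM : IsLocalModule A M)
    {J : Submodule A M} (hJ : J = jacobson A M)
    {C₁ C₂ C₃ : Submodule A J} (h₁ : len A C₁ + 1 = len A J)
    (h₂ : len A C₂ + 1 = len A J) (h₃ : len A C₃ + 1 = len A J)
    (h₁₂ : C₁ ≠ C₂) : C₃ = C₁ ∨ C₃ = C₂ := by
  by_contra! hne
  obtain ⟨h₃₁, h₃₂⟩ := hne
  have hscal : ∀ f : M →ₗ[A] M ⧸ J, ∃ a : Subsemiring.center A, ∀ m, f m = a • J.mkQ m := by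
    rw [hJ]; exact hA.exists_scalar_top hM
  have hcases : ∀ a : Subsemiring.center A,
      (∀ m : M, a • m ∈ J) ∨ Function.Bijective (centralMul M a) := by
    rw [hJ]; exact central_smul_cases hM
  have inst₁ : IsSimpleModule A (J ⧸ C₁) :=
    isSimpleModule_iff_isCoatom.2 (isCoatom_iff_len.2 h₁)
  have inst₂ : IsSimpleModule A (J ⧸ C₂) :=
    isSimpleModule_iff_isCoatom.2 (isCoatom_iff_len.2 h₂)
  have inst₃ : IsSimpleModule A (J ⧸ C₃) :=
    isSimpleModule_iff_isCoatom.2 (isCoatom_iff_len.2 h₃)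
  have hinf : ∀ C D : Submodule A J, len A C + 1 = len A J → len A D + 1 = len A J → C ≠ D →
      len A (C ⊓ D : Submodule A J) + 2 ≤ len A J := by
    intro C D hC hD hne
    have := len_lt_of_lt (lt_of_le_of_ne inf_le_left fun h =>
      hne (eq_of_le_of_len_le (inf_eq_left.1 h) (by omega)) : C ⊓ D < C)
    omega
  have hsurj : ∀ C D : Submodule A J, len A C + 1 = len A J → len A D + 1 = len A J → C ≠ D →
      Function.Surjective (C.mkQ.prod D.mkQ) := by
    intro C D hC hD hne
    rw [← LinearMap.range_eq_top]
    apply eq_top_of_len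
    have h1 := len_range_add_ker (C.mkQ.prod D.mkQ)
    have h2 := len_quot_add C
    have h3 := len_quot_add D
    have h4 := hinf C D hC hD hne
    rw [LinearMap.ker_prod, Submodule.ker_mkQ, Submodule.ker_mkQ] at h1
    rw [len_prod]
    omega
  let V := (J ⧸ C₁) × (J ⧸ C₂) × (J ⧸ C₃)
  have hV : len A V = 3 := by
    have e1 := len_quot_add C₁
    have e2 := len_quot_add C₂
    have e3 := len_quot_add C₃
    change len A ((J ⧸ C₁) × (J ⧸ C₂) × (J ⧸ C₃)) = 3
    rw [len_prod, len_prod]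
    omega
  have hss : IsSemisimpleModule A V := by
    rw [← jacobson_eq_bot_iff, eq_bot_iff]
    rintro ⟨x, y, z⟩ hx
    have e1 := map_jacobson_eq_bot (LinearMap.fst A (J ⧸ C₁) ((J ⧸ C₂) × (J ⧸ C₃))) hx
    have e2 := map_jacobson_eq_bot ((LinearMap.fst A (J ⧸ C₂) (J ⧸ C₃)).comp
      (LinearMap.snd A (J ⧸ C₁) ((J ⧸ C₂) × (J ⧸ C₃)))) hx
    have e3 := map_jacobson_eq_bot ((LinearMap.snd A (J ⧸ C₂) (J ⧸ C₃)).comp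
      (LinearMap.snd A (J ⧸ C₁) ((J ⧸ C₂) × (J ⧸ C₃)))) hx
    rw [Submodule.mem_bot]
    exact Prod.ext e1 (Prod.ext e2 e3)
  -- The first copy of M sees C₁ and C₂, the second sees C₂ and C₃, and the glueing shares the
  -- middle factor. If a or b acts invertibly, the kernel of aφ₁ + bφ₂ lies in two distinct Cᵢ, so
  -- its image has length at least two.
  let φ₁ : J →ₗ[A] V := C₁.mkQ.prod (C₂.mkQ.prod 0)
  let φ₂ : J →ₗ[A] V := (0 : J →ₗ[A] J ⧸ C₁).prod (C₂.mkQ.prod C₃.mkQ)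
  have hφ : ∀ v, ∃ x y, φ₁ x + φ₂ y = v := by
    rintro ⟨v₁, v₂, v₃⟩
    obtain ⟨x, hx⟩ := hsurj C₁ C₂ h₁ h₂ h₁₂ (v₁, v₂)
    obtain ⟨y, hy⟩ := hsurj C₂ C₃ h₂ h₃ h₃₂.symm (0, v₃)
    have x1 : C₁.mkQ x = v₁ := congrArg Prod.fst hx
    have x2 : C₂.mkQ x = v₂ := congrArg Prod.snd hx
    have y2 : C₂.mkQ y = 0 := congrArg Prod.fst hy
    have y3 : C₃.mkQ y = v₃ := congrArg Prod.snd hy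
    refine ⟨x, y, Prod.ext ?_ (Prod.ext ?_ ?_)⟩
    · change C₁.mkQ x + 0 = v₁; rw [x1, add_zero]
    · change C₂.mkQ x + C₂.mkQ y = v₂; rw [x2, y2, add_zero]
    · change 0 + C₃.mkQ y = v₃; rw [y3, zero_add]
  -- the action of central elements on `V`
  have hact : ∀ a : Subsemiring.center A, Function.Bijective (centralMul M a) →
      ∀ C : Submodule A J, ∀ x : J, a • C.mkQ x = 0 → C.mkQ x = 0 := by
    intro a ha C x hx
    have e1 : C.map (centralMul J a) = C := by
      refine eq_of_le_of_len_le ?_ ?_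
      · rintro _ ⟨c, hc, rfl⟩
        exact central_smul_mem C a hc
      · rw [len_map_of_injective]
        intro y z hyz
        exact Subtype.ext (ha.1 (congrArg Subtype.val hyz))
    rw [← map_central_smul, Submodule.mkQ_apply, Submodule.Quotient.mk_eq_zero, ← e1] at hx
    obtain ⟨c, hc, hcx⟩ := hx
    have : c = x := Subtype.ext (ha.1 (congrArg Subtype.val hcx))
    rwa [Submodule.mkQ_apply, Submodule.Quotient.mk_eq_zero, ← this]
  -- Multiplication by such an a followed by J → J/C is the restriction to J of a homomorphism from
  -- M to a simple module, so it vanishes on the radical J.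
  have hzero : ∀ a : Subsemiring.center A, (∀ m : M, a • m ∈ J) →
      ∀ C : Submodule A J, IsSimpleModule A (J ⧸ C) → ∀ x : J, a • C.mkQ x = 0 := by
    intro a ha C _ x
    rw [← map_central_smul]
    exact map_jacobson_eq_bot (C.mkQ.comp ((centralMul M a).codRestrict J ha)) (hJ ▸ x.2)
  have H : ∀ f₁ f₂ : M →ₗ[A] M ⧸ J, ¬ (f₁ = 0 ∧ f₂ = 0) → ∃ (g₁ g₂ : M →ₗ[A] M)
      (h₁ : ∀ x ∈ J, g₁ x ∈ J) (h₂ : ∀ x ∈ J, g₂ x ∈ J),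
      (∀ m, f₁ m = J.mkQ (g₁ m)) ∧ (∀ m, f₂ m = J.mkQ (g₂ m)) ∧
      2 ≤ len A (LinearMap.range (φ₁.comp (g₁.restrict h₁) + φ₂.comp (g₂.restrict h₂))) := by
    intro f₁ f₂ hf
    obtain ⟨a, ha⟩ := hscal f₁
    obtain ⟨b, hb⟩ := hscal f₂
    refine ⟨centralMul M a, centralMul M b, fun x hx => central_smul_mem J a hx,
      fun x hx => central_smul_mem J b hx, fun m => (ha m).trans (map_central_smul _ a m).symm,
      fun m => (hb m).trans (map_central_smul _ b m).symm, ?_⟩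
    set F := φ₁.comp ((centralMul M a).restrict fun x hx => central_smul_mem J a hx) +
      φ₂.comp ((centralMul M b).restrict fun x hx => central_smul_mem J b hx) with hF
    have hFx : ∀ x, F x = (a • C₁.mkQ x, a • C₂.mkQ x + b • C₂.mkQ x, b • C₃.mkQ x) := by
      intro x
      refine Prod.ext ?_ (Prod.ext rfl ?_)
      · exact add_zero _
      · exact zero_add _
    have hsmall : ∃ C D : Submodule A J, len A C + 1 = len A J ∧ len A D + 1 = len A J ∧ C ≠ D ∧
        LinearMap.ker F ≤ C ⊓ D := by
      have hker : ∀ x ∈ LinearMap.ker F, a • C₁.mkQ x = 0 ∧ a • C₂.mkQ x + b • C₂.mkQ x = 0 ∧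
          b • C₃.mkQ x = 0 := by
        intro x hx
        rw [LinearMap.mem_ker, hFx] at hx
        exact ⟨congrArg Prod.fst hx, congrArg (fun v => v.2.1) hx, congrArg (fun v => v.2.2) hx⟩
      have hm : ∀ {C : Submodule A J} {x}, C.mkQ x = 0 → x ∈ C := fun h =>
        (Submodule.Quotient.mk_eq_zero _).1 h
      rcases hcases a with ha' | ha'
      · rcases hcases b with hb' | hb'
        · exfalso
          refine hf ⟨?_, ?_⟩
          · ext m
            rw [ha, ← map_central_smul]
            exact (Submodule.Quotient.mk_eq_zero _).2 (ha' m)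
          · ext m
            rw [hb, ← map_central_smul]
            exact (Submodule.Quotient.mk_eq_zero _).2 (hb' m)
        · refine ⟨C₂, C₃, h₂, h₃, h₃₂.symm, fun x hx => ?_⟩
          obtain ⟨-, e2, e3⟩ := hker x hx
          rw [hzero a ha' C₂ inst₂, zero_add] at e2
          exact ⟨hm (hact b hb' _ _ e2), hm (hact b hb' _ _ e3)⟩
      · rcases hcases b with hb' | hb'
        · refine ⟨C₁, C₂, h₁, h₂, h₁₂, fun x hx => ?_⟩
          obtain ⟨e1, e2, -⟩ := hker x hx
          rw [hzero b hb' C₂ inst₂, add_zero] at e2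
          exact ⟨hm (hact a ha' _ _ e1), hm (hact a ha' _ _ e2)⟩
        · refine ⟨C₁, C₃, h₁, h₃, h₃₁.symm, fun x hx => ?_⟩
          obtain ⟨e1, -, e3⟩ := hker x hx
          exact ⟨hm (hact a ha' _ _ e1), hm (hact b hb' _ _ e3)⟩
    obtain ⟨C, D, hC, hD, hne, hle⟩ := hsmall
    have e1 := len_range_add_ker F
    have e2 := len_mono hle
    have e3 := hinf C D hC hD hne
    omega
  subst hJ
  exact hA.false_of_glue hM hM hV φ₁ φ₂ hφ H H

end LocalModules

/-! ### Fibre products and non-local indecomposable modules of length three and four. -/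

section NonLocalModules

variable {A : Type u} [Ring A] [IsArtinianRing A]
variable {M N : Type u} [AddCommGroup M] [Module A M] [Module.Finite A M]
  [AddCommGroup N] [Module A N] [Module.Finite A N]

/-- The radical of a local module has at most two maximal submodules. -/
theorem IsFourNakayama.jacobson_coatom_le (hA : IsFourNakayama A) (hM : IsLocalModule A M)
    {C₁ C₂ C₃ : Submodule A M} (hC₁ : C₁ ≤ jacobson A M) (hC₂ : C₂ ≤ jacobson A M)
    (hC₃ : C₃ ≤ jacobson A M) (h₁ : len A C₁ + 1 = len A (jacobson A M))
    (h₂ : len A C₂ + 1 = len A (jacobson A M)) (h₃ : len A C₃ + 1 = len A (jacobson A M))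
    (h₁₂ : C₁ ≠ C₂) : C₃ = C₁ ∨ C₃ = C₂ := by
  have hmap : ∀ C ≤ jacobson A M, (C.comap (jacobson A M).subtype).map (jacobson A M).subtype = C :=
    fun C hC => by rw [Submodule.map_comap_subtype, inf_eq_right.2 hC]
  have h := hA.jacobson_coatom hM rfl (C₁ := C₁.comap (jacobson A M).subtype)
    (C₂ := C₂.comap (jacobson A M).subtype) (C₃ := C₃.comap (jacobson A M).subtype)
    (by rwa [len_comap_subtype hC₁]) (by rwa [len_comap_subtype hC₂])
    (by rwa [len_comap_subtype hC₃])
    (fun h => h₁₂ (by rw [← hmap C₁ hC₁, h, hmap C₂ hC₂]))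
  refine h.imp (fun h => ?_) fun h => ?_
  · rw [← hmap C₃ hC₃, h, hmap C₁ hC₁]
  · rw [← hmap C₃ hC₃, h, hmap C₂ hC₂]

theorem IsFourNakayama.exists_jacobson_coatoms (hA : IsFourNakayama A) (hM : IsLocalModule A M)
    (hu : ¬ IsUniserial A M) : ∃ C₁ C₂ : Submodule A M, C₁ ≤ jacobson A M ∧ C₂ ≤ jacobson A M ∧
      len A C₁ + 1 = len A (jacobson A M) ∧ len A C₂ + 1 = len A (jacobson A M) ∧ C₁ ≠ C₂ ∧
      ∀ C ≤ jacobson A M, len A C + 1 = len A (jacobson A M) → C = C₁ ∨ C = C₂ := by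
  have hlJ := len_jacobson_of_isLocal hM
  have hb : jacobson A M ≠ ⊥ := fun h => hu
    (isUniserial_of_len_le_one (by rw [h, len_bot] at hlJ; omega))
  obtain ⟨C, hC, D, hD, hCl, hDl, hne⟩ :=
    exists_coatoms_sub_of_not_isLocal hb (hA.not_isLocal_jacobson hM hu)
  exact ⟨C, D, hC, hD, hCl, hDl, hne, fun E hE hEl =>
    hA.jacobson_coatom_le hM hC hD hE hCl hDl hEl hne⟩

theorem isSemisimple_prod (hM : IsSemisimpleModule A M) (hN : IsSemisimpleModule A N) :
    IsSemisimpleModule A (M × N) := by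
  rw [← jacobson_eq_bot_iff, eq_bot_iff]
  rintro x hx
  exact Prod.ext (map_jacobson_eq_bot (LinearMap.fst A M N) hx)
    (map_jacobson_eq_bot (LinearMap.snd A M N) hx)

/-- The fibre product of two homomorphisms. -/
def fiberProduct {T : Type u} [AddCommGroup T] [Module A T] (f : M →ₗ[A] T) (g : N →ₗ[A] T) :
    Submodule A (M × N) :=
  LinearMap.ker (f.comp (LinearMap.fst A M N) - g.comp (LinearMap.snd A M N))

theorem mem_fiberProduct {T : Type u} [AddCommGroup T] [Module A T] {f : M →ₗ[A] T}
    {g : N →ₗ[A] T} {z : M × N} : z ∈ fiberProduct f g ↔ f z.1 = g z.2 := by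
  exact sub_eq_zero

/-- The first projection of a fibre product. -/
abbrev fiberFst {T : Type u} [AddCommGroup T] [Module A T] (f : M →ₗ[A] T) (g : N →ₗ[A] T) :
    fiberProduct f g →ₗ[A] M :=
  (LinearMap.fst A M N).comp (fiberProduct f g).subtype

/-- The second projection of a fibre product. -/
abbrev fiberSnd {T : Type u} [AddCommGroup T] [Module A T] (f : M →ₗ[A] T) (g : N →ₗ[A] T) :
    fiberProduct f g →ₗ[A] N :=
  (LinearMap.snd A M N).comp (fiberProduct f g).subtype

theorem fiberFst_surjective {T : Type u} [AddCommGroup T] [Module A T] {f : M →ₗ[A] T}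
    {g : N →ₗ[A] T} (hg : Function.Surjective g) : Function.Surjective (fiberFst f g) := fun m => by
  obtain ⟨n, hn⟩ := hg (f m)
  exact ⟨⟨(m, n), mem_fiberProduct.2 hn.symm⟩, rfl⟩

theorem len_fiberProduct {T : Type u} [AddCommGroup T] [Module A T] [Module.Finite A T]
    {f : M →ₗ[A] T} {g : N →ₗ[A] T} (hg : Function.Surjective g) :
    len A (fiberProduct f g) + len A T = len A M + len A N := by
  have h : len A (LinearMap.range (f.comp (LinearMap.fst A M N) - g.comp (LinearMap.snd A M N))) +
    len A (fiberProduct f g) = len A (M × N) := len_range_add_ker _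
  rw [LinearMap.range_eq_top.2, len_top, len_prod] at h
  · omega
  · intro t
    obtain ⟨n, hn⟩ := hg (-t)
    exact ⟨(0, n), by simp [hn]⟩

theorem len_ker_fiberFst {T : Type u} [AddCommGroup T] [Module A T] [Module.Finite A T]
    {f : M →ₗ[A] T} {g : N →ₗ[A] T} (hg : Function.Surjective g) :
    len A (LinearMap.ker (fiberFst f g)) + len A T = len A N := by
  have h1 := len_fiberProduct (f := f) hg
  have h2 := len_range_add_ker (fiberFst f g)
  rw [LinearMap.range_eq_top.2 (fiberFst_surjective hg), len_top] at h2
  omega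

/-- The simple module `T` kills the radical of `N`, so the image of `g` is not inside the radical;
`N` being local, it is everything. -/
theorem surjective_of_isUniserial {T : Type u} [AddCommGroup T] [Module A T] [Module.Finite A T]
    (hN : IsUniserial A N) (hT : len A T = 1) {f : N →ₗ[A] T} {g : M →ₗ[A] N}
    (h : f.comp g ≠ 0) : Function.Surjective g := by
  have : IsSimpleModule A T := len_eq_one_iff.1 hT
  have : Nontrivial N := by
    by_contra hn
    rw [not_nontrivial_iff_subsingleton] at hn
    exact h (LinearMap.ext fun m => by
      rw [LinearMap.comp_apply, Subsingleton.elim (g m) 0, map_zero]; rfl)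
  refine range_eq_top_of_not_le_jacobson (isLocal_of_isUniserial hN) fun hr => h ?_
  ext m
  exact map_jacobson_eq_bot f (hr ⟨m, rfl⟩)

/-- Uniserial modules of length two are determined by their tops and socles. -/
theorem IsFourNakayama.exists_equiv_of_isUniserial (hA : IsFourNakayama A) {T : Type u}
    [AddCommGroup T] [Module A T] [Module.Finite A T] (hT : len A T = 1)
    (hMl : len A M = 2) (hNl : len A N = 2) (hN : IsUniserial A N)
    {f : M →ₗ[A] T} {g : N →ₗ[A] T} (hf : Function.Surjective f) (hg : Function.Surjective g)
    (θ : LinearMap.ker f ≃ₗ[A] LinearMap.ker g) (hM : IsUniserial A M) :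
    ∃ e : M ≃ₗ[A] N, ∀ m, g (e m) = f m := by
  have hTs : IsSimpleModule A T := len_eq_one_iff.1 hT
  have hTn : Nontrivial T := IsSimpleModule.nontrivial A T
  have hfne : f ≠ 0 := by
    rintro rfl
    obtain ⟨t, ht⟩ := exists_ne (0 : T)
    obtain ⟨m, hm⟩ := hf t
    exact ht hm.symm
  have hYl := len_fiberProduct (f := f) hg
  have hkl := len_ker_fiberFst (f := f) hg
  have : Nontrivial M := by
    by_contra hn
    rw [not_nontrivial_iff_subsingleton, ← len_eq_zero_iff (A := A)] at hn
    omega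
  have hkf : len A (LinearMap.ker f) = 1 := by
    have := len_range_add_ker f
    rw [LinearMap.range_eq_top.2 hf, len_top] at this
    omega
  rcases isLocal_or_exists_section (isLocal_of_isUniserial hM) (fiberFst_surjective hg)
    (by omega : len A (LinearMap.ker (fiberFst f g)) = 1) with hY | ⟨σ, hσ⟩
  · exfalso
    -- A local fibre product, of length three, would have ker f × 0, 0 × ker g and the graph of θ as
    -- three maximal submodules of its radical.
    have hlJ := len_jacobson_of_isLocal hY
    have hatom : ∀ i : LinearMap.ker f →ₗ[A] fiberProduct f g, Function.Injective i →
        LinearMap.range i ≤ jacobson A (fiberProduct f g) ∧ len A (LinearMap.range i) = 1 :=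
      fun i hi => by
        have := (len_range_of_injective hi).trans hkf
        exact ⟨atom_le_jacobson_of_isLocal hY (by omega) this, this⟩
    let i₁ : LinearMap.ker f →ₗ[A] fiberProduct f g :=
      ((LinearMap.ker f).subtype.prod 0).codRestrict _ fun x => by
        rw [mem_fiberProduct]; exact (LinearMap.mem_ker.1 x.2).trans (map_zero g).symm
    let i₂ : LinearMap.ker f →ₗ[A] fiberProduct f g :=
      ((0 : LinearMap.ker f →ₗ[A] M).prod
        ((LinearMap.ker g).subtype.comp θ.toLinearMap)).codRestrict _ fun x => by
        rw [mem_fiberProduct]; exact (map_zero f).trans (LinearMap.mem_ker.1 (θ x).2).symm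
    let i₃ : LinearMap.ker f →ₗ[A] fiberProduct f g :=
      ((LinearMap.ker f).subtype.prod
        ((LinearMap.ker g).subtype.comp θ.toLinearMap)).codRestrict _ fun x => by
        rw [mem_fiberProduct]
        exact (LinearMap.mem_ker.1 x.2).trans (LinearMap.mem_ker.1 (θ x).2).symm
    have hi₁ : Function.Injective i₁ := fun x y h =>
      Subtype.ext (congrArg (fun z : fiberProduct f g => z.1.1) h)
    have hi₂ : Function.Injective i₂ := fun x y h =>
      θ.injective (Subtype.ext (congrArg (fun z : fiberProduct f g => z.1.2) h))
    have hi₃ : Function.Injective i₃ := fun x y h =>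
      Subtype.ext (congrArg (fun z : fiberProduct f g => z.1.1) h)
    obtain ⟨x, hx⟩ : ∃ x : LinearMap.ker f, x ≠ 0 := by
      by_contra! h
      have : Subsingleton (LinearMap.ker f) := ⟨fun a b => (h a).trans (h b).symm⟩
      rw [← len_eq_zero_iff (A := A)] at this
      omega
    have hx0 : (x : M) ≠ 0 := fun h => hx (Subtype.ext h)
    have hθ0 : (θ x : N) ≠ 0 := fun h => hx (θ.injective ((Subtype.ext h).trans (map_zero θ).symm))
    have h₁₂ : LinearMap.range i₁ ≠ LinearMap.range i₂ := fun h => by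
      obtain ⟨y, hy⟩ : i₁ x ∈ LinearMap.range i₂ := h ▸ LinearMap.mem_range_self i₁ x
      exact hx0 (congrArg (fun z : fiberProduct f g => z.1.1) hy).symm
    obtain ⟨h1, h1l⟩ := hatom i₁ hi₁
    obtain ⟨h2, h2l⟩ := hatom i₂ hi₂
    obtain ⟨h3, h3l⟩ := hatom i₃ hi₃
    rcases hA.jacobson_coatom_le hY h1 h2 h3 (by omega) (by omega) (by omega) h₁₂ with h | h
    · obtain ⟨y, hy⟩ : i₃ x ∈ LinearMap.range i₁ := h ▸ LinearMap.mem_range_self i₃ x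
      exact hθ0 (congrArg (fun z : fiberProduct f g => z.1.2) hy).symm
    · obtain ⟨y, hy⟩ : i₃ x ∈ LinearMap.range i₂ := h ▸ LinearMap.mem_range_self i₃ x
      exact hx0 (congrArg (fun z : fiberProduct f g => z.1.1) hy).symm
  -- Otherwise the first projection has a section, whose second component is the required
  -- isomorphism.
  · have hcomm : ∀ m, g ((fiberSnd f g).comp σ m) = f m := fun m => by
      have := mem_fiberProduct.1 (σ m).2
      rw [show (σ m).1.1 = m from hσ m] at this
      exact this.symm
    have hs : Function.Surjective ((fiberSnd f g).comp σ) := by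
      refine surjective_of_isUniserial (f := g) hN hT ?_
      rwa [show g.comp ((fiberSnd f g).comp σ) = f from LinearMap.ext hcomm]
    exact ⟨LinearEquiv.ofBijective _ (bijective_of_surjective_of_len hs (by omega)), hcomm⟩

/-- Indecomposable modules of length three with two maximal submodules. -/
theorem IsFourNakayama.nonlocal_len_three (hA : IsFourNakayama A)
    (hM : IsIndecomposableModule A M) (hl : len A M = 3) (hn : ¬ IsLocalModule A M) :
    len A (jacobson A M) = 1 ∧ (∀ Z : Submodule A M, len A Z = 1 → Z = jacobson A M) ∧
    ∃ C₁ C₂ : Submodule A M, len A C₁ = 2 ∧ len A C₂ = 2 ∧ C₁ ≠ C₂ ∧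
      ∀ C : Submodule A M, len A C = 2 → C = C₁ ∨ C = C₂ := by
  have := hM.1
  obtain ⟨C₁, C₂, h₁, h₂, h₁₂⟩ := exists_coatoms_of_not_isLocal hn
  have hinf : ∀ C D : Submodule A M, len A C = 2 → len A D = 2 → C ≠ D →
      C ⊓ D = jacobson A M ∧ len A (jacobson A M) = 1 := by
    intro C D hC hD hne
    have h1 := len_lt_of_lt (lt_of_le_of_ne inf_le_left fun h =>
      hne (eq_of_le_of_len_le (inf_eq_left.1 h) (by omega)) : C ⊓ D < C)
    obtain ⟨Z, -, hZ⟩ := exists_atom_le (X := (⊤ : Submodule A M)) top_ne_bot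
    have h2 := len_mono (atom_le_jacobson_of_isIndecomposable hM (by omega) hZ)
    have h3 : jacobson A M ≤ C ⊓ D :=
      le_inf (jacobson_le_of_len (by omega)) (jacobson_le_of_len (by omega))
    have h4 := len_mono h3
    exact ⟨(eq_of_le_of_len_le h3 (by omega)).symm, by omega⟩
  have hJl := (hinf C₁ C₂ (by omega) (by omega) h₁₂).2
  have hatom : ∀ Z : Submodule A M, len A Z = 1 → Z = jacobson A M := fun Z hZ =>
    eq_of_le_of_len_le (atom_le_jacobson_of_isIndecomposable hM (by omega) hZ) (by omega)
  refine ⟨hJl, hatom, C₁, C₂, by omega, by omega, h₁₂, fun C₃ h₃ => ?_⟩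
  -- Given a third maximal submodule C₃, both C₁ and C₂ are uniserial of length two, map onto M/C₃
  -- and have the radical as kernel of that map. Hence there is an isomorphism e : C₁ → C₂ over
  -- M/C₃.
  by_contra! hne
  obtain ⟨h₃₁, h₃₂⟩ := hne
  have h₁₃ := (hinf C₁ C₃ (by omega) h₃ h₃₁.symm).1
  have h₂₃ := (hinf C₂ C₃ (by omega) h₃ h₃₂.symm).1
  have huni : ∀ C : Submodule A M, len A C = 2 → IsUniserial A C := fun C hC =>
    isUniserial_of_len_two hC fun Z _ hZ => hatom Z hZ
  have hTl := len_quot_add C₃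
  have hsurj : ∀ C : Submodule A M, len A C = 2 → C ≠ C₃ →
      Function.Surjective (C₃.mkQ.comp C.subtype) := by
    intro C hC hne
    have h1 := len_range_add_ker (C₃.mkQ.comp C.subtype)
    rw [LinearMap.ker_comp, Submodule.ker_mkQ, ← len_map_of_injective C.injective_subtype,
      Submodule.map_comap_subtype, (hinf C C₃ hC h₃ hne).1] at h1
    exact LinearMap.range_eq_top.1 (eq_top_of_len (by omega))
  have hker : ∀ C : Submodule A M, len A C = 2 → C ≠ C₃ →
      LinearMap.ker (C₃.mkQ.comp C.subtype) = (jacobson A M).comap C.subtype := by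
    intro C hC hne
    rw [LinearMap.ker_comp, Submodule.ker_mkQ, ← (hinf C C₃ hC h₃ hne).1, Submodule.comap_inf,
      Submodule.comap_subtype_self, top_inf_eq]
  have hJC : ∀ C : Submodule A M, len A C = 2 → jacobson A M ≤ C := fun C hC =>
    jacobson_le_of_len (by omega)
  obtain ⟨e, he⟩ := hA.exists_equiv_of_isUniserial (M := C₁) (N := C₂) (by omega) (by omega)
    (by omega) (huni C₂ (by omega)) (hsurj C₁ (by omega) h₃₁.symm)
    (hsurj C₂ (by omega) h₃₂.symm)
    ((LinearEquiv.ofEq _ _ (hker C₁ (by omega) h₃₁.symm)).trans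
      ((Submodule.submoduleOfEquivOfLe (hJC C₁ (by omega))).trans
        ((LinearEquiv.ofEq _ _ (hker C₂ (by omega) h₃₂.symm)).trans
          (Submodule.submoduleOfEquivOfLe (hJC C₂ (by omega)))).symm)) (huni C₁ (by omega))
  have he' : ∀ x : C₁, (e x : M) - x ∈ C₃ := fun x => (Submodule.Quotient.eq C₃).1 (he x)
  have heJ : ∀ x : C₁, (x : M) ∈ jacobson A M → (e x : M) ∈ jacobson A M := fun x hx => by
    rw [← h₂₃]
    refine ⟨(e x).2, ?_⟩
    have := C₃.add_mem (he' x) (hJC C₃ h₃ hx)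
    rwa [sub_add_cancel] at this
  have hJs : IsSimpleModule A (jacobson A M) := len_eq_one_iff.1 hJl
  obtain ⟨a, ha⟩ := hA.scalar (jacobson A M)
    ((C₂.subtype.comp (e.toLinearMap.comp
      (Submodule.inclusion (hJC C₁ (by omega))))).codRestrict (jacobson A M)
        fun x => heJ _ x.2)
  -- On the simple radical, e is multiplication by a central a. So h = e − a kills the radical and
  -- has image of length at most one, inside the radical. Then C₂ = e(C₁) ⊆ C₁ + rad M = C₁.
  let h : C₁ →ₗ[A] M := C₂.subtype.comp e.toLinearMap - C₁.subtype.comp (centralMul C₁ a)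
  have hh : ∀ x : C₁, h x = (e x : M) - a • (x : M) := fun x => rfl
  have hk : (jacobson A M).comap C₁.subtype ≤ LinearMap.ker h := by
    intro x hx
    rw [LinearMap.mem_ker, hh]
    exact sub_eq_zero.2 (congrArg Subtype.val (ha ⟨x, hx⟩))
  have h1 := len_mono hk
  rw [len_comap_subtype (hJC C₁ (by omega))] at h1
  have h2 := len_range_add_ker h
  have h3 : LinearMap.range h ≤ jacobson A M := by
    rcases (by omega : len A (LinearMap.range h) = 0 ∨ len A (LinearMap.range h) = 1) with h0 | h0
    · rw [len_sub_eq_zero_iff.1 h0]; exact bot_le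
    · exact (hatom _ h0).le
  apply h₁₂
  refine (eq_of_le_of_len_le (fun y hy => ?_) (by omega)).symm
  obtain ⟨x, hx⟩ := e.surjective ⟨y, hy⟩
  have h4 := hJC C₁ (by omega) (h3 ⟨x, rfl⟩)
  rw [hh, hx] at h4
  have := C₁.add_mem h4 (central_smul_mem C₁ a x.2)
  rwa [sub_add_cancel] at this

/-- The image is a quotient of the semisimple module `M ⧸ X`, hence lies in the socle. -/
theorem range_le_of_ker {X : Submodule A M} {S : Submodule A N} (hS : socle A N ≤ S)
    [IsSemisimpleModule A (M ⧸ X)] (f : M →ₗ[A] N) (hf : ∀ x ∈ X, f x = 0) :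
    LinearMap.range f ≤ S := by
  have hf' : X ≤ LinearMap.ker f := hf
  have h1 : IsSemisimpleModule A (LinearMap.range (X.liftQ f hf')) := IsSemisimpleModule.range _
  have e : LinearMap.range (X.liftQ f hf') = LinearMap.range f := Submodule.range_liftQ X f hf'
  rw [e] at h1
  exact (le_socle_of_isSemisimple _).trans hS

theorem isSemisimple_quot_jacobson : IsSemisimpleModule A (M ⧸ jacobson A M) :=
  jacobson_eq_bot_iff.1 (Module.jacobson_quotient_jacobson A M)

theorem map_centralMul_eq {a : Subsemiring.center A} (ha : Function.Bijective (centralMul M a))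
    (X : Submodule A M) : X.map (centralMul M a) = X := by
  refine eq_of_le_of_len_le ?_ (len_map_of_injective ha.1 X).ge
  rintro _ ⟨x, hx, rfl⟩
  exact central_smul_mem X a hx

/-- The top of an indecomposable module of length four has length at most two. -/
theorem IsFourNakayama.jacobson_eq_inf (hA : IsFourNakayama A)
    (hM : IsIndecomposableModule A M) (hl : len A M = 4)
    {C₁ C₂ : Submodule A M} (h₁ : len A C₁ = 3) (h₂ : len A C₂ = 3) (h₁₂ : C₁ ≠ C₂) :
    jacobson A M = C₁ ⊓ C₂ ∧ len A (jacobson A M) = 2 := by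
  have := hM.1
  have hinf : ∀ C D : Submodule A M, len A C = 3 → len A D = 3 → C ≠ D →
      C ⊔ D = ⊤ ∧ len A (C ⊓ D : Submodule A M) = 2 := by
    intro C D hC hD hne
    have h1 := len_lt_of_lt (lt_of_le_of_ne inf_le_left fun h =>
      hne (eq_of_le_of_len_le (inf_eq_left.1 h) (by omega)) : C ⊓ D < C)
    have h2 := len_sup_add_inf C D
    have h3 := len_le (C ⊔ D)
    exact ⟨eq_top_of_len (by omega), by omega⟩
  have hJC : ∀ C : Submodule A M, len A C = 3 → jacobson A M ≤ C := fun C hC =>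
    jacobson_le_of_len (by omega)
  have hJ12 : jacobson A M ≤ C₁ ⊓ C₂ := le_inf (hJC C₁ h₁) (hJC C₂ h₂)
  have hl12 := (hinf C₁ C₂ h₁ h₂ h₁₂).2
  suffices h : C₁ ⊓ C₂ ≤ jacobson A M by
    have := le_antisymm hJ12 h
    exact ⟨this, this ▸ hl12⟩
  -- Otherwise there is a maximal submodule C₃ not containing C₁ ∩ C₂. Then the radical S is
  -- strictly smaller than C₁ ∩ C₂, so it is simple; it contains every simple submodule, so it is
  -- the only one.
  by_contra hnot
  obtain ⟨C₃, h₃, hC₃⟩ := exists_coatom_not_le hnot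
  replace h₃ : len A C₃ = 3 := by omega
  set S := jacobson A M with hS
  obtain ⟨Z, -, hZ⟩ := exists_atom_le (X := (⊤ : Submodule A M)) top_ne_bot
  have hSl : len A S = 1 := by
    have e1 : len A Z ≤ len A S :=
      len_mono (atom_le_jacobson_of_isIndecomposable hM (by omega) hZ)
    have e2 : len A S < len A (C₁ ⊓ C₂ : Submodule A M) :=
      len_lt_of_lt (lt_of_le_of_ne hJ12 fun h => hnot h.ge)
    omega
  have hatom : ∀ Z : Submodule A M, len A Z = 1 → Z = S := fun Z hZ =>
    eq_of_le_of_len_le (atom_le_jacobson_of_isIndecomposable hM (by omega) hZ) (by omega)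
  have hsoc : socle A M ≤ S := socle_le fun Z hZ => (hatom Z hZ).le
  have hle_one : ∀ Y : Submodule A M, len A Y ≤ 1 → Y ≤ S := fun Y hY => by
    rcases (by omega : len A Y = 0 ∨ len A Y = 1) with h0 | h0
    · rw [len_sub_eq_zero_iff.1 h0]; exact bot_le
    · exact (hatom _ h0).le
  have hss : IsSemisimpleModule A (M ⧸ S) := isSemisimple_quot_jacobson
  have hSs : IsSimpleModule A S := len_eq_one_iff.1 hSl
  have h₁₃ : C₁ ≠ C₃ := fun h => hC₃ (h ▸ inf_le_left)
  have h₂₃ : C₂ ≠ C₃ := fun h => hC₃ (h ▸ inf_le_right)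
  have hl3 : C₁ ⊓ C₂ ≠ C₃ ⊓ C₂ := fun h => hC₃ (h.le.trans inf_le_left)
  -- The first projection maps X onto C₃ with kernel 0 × (C₁ ∩ C₂), so X has length five. It is not
  -- local, since C₃ has the two maximal submodules C₁ ∩ C₃ and C₂ ∩ C₃.
  let X : Submodule A (M × M) := C₃.comap (LinearMap.fst A M M) ⊓ C₁.comap (LinearMap.snd A M M) ⊓
    C₂.comap (LinearMap.fst A M M - LinearMap.snd A M M)
  have hX : ∀ x y : M, (x, y) ∈ X ↔ (x ∈ C₃ ∧ y ∈ C₁) ∧ x - y ∈ C₂ := fun x y => Iff.rfl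
  let π₁ : X →ₗ[A] M := (LinearMap.fst A M M).comp X.subtype
  let π₂ : X →ₗ[A] M := (LinearMap.snd A M M).comp X.subtype
  have hex₁ : ∀ x ∈ C₃, ∃ y, (x, y) ∈ X := fun x hx => by
    have h1 : x ∈ C₁ ⊔ C₂ := (hinf C₁ C₂ h₁ h₂ h₁₂).1 ▸ Submodule.mem_top
    obtain ⟨y, hy, z, hz, rfl⟩ := Submodule.mem_sup.1 h1
    exact ⟨y, (hX _ _).2 ⟨⟨hx, hy⟩, by rwa [add_sub_cancel_left]⟩⟩
  have hex₂ : ∀ y ∈ C₁, ∃ x, (x, y) ∈ X := fun y hy => by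
    have h1 : y ∈ C₃ ⊔ C₂ := (hinf C₃ C₂ h₃ h₂ h₂₃.symm).1 ▸ Submodule.mem_top
    obtain ⟨x, hx, z, hz, rfl⟩ := Submodule.mem_sup.1 h1
    exact ⟨x, (hX _ _).2 ⟨⟨hx, hy⟩, by rw [sub_add_cancel_left]; exact C₂.neg_mem hz⟩⟩
  have hr₁ : LinearMap.range π₁ = C₃ := by
    refine le_antisymm ?_ fun x hx => ?_
    · rintro _ ⟨⟨⟨x, y⟩, h⟩, rfl⟩
      exact ((hX x y).1 h).1.1
    · obtain ⟨y, hy⟩ := hex₁ x hx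
      exact ⟨⟨_, hy⟩, rfl⟩
  have hXl : len A X = 5 := by
    have e1 := len_range_add_ker π₁
    have e2 : (LinearMap.ker π₁).map π₂ = C₁ ⊓ C₂ := by
      refine le_antisymm ?_ fun y hy => ?_
      · rintro _ ⟨⟨⟨x, y⟩, h⟩, hx, rfl⟩
        replace hx : x = 0 := hx
        subst hx
        obtain ⟨⟨-, hy⟩, hy'⟩ := (hX 0 y).1 h
        rw [zero_sub] at hy'
        have hy'' := C₂.neg_mem hy'
        rw [neg_neg] at hy''
        exact ⟨hy, hy''⟩
      · refine ⟨⟨(0, y), (hX 0 y).2 ⟨⟨C₃.zero_mem, hy.1⟩, ?_⟩⟩, rfl, rfl⟩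
        rw [zero_sub]
        exact C₂.neg_mem hy.2
    have e3 := len_map_add π₂ (LinearMap.ker π₁)
    have e4 : LinearMap.ker π₂ ⊓ LinearMap.ker π₁ = ⊥ := by
      rw [eq_bot_iff]
      rintro ⟨⟨x, y⟩, h⟩ ⟨hy, hx⟩
      exact Subtype.ext (Prod.ext hx hy)
    rw [e4, len_bot, e2] at e3
    rw [hr₁] at e1
    omega
  have hXnl : ¬ IsLocalModule A X := fun hloc => by
    have hs : Function.Surjective (π₁.codRestrict C₃ fun x => hr₁ ▸ LinearMap.mem_range_self π₁ x) := by
      rintro ⟨x, hx⟩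
      obtain ⟨y, hy⟩ := hex₁ x hx
      exact ⟨⟨_, hy⟩, rfl⟩
    have : Nontrivial C₃ := Submodule.nontrivial_iff_ne_bot.2 fun h => by
      rw [h, len_bot] at h₃; omega
    have e1 := (hinf C₁ C₃ h₁ h₃ h₁₃).2
    have e2 := (hinf C₂ C₃ h₂ h₃ h₂₃).2
    refine not_isLocal_sub (X := C₃) (C := C₁ ⊓ C₃) (D := C₂ ⊓ C₃) inf_le_right inf_le_right
      (by omega) (by omega) (fun h => ?_) (isLocal_of_surjective hs hloc)
    have h5 : C₁ ⊓ C₃ = C₁ ⊓ C₂ :=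
      eq_of_le_of_len_le (le_inf inf_le_left (h.le.trans inf_le_left)) (by omega)
    exact hC₃ (h5 ▸ inf_le_right)
  let D : Submodule A X := S.comap π₁ ⊓ S.comap π₂
  have hXD : IsSemisimpleModule A (X ⧸ D) := by
    have := isSemisimple_prod hss hss
    have hk : LinearMap.ker ((S.mkQ.comp π₁).prod (S.mkQ.comp π₂)) = D := by
      rw [LinearMap.ker_prod, LinearMap.ker_comp, LinearMap.ker_comp, Submodule.ker_mkQ]
    refine IsSemisimpleModule.of_injective
      (D.liftQ ((S.mkQ.comp π₁).prod (S.mkQ.comp π₂)) hk.ge) ?_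
    rw [← LinearMap.ker_eq_bot, Submodule.ker_liftQ, hk, Submodule.mkQ_map_self]
  have hS1 : ∀ s ∈ S, (s, (0 : M)) ∈ X := fun s hs =>
    (hX _ _).2 ⟨⟨hJC _ h₃ hs, zero_mem _⟩, by rw [sub_zero]; exact hJC _ h₂ hs⟩
  have hS2 : ∀ s ∈ S, ((0 : M), s) ∈ X := fun s hs =>
    (hX _ _).2 ⟨⟨zero_mem _, hJC _ h₁ hs⟩, by rw [zero_sub]; exact C₂.neg_mem (hJC _ h₂ hs)⟩
  have hscal : ∀ i : S →ₗ[A] M, ∃ a : Subsemiring.center A, ∀ s, i s = a • (s : M) := by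
    intro i
    have e1 := len_range_add_ker i
    have e2 := hle_one (LinearMap.range i) (by omega)
    obtain ⟨a, ha⟩ := hA.scalar S (i.codRestrict S fun s => e2 ⟨s, rfl⟩)
    exact ⟨a, fun s => congrArg Subtype.val (ha s)⟩
  have hcases : ∀ a : Subsemiring.center A,
      ((∀ m : M, a • m ∈ S) ∧ ∀ s ∈ S, a • s = 0) ∨ Function.Bijective (centralMul M a) := by
    intro a
    by_cases h : LinearMap.ker (centralMul M a) = ⊥
    · exact Or.inr (bijective_of_injective_of_len (LinearMap.ker_eq_bot.1 h) le_rfl)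
    · obtain ⟨Z, hZ, hZl⟩ := exists_atom_le h
      rw [hatom Z hZl] at hZ
      exact Or.inl ⟨fun m => range_le_of_ker hsoc (centralMul M a) hZ ⟨m, rfl⟩, hZ⟩
  -- homomorphisms not vanishing on the socle have image of length at least three
  have key : ∀ g : X →ₗ[A] M, (∃ d ∈ D, g d ≠ 0) → 3 ≤ len A (LinearMap.range g) := by
    rintro g ⟨d, hd, hgd⟩
    obtain ⟨a, ha⟩ := hscal (g.comp ((S.subtype.prod 0).codRestrict X fun s => hS1 _ s.2))
    obtain ⟨b, hb⟩ := hscal (g.comp (((0 : S →ₗ[A] M).prod S.subtype).codRestrict X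
      fun s => hS2 _ s.2))
    -- On D = S × S the map g is given by two central scalars. Subtracting aπ₁ + bπ₂ leaves a map
    -- that factors through the semisimple module X/D, so it lands in the socle S, which already
    -- lies in the image of g.
    have hgD : ∀ x ∈ D, g x = a • π₁ x + b • π₂ x := by
      rintro ⟨⟨x, y⟩, h⟩ ⟨hx, hy⟩
      have e1 := ha ⟨x, hx⟩
      have e2 := hb ⟨y, hy⟩
      have e3 : (⟨(x, y), h⟩ : X) = ⟨(x, 0), hS1 x hx⟩ + ⟨(0, y), hS2 y hy⟩ :=
        Subtype.ext (Prod.ext (add_zero x).symm (zero_add y).symm)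
      rw [e3, map_add]
      refine (congrArg₂ (· + ·) e1 e2).trans ?_
      rw [← e3]
      rfl
    have hg : ∀ x, g x - (a • π₁ x + b • π₂ x) ∈ S := fun x =>
      range_le_of_ker (X := D) hsoc
        (g - ((centralMul M a).comp π₁ + (centralMul M b).comp π₂))
        (fun x hx => sub_eq_zero.2 (hgD x hx)) ⟨x, rfl⟩
    have hSg : S ≤ LinearMap.range g := by
      have hne : LinearMap.range g ≠ ⊥ := fun h => hgd
        ((Submodule.mem_bot A).1 (h ▸ LinearMap.mem_range_self g d))
      obtain ⟨Z, hZ, hZl⟩ := exists_atom_le hne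
      exact hatom Z hZl ▸ hZ
    have hmem : ∀ x, a • π₁ x + b • π₂ x ∈ LinearMap.range g := fun x => by
      have := sub_mem (LinearMap.mem_range_self g x) (hSg (hg x))
      rwa [sub_sub_cancel] at this
    have hfull : ∀ (c : Subsemiring.center A) (C : Submodule A M),
        Function.Bijective (centralMul M c) → (∀ x ∈ C, c • x ∈ LinearMap.range g) →
        C ≤ LinearMap.range g := by
      intro c C hc h
      rw [← map_centralMul_eq hc C]
      rintro _ ⟨x, hx, rfl⟩
      exact h x hx
    rcases hcases a with ⟨ha', ha0⟩ | ha'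
    · rcases hcases b with ⟨hb', hb0⟩ | hb'
      · exfalso
        rw [hgD d hd, ha0 _ hd.1, hb0 _ hd.2, add_zero] at hgd
        exact hgd rfl
      · rw [← h₁]
        refine len_mono (hfull b C₁ hb' fun y hy => ?_)
        obtain ⟨x, hx⟩ := hex₂ y hy
        have := sub_mem (hmem ⟨_, hx⟩) (hSg (ha' x))
        rwa [show a • π₁ ⟨(x, y), hx⟩ + b • π₂ ⟨(x, y), hx⟩ = a • x + b • y from rfl,
          add_sub_cancel_left] at this
    · rcases hcases b with ⟨hb', hb0⟩ | hb'
      · rw [← h₃]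
        refine len_mono (hfull a C₃ ha' fun x hx => ?_)
        obtain ⟨y, hy⟩ := hex₁ x hx
        have := sub_mem (hmem ⟨_, hy⟩) (hSg (hb' y))
        rwa [show a • π₁ ⟨(x, y), hy⟩ + b • π₂ ⟨(x, y), hy⟩ = a • x + b • y from rfl,
          add_sub_cancel_right] at this
      -- With both scalars invertible, the image contains two distinct submodules of length two,
      -- visible on the pairs (x, 0) and (0, y) of X.
      · have e1 : C₃ ⊓ C₂ ≤ LinearMap.range g := hfull a _ ha' fun x hx => by
          have := hmem ⟨(x, 0), (hX _ _).2 ⟨⟨hx.1, zero_mem _⟩, by rw [sub_zero]; exact hx.2⟩⟩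
          change a • x + b • (0 : M) ∈ _ at this
          rwa [smul_zero, add_zero] at this
        have e2 : C₁ ⊓ C₂ ≤ LinearMap.range g := hfull b _ hb' fun y hy => by
          have := hmem ⟨(0, y), (hX _ _).2 ⟨⟨zero_mem _, hy.1⟩,
            by rw [zero_sub]; exact C₂.neg_mem hy.2⟩⟩
          change a • (0 : M) + b • y ∈ _ at this
          rwa [smul_zero, zero_add] at this
        have e3 := (hinf C₃ C₂ h₃ h₂ h₂₃.symm).2
        have e4 := len_lt_of_lt (left_lt_sup.2 fun h =>
          hl3 (eq_of_le_of_len_le h (by omega)).symm.symm : C₃ ⊓ C₂ < C₃ ⊓ C₂ ⊔ C₁ ⊓ C₂)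
        have e5 := len_mono (sup_le e1 e2)
        omega
  obtain ⟨X₁, X₂, hs, hd, hX₁, hX₂⟩ := hA.exists_decomposition (M := X) (by omega) hXnl
  -- Every simple submodule of X lies in D. The projection to X₁, followed by π₁ or π₂, does not
  -- vanish on a simple submodule of X₁, so X₁ has length at least three; two such summands exceed
  -- five.
  have main : ∀ X₁ X₂ : Submodule A X, X₁ ⊔ X₂ = ⊤ → X₁ ⊓ X₂ = ⊥ → X₁ ≠ ⊥ → 3 ≤ len A X₁ := by
    intro X₁ X₂ hs hd hX₁
    obtain ⟨p, q, hp, -, -, hpX, -⟩ := exists_projections hs hd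
    obtain ⟨Z, hZ, hZl⟩ := exists_atom_le hX₁
    have hZD : Z ≤ D := by
      refine le_inf ?_ ?_ <;> rw [← Submodule.map_le_iff_le_comap] <;> apply hle_one
      · exact (len_map_le π₁ Z).trans hZl.le
      · exact (len_map_le π₂ Z).trans hZl.le
    obtain ⟨z, hz, hz0⟩ := Z.ne_bot_iff.1 fun h => by rw [h, len_bot] at hZl; omega
    have hrange : ∀ π : X →ₗ[A] M, len A (LinearMap.range (π.comp p)) ≤ len A X₁ := fun π => by
      rw [LinearMap.range_comp]
      refine (len_map_le π _).trans (len_mono ?_)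
      rintro _ ⟨x, rfl⟩
      exact hp x
    by_cases h1 : π₁ z = 0
    · refine (key (π₂.comp p) ⟨z, hZD hz, fun h2 => hz0 ?_⟩).trans (hrange _)
      rw [LinearMap.comp_apply, (hpX z (hZ hz)).1] at h2
      exact Subtype.ext (Prod.ext h1 h2)
    · refine (key (π₁.comp p) ⟨z, hZD hz, fun h2 => h1 ?_⟩).trans (hrange _)
      rwa [LinearMap.comp_apply, (hpX z (hZ hz)).1] at h2
  have e1 := main X₁ X₂ hs hd hX₁
  have e2 := main X₂ X₁ (sup_comm X₁ X₂ ▸ hs) (inf_comm X₁ X₂ ▸ hd) hX₂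
  have e3 := len_add_of_isCompl hs hd
  omega

theorem exists_section_of_inf_ker {π : N →ₗ[A] M} {X : Submodule A N}
    (h : LinearMap.ker π ⊓ X = ⊥) (hl : len A M ≤ len A X) :
    ∃ σ : M →ₗ[A] N, ∀ m, π (σ m) = m := by
  have hinj : Function.Injective (π.comp X.subtype) := by
    refine (injective_iff_map_eq_zero _).2 fun x hx => ?_
    have h1 : (x : N) ∈ LinearMap.ker π ⊓ X := ⟨hx, x.2⟩
    rw [h] at h1
    exact Subtype.ext h1
  have hb := bijective_of_injective_of_len hinj hl
  exact ⟨X.subtype.comp (LinearEquiv.ofBijective _ hb).symm.toLinearMap,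
    (LinearEquiv.ofBijective _ hb).apply_symm_apply⟩

/-- Lifting of homomorphisms from certain colocal modules of length four. -/
theorem IsFourNakayama.exists_lift (hA : IsFourNakayama A) (hn : ¬ IsLocalModule A M)
    (hl : len A M = 4) {S : Submodule A M} (hS : len A S = 1)
    (hatom : ∀ Z : Submodule A M, len A Z = 1 → Z = S) (hMS : IsIndecomposableModule A (M ⧸ S))
    {T : Type u} [AddCommGroup T] [Module A T] [Module.Finite A T] (hT : len A T = 1)
    (hNl : len A N = 2) {p : M →ₗ[A] T} {f : N →ₗ[A] T}
    (hpS : ∀ s ∈ S, p s = 0) (hf : Function.Surjective f) :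
    ∃ h : M →ₗ[A] N, ∀ m, f (h m) = p m := by
  have hne : Nontrivial M := by
    by_contra hn
    rw [not_nontrivial_iff_subsingleton, ← len_eq_zero_iff (A := A)] at hn
    omega
  have hle_one : ∀ Y : Submodule A M, len A Y ≤ 1 → Y ≤ S := fun Y hY => by
    rcases (by omega : len A Y = 0 ∨ len A Y = 1) with h0 | h0
    · rw [len_sub_eq_zero_iff.1 h0]; exact bot_le
    · exact (hatom _ h0).le
  -- The fibre product has length 4 + 2 − 1 = 5 and maps onto the non-local module M, so it
  -- decomposes.
  have hYl := len_fiberProduct (f := p) hf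
  have hkl := len_ker_fiberFst (f := p) hf
  have hps : Function.Surjective (fiberFst p f) := fiberFst_surjective hf
  have hXnl : ¬ IsLocalModule A (fiberProduct p f) := fun h => hn (isLocal_of_surjective hps h)
  let κ : fiberProduct p f →ₗ[A] M ⧸ S := S.mkQ.comp (fiberFst p f)
  have hκs : Function.Surjective κ := S.mkQ_surjective.comp hps
  set D := LinearMap.ker κ with hD
  have hDl : len A D = 2 := by
    have e1 : len A (LinearMap.range κ) + len A D = len A (fiberProduct p f) :=
      len_range_add_ker κ
    have e2 := len_quot_add S
    rw [LinearMap.range_eq_top.2 hκs, len_top] at e1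
    omega
  have hDmem : ∀ x ∈ D, (fiberFst p f) x ∈ S := fun x hx => (Submodule.Quotient.mk_eq_zero S).1 hx
  have hatomD : ∀ Z : Submodule A (fiberProduct p f), len A Z = 1 → Z ≤ D := fun Z hZ x hx =>
    (Submodule.Quotient.mk_eq_zero S).2
      (hle_one (Z.map (fiberFst p f)) ((len_map_le (fiberFst p f) Z).trans hZ.le) ⟨x, hx, rfl⟩)
  have hDss : IsSemisimpleModule A D := by
    have hkf : len A (LinearMap.ker f) = 1 := by
      have := len_range_add_ker f
      rw [LinearMap.range_eq_top.2 hf, len_top] at this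
      omega
    have := isSemisimple_prod (isSemisimple_of_len_one hS) (isSemisimple_of_len_one hkf)
    let g : D →ₗ[A] S × LinearMap.ker f :=
      (((fiberFst p f).comp D.subtype).codRestrict S fun x => hDmem _ x.2).prod
        (((fiberSnd p f).comp D.subtype).codRestrict (LinearMap.ker f) fun x => by
          have h1 := mem_fiberProduct.1 x.1.2
          exact h1.symm.trans (hpS _ (hDmem _ x.2)))
    refine IsSemisimpleModule.of_injective g fun x y h => Subtype.ext (Subtype.ext (Prod.ext ?_ ?_))
    · exact congrArg (fun z => (z.1 : M)) h
    · exact congrArg (fun z => (z.2 : N)) h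
  have hDsoc : D = socle A (fiberProduct p f) := le_antisymm (le_socle_of_isSemisimple D) (socle_le hatomD)
  obtain ⟨X₁, X₂, hs, hd, hX₁, hX₂⟩ := hA.exists_decomposition (M := fiberProduct p f) (by omega) hXnl
  have main : ∀ X₁ X₂ : Submodule A (fiberProduct p f), X₁ ⊔ X₂ = ⊤ → X₁ ⊓ X₂ = ⊥ → X₁ ≠ ⊥ → X₂ ≠ ⊥ →
      X₂ ≤ D → ∃ h : M →ₗ[A] N, ∀ m, f (h m) = p m := by
    intro X₁ X₂ hs hd hX₁ hX₂ hXD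
    obtain ⟨Z, hZ, hZl⟩ := exists_atom_le hX₁
    have e1 := len_sup_add_inf X₂ Z
    have e2 : X₂ ⊓ Z = ⊥ := by
      rw [eq_bot_iff, ← hd]
      exact le_inf (inf_le_right.trans hZ) inf_le_left
    have e3 := len_mono (sup_le hXD (hatomD Z hZl))
    have e4 := len_pos_of_ne_bot hX₂
    have e5 := len_add_of_isCompl hs hd
    rw [e2, len_bot] at e1
    -- Since D has length two and also meets X₁, the summand X₂ is simple and X₁ has length four,
    -- that of M.
    have hk : len A (LinearMap.ker (fiberFst p f)) = 1 := by omega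
    rcases disjoint_or_le (X := X₁) hk with h | h
    · obtain ⟨σ, hσ⟩ := exists_section_of_inf_ker h (by omega)
      refine ⟨(fiberSnd p f).comp σ, fun m => ?_⟩
      have h2 := mem_fiberProduct.1 (σ m).2
      rw [show (σ m).1.1 = m from hσ m] at h2
      exact h2.symm
    · exfalso
      -- If the kernel of the first projection lies in X₁, then both summands have images containing
      -- S. Preimages of one element of S differ by an element of the kernel, so the preimage in X₂
      -- lies in X₁ as well and vanishes.
      have hge : ∀ Y : Submodule A M, Y ≠ ⊥ → S ≤ Y := fun Y hY => by
        obtain ⟨Z, hZ, hZl⟩ := exists_atom_le hY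
        exact hatom Z hZl ▸ hZ
      have h1 : S ≤ X₁.map (fiberFst p f) := hge _ fun h0 => by
        rw [← LinearMap.le_ker_iff_map] at h0
        have := len_mono h0
        omega
      have h2 : S ≤ X₂.map (fiberFst p f) := hge _ fun h0 => by
        rw [← LinearMap.le_ker_iff_map] at h0
        have h3 : X₂ ≤ X₁ ⊓ X₂ := le_inf (h0.trans h) le_rfl
        rw [hd] at h3
        exact hX₂ (le_bot_iff.1 h3)
      have hS0 : S ≤ ⊥ := fun s hs' => by
        obtain ⟨x, hx, hxs⟩ := h1 hs'
        obtain ⟨y, hy, hys⟩ := h2 hs'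
        have h3 : x - y ∈ X₁ := h (by rw [LinearMap.mem_ker, map_sub, hxs, hys, sub_self])
        have h4 : y ∈ X₁ ⊓ X₂ := ⟨by simpa using X₁.sub_mem hx h3, hy⟩
        rw [hd, Submodule.mem_bot] at h4
        rw [Submodule.mem_bot, ← hys, h4, map_zero]
      rw [le_bot_iff.1 hS0, len_bot] at hS
      omega
  -- The kernel D is the socle, hence stable under the projections; therefore the images of the
  -- summands in M/S are complementary. As M/S is indecomposable, one summand lies in D.
  have hκ : X₁.map κ = ⊥ ∨ X₂.map κ = ⊥ := by
    refine hMS.2 _ _ ⟨?_, ?_⟩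
    · rw [disjoint_iff, eq_bot_iff]
      rintro _ ⟨⟨x, hx, rfl⟩, y, hy, hxy⟩
      obtain ⟨e, q, -, -, -, he₁, he₂⟩ := exists_projections hs hd
      have h1 : x - y ∈ D := by rw [hD, LinearMap.mem_ker, map_sub, hxy, sub_self]
      have h2 : e (x - y) ∈ D := by
        rw [hDsoc] at h1 ⊢
        exact map_socle_le e (Submodule.mem_map_of_mem h1)
      rw [map_sub, (he₁ x hx).1, (he₂ y hy).1, sub_zero] at h2
      exact h2
    · rw [codisjoint_iff, ← Submodule.map_sup, hs, Submodule.map_top, LinearMap.range_eq_top.2 hκs]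
  rcases hκ with h | h
  · exact main X₂ X₁ (sup_comm X₁ X₂ ▸ hs) (inf_comm X₁ X₂ ▸ hd) hX₂ hX₁
      (LinearMap.le_ker_iff_map.2 h)
  · exact main X₁ X₂ hs hd hX₁ hX₂ (LinearMap.le_ker_iff_map.2 h)

theorem isIndecomposable_of_atom (hne : Nontrivial M) {S : Submodule A M} (hS : len A S = 1)
    (hatom : ∀ Z : Submodule A M, len A Z = 1 → Z = S) : IsIndecomposableModule A M := by
  refine ⟨hne, fun X Y h => ?_⟩
  by_contra! h0
  obtain ⟨Z, hZ, hZl⟩ := exists_atom_le h0.1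
  obtain ⟨Z', hZ', hZ'l⟩ := exists_atom_le h0.2
  have h1 : S ≤ X ⊓ Y := le_inf (hatom Z hZl ▸ hZ) (hatom Z' hZ'l ▸ hZ')
  rw [h.inf_eq_bot, le_bot_iff] at h1
  rw [h1, len_bot] at hS
  omega

/-- Factoring out the socle of a colocal nonlocal module of length four gives a decomposable
module. -/
theorem IsFourNakayama.not_isIndecomposable_quot_socle (hA : IsFourNakayama A)
    (hn : ¬ IsLocalModule A M) (hl : len A M = 4) {S : Submodule A M} (hS : len A S = 1)
    (hatom : ∀ Z : Submodule A M, len A Z = 1 → Z = S) :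
    ¬ IsIndecomposableModule A (M ⧸ S) := by
  intro hMS
  have hne : Nontrivial M := by
    by_contra hn
    rw [not_nontrivial_iff_subsingleton, ← len_eq_zero_iff (A := A)] at hn
    omega
  have hM := isIndecomposable_of_atom hne hS hatom
  obtain ⟨C₁, C₂, h₁, h₂, h₁₂⟩ := exists_coatoms_of_not_isLocal hn
  obtain ⟨hJ, hJl⟩ := hA.jacobson_eq_inf hM hl (by omega) (by omega) h₁₂
  have hSJ : S ≤ jacobson A M := atom_le_jacobson_of_isIndecomposable hM (by omega) hS
  have hSC₁ : S ≤ C₁ := hSJ.trans (hJ ▸ inf_le_left)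
  have hSC₂ : S ≤ C₂ := hSJ.trans (hJ ▸ inf_le_right)
  have hQl := len_quot_add S
  have hmapl : ∀ X : Submodule A M, S ≤ X → len A (X.map S.mkQ) + 1 = len A X := fun X hX => by
    rw [← len_mapQ_add hX, hS]
  have hmap_inj : ∀ X Y : Submodule A M, S ≤ X → S ≤ Y → X.map S.mkQ = Y.map S.mkQ → X = Y := by
    intro X Y hX hY h
    have := congrArg (Submodule.comap S.mkQ) h
    rwa [Submodule.comap_map_mkQ, Submodule.comap_map_mkQ, sup_eq_right.2 hX,
      sup_eq_right.2 hY] at this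
  have e1 := hmapl C₁ hSC₁
  have e2 := hmapl C₂ hSC₂
  have hQn : ¬ IsLocalModule A (M ⧸ S) :=
    not_isLocal_of_coatoms (C := C₁.map S.mkQ) (D := C₂.map S.mkQ) (by omega) (by omega)
      fun h => h₁₂ (hmap_inj _ _ hSC₁ hSC₂ h)
  obtain ⟨hJQl, hatomQ, -⟩ := hA.nonlocal_len_three hMS (by omega) hQn
  have hK : IsUniserial A (C₂.map S.mkQ) :=
    isUniserial_of_len_two (by omega) fun Z _ hZ => hatomQ Z hZ
  have hTl := len_quot_add C₁
  have : IsSimpleModule A (M ⧸ C₁) := len_eq_one_iff.1 (by omega)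
  have hf : Function.Surjective (subquotMap S C₁ C₂ hSC₁) := by
    refine LinearMap.surjective_of_ne_zero fun h0 => h₁₂ ?_
    refine (eq_of_le_of_len_le (fun x hx => ?_) (by omega)).symm
    have := LinearMap.congr_fun h0 ⟨S.mkQ x, x, hx, rfl⟩
    exact (Submodule.Quotient.mk_eq_zero C₁).1 this
  -- The projection M → M/C₁ is lifted along the epimorphism C₂/S → M/C₁.
  obtain ⟨h, hh⟩ := hA.exists_lift (N := C₂.map S.mkQ) hn hl hS hatom hMS (T := M ⧸ C₁)
    (by omega) (by omega) (p := C₁.mkQ)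
    (fun s hs => (Submodule.Quotient.mk_eq_zero C₁).2 (hSC₁ hs)) hf
  have hhs : Function.Surjective h := by
    refine surjective_of_isUniserial hK (by omega : len A (M ⧸ C₁) = 1)
      (f := subquotMap S C₁ C₂ hSC₁) fun h0 => ?_
    have h1 : C₁ = ⊤ := by
      rw [eq_top_iff]
      intro m _
      refine (Submodule.Quotient.mk_eq_zero C₁).1 ?_
      exact (hh m).symm.trans (LinearMap.congr_fun h0 m)
    rw [h1, len_top] at h₁
    omega
  have hkl := len_range_add_ker h
  rw [LinearMap.range_eq_top.2 hhs, len_top] at hkl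
  have hSk : S ≤ LinearMap.ker h := by
    obtain ⟨Z, hZ, hZl⟩ := exists_atom_le (X := LinearMap.ker h) fun h0 => by
      rw [h0, len_bot] at hkl; omega
    exact hatom Z hZl ▸ hZ
  -- Modulo S both submodules are simple, and M/S has only one simple submodule. Hence M/rad M would
  -- be isomorphic to the uniserial module C₂/S, although C₁ and C₂ are distinct.
  have hkJ : LinearMap.ker h = jacobson A M := by
    refine hmap_inj _ _ hSk hSJ ?_
    have e3 := hmapl _ hSk
    have e4 := hmapl _ hSJ
    rw [hatomQ _ (by omega : len A ((LinearMap.ker h).map S.mkQ) = 1),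
      hatomQ _ (by omega : len A ((jacobson A M).map S.mkQ) = 1)]
  refine not_isUniserial_quot (K := jacobson A M) (C := C₁) (D := C₂) (hJ ▸ inf_le_left)
    (hJ ▸ inf_le_right) (by omega) h₁₂ ?_
  rw [← hkJ]
  exact isUniserial_of_injective (h.quotKerEquivOfSurjective hhs).injective hK

end NonLocalModules

/-! ### Non-local modules of length four with simple socle. -/

section ColocalModules

variable {A : Type u} [Ring A] [IsArtinianRing A]
variable {M N : Type u} [AddCommGroup M] [Module A M] [Module.Finite A M]
  [AddCommGroup N] [Module A N] [Module.Finite A N]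

theorem mkQ_comp_subtype_surjective {C X : Submodule A M} (hC : len A C + 1 = len A M)
    (h : ¬ X ≤ C) : Function.Surjective (C.mkQ.comp X.subtype) := by
  have h1 := len_quot_add C
  have : IsSimpleModule A (M ⧸ C) := len_eq_one_iff.1 (by omega)
  refine LinearMap.surjective_of_ne_zero fun h0 => h fun x hx => ?_
  exact (Submodule.Quotient.mk_eq_zero C).1 (LinearMap.congr_fun h0 ⟨x, hx⟩)

/-- The radical of the fibre product has length three, and J × 0 and a(S) × b(S) are its two maximal
submodules. Both contain a(S) × 0, so in a decomposition of the radical the summand of length two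
does too. The extension theorem applies to a(S) × 0, and the first projection yields `h`. -/
theorem IsFourNakayama.exists_hom_of_isLocal_fiberProduct (hA : IsFourNakayama A) {T S : Type u}
    [AddCommGroup T] [Module A T] [Module.Finite A T]
    [AddCommGroup S] [Module A S] [Module.Finite A S] {u : M →ₗ[A] T} {w : N →ₗ[A] T}
    (hP : IsLocalModule A (fiberProduct u w)) (hPl : len A (fiberProduct u w) = 4)
    (hN : len A N = 2) (hS : len A S = 1) {J : Submodule A M} (hJ : ∀ x ∈ J, u x = 0)
    (hJl : len A J = 2) {a : S →ₗ[A] M} (ha : Function.Injective a) (haJ : ∀ s, a s ∈ J)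
    {b : S →ₗ[A] N} (hb : Function.Injective b) (hbw : ∀ s, w (b s) = 0) :
    ∃ h : N →ₗ[A] M, ∀ s, h (b s) = a s := by
  have hlJ := len_jacobson_of_isLocal hP
  let i₁ : J →ₗ[A] fiberProduct u w := (J.subtype.prod 0).codRestrict _ fun x => by
    rw [mem_fiberProduct]
    exact (hJ _ x.2).trans (map_zero w).symm
  let i₂ : S × S →ₗ[A] fiberProduct u w := (a.prodMap b).codRestrict _ fun x => by
    rw [mem_fiberProduct]
    exact (hJ _ (haJ _)).trans (hbw _).symm
  let i : S →ₗ[A] fiberProduct u w := (a.prod 0).codRestrict _ fun x => by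
    rw [mem_fiberProduct]
    exact (hJ _ (haJ _)).trans (map_zero w).symm
  have hi₁ : Function.Injective i₁ := fun x y h =>
    Subtype.ext (congrArg (fun z => z.1.1) h)
  have hi₂ : Function.Injective i₂ := fun x y h =>
    Prod.ext (ha (congrArg (fun z => z.1.1) h)) (hb (congrArg (fun z => z.1.2) h))
  have hi : Function.Injective i := fun x y h => ha (congrArg (fun z => z.1.1) h)
  have hl₁ := len_range_of_injective hi₁
  have hl₂ := len_range_of_injective hi₂
  rw [len_prod] at hl₂
  have hJP : ∀ X : Submodule A (fiberProduct u w), len A X = 2 → X ≤ jacobson A _ := fun X hX =>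
    le_jacobson_of_isLocal hP fun h => by rw [h, len_top] at hX; omega
  have h1 : LinearMap.range i ≤ LinearMap.range i₁ := by
    rintro _ ⟨s, rfl⟩
    exact ⟨⟨a s, haJ s⟩, rfl⟩
  have h2 : LinearMap.range i ≤ LinearMap.range i₂ := by
    rintro _ ⟨s, rfl⟩
    exact ⟨(s, 0), Subtype.ext (Prod.ext rfl (map_zero b))⟩
  have h12 : LinearMap.range i₁ ≠ LinearMap.range i₂ := fun h => by
    obtain ⟨s, hs⟩ : ∃ s : S, s ≠ 0 := by
      by_contra! h0
      have : Subsingleton S := ⟨fun x y => (h0 x).trans (h0 y).symm⟩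
      rw [← len_eq_zero_iff (A := A)] at this
      omega
    obtain ⟨y, hy⟩ : i₂ (0, s) ∈ LinearMap.range i₁ := h ▸ LinearMap.mem_range_self i₂ _
    exact hs (hb ((congrArg (fun z => z.1.2) hy).symm.trans (map_zero b).symm))
  have hdec : ∀ X, X ≤ jacobson A _ → len A X = 2 → LinearMap.range i ≤ X := fun X hX hXl => by
    rcases hA.jacobson_coatom_le hP (hJP _ (hl₁.trans hJl)) (hJP _ (by omega)) hX (by omega)
      (by omega) (by omega) h12 with rfl | rfl
    · exact h1
    · exact h2
  obtain ⟨h, hh⟩ := hA.exists_extension hP (by omega) hN hS i hi b hb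
    (fun Y₁ Y₂ hs hd hY₁ hY₂ => by
      have e1 := len_sup_add_inf Y₁ Y₂
      rw [hs, hd, len_bot] at e1
      have e2 := len_pos_of_ne_bot hY₁
      have e3 := len_pos_of_ne_bot hY₂
      rcases (by omega : len A Y₁ = 2 ∨ len A Y₂ = 2) with e | e
      · exact Or.inl ⟨hdec Y₁ (hs ▸ le_sup_left) e, e.ge⟩
      · exact Or.inr ⟨hdec Y₂ (hs ▸ le_sup_right) e, e.ge⟩)
  exact ⟨(fiberFst u w).comp h, fun s => congrArg (fun z => z.1.1) (hh s)⟩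

/-- The first projection has simple kernel and local target, so it splits if the fibre product is
not local. The second component of a section lifts `u` along `w`. -/
theorem isLocal_fiberProduct_or_exists_hom {T : Type u} [AddCommGroup T] [Module A T]
    [Module.Finite A T] (hM : IsLocalModule A M) {u : M →ₗ[A] T} {w : N →ₗ[A] T}
    (hw : Function.Surjective w) (hl : len A N = len A T + 1) :
    IsLocalModule A (fiberProduct u w) ∨ ∃ g : M →ₗ[A] N, ∀ m, w (g m) = u m := by
  have hkl := len_ker_fiberFst (f := u) hw
  refine (isLocal_or_exists_section hM (fiberFst_surjective hw) (by omega)).imp_right ?_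
  rintro ⟨σ, hσ⟩
  refine ⟨(fiberSnd u w).comp σ, fun m => ?_⟩
  have h2 := mem_fiberProduct.1 (σ m).2
  rw [show (σ m).1.1 = m from hσ m] at h2
  exact h2.symm

/-- The map `k` is injective, being so on S, and its image is J, the only submodule of length two in
`M₁`. The difference n − k(n) kills S, so its image is at most simple and lies in S. Thus N₂ ⊆ S + J
= J. -/
theorem eq_of_extension {S M₁ N₂ J : Submodule A M} (hS : len A S = 1)
    (hatom : ∀ Z : Submodule A M, len A Z = 1 → Z = S) (hM₁ : IsUniserial A M₁)
    (hN₂ : IsUniserial A N₂) (hN₂l : len A N₂ = 2) (hJl : len A J = 2)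
    (hJM₁ : J ≤ M₁) (hSN : S ≤ N₂) (hSJ : S ≤ J) {k : N₂ →ₗ[A] M₁}
    (hk : ∀ s : S, (k (Submodule.inclusion hSN s) : M) = s) : N₂ = J := by
  have hkinj : Function.Injective k :=
    injective_of_comp_injective hN₂ hS (Submodule.inclusion_injective hSN) fun s t hst =>
      Subtype.ext ((hk s).symm.trans ((congrArg Subtype.val hst).trans (hk t)))
  have hkJ : ∀ n, (k n : M) ∈ J := by
    have hinj : Function.Injective (M₁.subtype.comp k) := M₁.injective_subtype.comp hkinj
    have e1 := len_range_of_injective hinj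
    have e2 : LinearMap.range (M₁.subtype.comp k) ≤ M₁ := by
      rintro _ ⟨n, rfl⟩
      exact (k n).2
    have e3 := eq_of_isUniserial_of_len hM₁ e2 hJM₁ (by omega)
    exact fun n => e3 ▸ LinearMap.mem_range_self (M₁.subtype.comp k) n
  have hd := len_range_add_ker (N₂.subtype - M₁.subtype.comp k)
  have hd2 : S.comap N₂.subtype ≤ LinearMap.ker (N₂.subtype - M₁.subtype.comp k) := by
    rintro ⟨n, hn⟩ hs
    exact sub_eq_zero.2 (hk ⟨n, hs⟩).symm
  have hd3 := len_mono hd2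
  rw [len_comap_subtype hSN] at hd3
  have hd4 : LinearMap.range (N₂.subtype - M₁.subtype.comp k) ≤ S := by
    rcases (by omega : len A (LinearMap.range (N₂.subtype - M₁.subtype.comp k)) = 0 ∨
      len A (LinearMap.range (N₂.subtype - M₁.subtype.comp k)) = 1) with h0 | h0
    · rw [len_sub_eq_zero_iff.1 h0]; exact bot_le
    · exact (hatom _ h0).le
  refine eq_of_le_of_len_le (fun n hn => ?_) (by omega)
  have := J.add_mem (hSJ (hd4 ⟨⟨n, hn⟩, rfl⟩)) (hkJ ⟨n, hn⟩)
  rwa [LinearMap.sub_apply, LinearMap.comp_apply, Submodule.subtype_apply,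
    Submodule.subtype_apply, sub_add_cancel] at this

/-- The isomorphism is x ↦ x − g(x). The kernel of `g` has length one, hence is S, so this map is
the identity on S. Every nonzero kernel would contain S, so the map is injective. -/
theorem exists_equiv_of_sub_mem {S M₁ N₂ Y : Submodule A M}
    (hatom : ∀ Z : Submodule A M, len A Z = 1 → Z = S)
    (hM₁l : len A M₁ = 3) (hN₂l : len A N₂ = 2) (hYl : len A Y = 3) {g : M₁ →ₗ[A] N₂}
    (hgs : Function.Surjective g) (hg : ∀ x : M₁, (x : M) - g x ∈ Y) :
    Nonempty (Y ≃ₗ[A] M₁) := by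
  have hgk := len_range_add_ker g
  rw [LinearMap.range_eq_top.2 hgs, len_top] at hgk
  have hgS : ∀ x : M₁, (x : M) ∈ S → g x = 0 := fun x hx => by
    have e := hatom ((LinearMap.ker g).map M₁.subtype)
      (by rw [len_map_of_injective M₁.injective_subtype]; omega)
    rw [← e] at hx
    obtain ⟨y, hy, hyx⟩ := hx
    rwa [← Subtype.ext hyx]
  let e : M₁ →ₗ[A] Y := (M₁.subtype - N₂.subtype.comp g).codRestrict Y hg
  have he : Function.Injective e := by
    rw [← LinearMap.ker_eq_bot]
    by_contra h0
    obtain ⟨Z, hZ, hZl⟩ := exists_atom_le h0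
    have hZS := hatom (Z.map M₁.subtype) (by rw [len_map_of_injective M₁.injective_subtype, hZl])
    obtain ⟨z, hz, hz0⟩ := Z.ne_bot_iff.1 fun h => by rw [h, len_bot] at hZl; omega
    have h1 : (z : M) - g z = 0 := congrArg Subtype.val (hZ hz)
    rw [hgS z (hZS ▸ Submodule.mem_map_of_mem hz)] at h1
    exact hz0 (Subtype.ext ((sub_zero _).symm.trans h1))
  exact ⟨(LinearEquiv.ofBijective e (bijective_of_injective_of_len he (by omega))).symm⟩

/-- In a colocal module of length four with a uniserial submodule `M₁` of length three and a
uniserial submodule `N₂` of length two not contained in `M₁`, almost every maximal submodule is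
isomorphic to `M₁`. -/
theorem IsFourNakayama.equiv_of_coatom (hA : IsFourNakayama A)
    (hl : len A M = 4) {S M₁ N₂ J Y : Submodule A M} (hS : len A S = 1)
    (hatom : ∀ Z : Submodule A M, len A Z = 1 → Z = S) (hM₁ : IsUniserial A M₁)
    (hM₁l : len A M₁ = 3) (hN₂ : IsUniserial A N₂) (hN₂l : len A N₂ = 2) (hJl : len A J = 2)
    (hJM₁ : J ≤ M₁) (hJN : J ≠ N₂) (hJY : J ≤ Y) (hYl : len A Y = 3) (hYM₁ : Y ≠ M₁)
    (hNY : ¬ N₂ ≤ Y) : Nonempty (Y ≃ₗ[A] M₁) := by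
  have hge : ∀ X : Submodule A M, X ≠ ⊥ → S ≤ X := fun X hX => by
    obtain ⟨Z, hZ, hZl⟩ := exists_atom_le hX
    exact hatom Z hZl ▸ hZ
  have hSN : S ≤ N₂ := hge _ fun h => by rw [h, len_bot] at hN₂l; omega
  have hSJ : S ≤ J := hge _ fun h => by rw [h, len_bot] at hJl; omega
  have hSM₁ : S ≤ M₁ := hSJ.trans hJM₁
  have hM₁Y : ¬ M₁ ≤ Y := fun h => hYM₁ (eq_of_le_of_len_le h (by omega)).symm
  obtain ⟨u, hu⟩ : ∃ u : M₁ →ₗ[A] M ⧸ Y, ∀ x, u x = Y.mkQ x := ⟨Y.mkQ.comp M₁.subtype, fun _ => rfl⟩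
  obtain ⟨w, hw⟩ : ∃ w : N₂ →ₗ[A] M ⧸ Y, ∀ x, w x = Y.mkQ x := ⟨Y.mkQ.comp N₂.subtype, fun _ => rfl⟩
  have hws : Function.Surjective w := by
    have e : w = Y.mkQ.comp N₂.subtype := LinearMap.ext hw
    rw [e]
    exact mkQ_comp_subtype_surjective (by omega) hNY
  have hTl : len A (M ⧸ Y) = 1 := by have := len_quot_add Y; omega
  have : Nontrivial M₁ := by
    by_contra h
    rw [not_nontrivial_iff_subsingleton, ← len_eq_zero_iff (A := A)] at h
    omega
  have hPl := len_fiberProduct (f := u) hws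
  -- A local fibre product would extend S ⊆ M₁ to a map N₂ → M₁ and force N₂ = J. Otherwise there is
  -- g : M₁ → N₂ congruent to the identity modulo Y, and x ↦ x − g(x) carries M₁ onto Y.
  rcases isLocal_fiberProduct_or_exists_hom (u := u) (isLocal_of_isUniserial hM₁) hws (by omega)
    with hP | ⟨g, hg⟩
  · exfalso
    obtain ⟨k, hk'⟩ := hA.exists_hom_of_isLocal_fiberProduct hP (by omega) hN₂l hS
      (J := J.comap M₁.subtype)
      (fun x hx => (hu x).trans ((Submodule.Quotient.mk_eq_zero Y).2 (hJY hx)))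
      (by rwa [len_comap_subtype hJM₁])
      (Submodule.inclusion_injective hSM₁) (fun s => hSJ s.2) (Submodule.inclusion_injective hSN)
      (fun s => (hw _).trans ((Submodule.Quotient.mk_eq_zero Y).2 (hJY (hSJ s.2))))
    exact hJN (eq_of_extension hS hatom hM₁ hN₂ hN₂l hJl hJM₁ hSN hSJ
      fun s => congrArg Subtype.val (hk' s)).symm
  · have hgs : Function.Surjective g := by
      refine surjective_of_isUniserial hN₂ hTl (f := w) fun h0 => hM₁Y fun x hx => ?_
      refine (Submodule.Quotient.mk_eq_zero Y).1 ?_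
      exact ((hu ⟨x, hx⟩).symm.trans (hg ⟨x, hx⟩).symm).trans (LinearMap.congr_fun h0 ⟨x, hx⟩)
    exact exists_equiv_of_sub_mem hatom hM₁l hN₂l hYl hgs fun x =>
      (Submodule.Quotient.eq Y).1 ((hu x).symm.trans ((hg x).symm.trans (hw _)))

/-- The submodules of colocal nonlocal modules of length four. -/
theorem IsFourNakayama.colocal_len_four (hA : IsFourNakayama A) (hn : ¬ IsLocalModule A M)
    (hl : len A M = 4) {S : Submodule A M} (hS : len A S = 1)
    (hatom : ∀ Z : Submodule A M, len A Z = 1 → Z = S) :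
    ∃ M₁ M₂ N₁ N₂ : Submodule A M, len A M₁ = 3 ∧ IsUniserial A M₁ ∧ len A M₂ = 3 ∧
      ¬ IsLocalModule A M₂ ∧ len A N₁ = 2 ∧ len A N₂ = 2 ∧ N₁ ≠ N₂ ∧ N₁ ≤ M₁ ∧ N₁ ≤ M₂ ∧ N₂ ≤ M₂ ∧
      M₁ ≠ M₂ ∧ (∀ Y : Submodule A M, len A Y = 2 → Y = N₁ ∨ Y = N₂) ∧
      ∀ Y : Submodule A M, len A Y = 3 → Y = M₁ ∨ Y = M₂ ∨ Nonempty (Y ≃ₗ[A] M₁) := by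
  have hne : Nontrivial M := by
    by_contra hn
    rw [not_nontrivial_iff_subsingleton, ← len_eq_zero_iff (A := A)] at hn
    omega
  have hM := isIndecomposable_of_atom hne hS hatom
  obtain ⟨C₁, C₂, h₁, h₂, h₁₂⟩ := exists_coatoms_of_not_isLocal hn
  have hJl := (hA.jacobson_eq_inf hM hl (by omega) (by omega) h₁₂).2
  have hge : ∀ X : Submodule A M, X ≠ ⊥ → S ≤ X := fun X hX => by
    obtain ⟨Z, hZ, hZl⟩ := exists_atom_le hX
    exact hatom Z hZl ▸ hZ
  have hJC : ∀ C : Submodule A M, len A C = 3 → jacobson A M ≤ C := fun C hC =>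
    jacobson_le_of_len (by omega)
  have huni : ∀ C : Submodule A M, len A C = 2 → IsUniserial A C := fun C hC =>
    isUniserial_of_len_two hC fun Z _ hZ => hatom Z hZ
  have hind : ∀ C : Submodule A M, len A C = 3 → IsIndecomposableModule A C := fun C hC => by
    refine isIndecomposable_sub_iff.2 ⟨fun h => by rw [h, len_bot] at hC; omega, fun Y Z _ hi => ?_⟩
    by_contra! h0
    have h1 : S ≤ Y ⊓ Z := le_inf (hge Y h0.1) (hge Z h0.2)
    rw [hi, le_bot_iff] at h1
    rw [h1, len_bot] at hS
    omega
  -- These are the preimages of the two summands of M/S. Their lengths add up to 4 + 1 and each is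
  -- at least two.
  obtain ⟨M₁, N₂, hs, hi, hM₁l, hN₂l⟩ : ∃ M₁ N₂ : Submodule A M, M₁ ⊔ N₂ = ⊤ ∧ M₁ ⊓ N₂ = S ∧
      len A M₁ = 3 ∧ len A N₂ = 2 := by
    obtain ⟨Y, Z, hs, hi, hY, hZ⟩ := exists_of_not_isIndecomposable_quot
      (fun h => by rw [h, len_top] at hS; omega)
      (hA.not_isIndecomposable_quot_socle hn hl hS hatom)
    have e1 := len_sup_add_inf Y Z
    rw [hs, hi, len_top] at e1
    have e2 := len_lt_of_lt (lt_of_le_of_ne (hi ▸ inf_le_left) hY.symm)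
    have e3 := len_lt_of_lt (lt_of_le_of_ne (hi ▸ inf_le_right) hZ.symm)
    rcases (by omega : (len A Y = 3 ∧ len A Z = 2) ∨ (len A Z = 3 ∧ len A Y = 2)) with e | e
    · exact ⟨Y, Z, hs, hi, e.1, e.2⟩
    · exact ⟨Z, Y, sup_comm Y Z ▸ hs, inf_comm Y Z ▸ hi, e.1, e.2⟩
  have hJM₁ := hJC M₁ hM₁l
  have hJN : jacobson A M ≠ N₂ := fun h => by
    rw [sup_eq_left.2 (h ▸ hJM₁)] at hs
    rw [hs, len_top] at hM₁l
    omega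
  have hsup : ∀ Y : Submodule A M, len A Y = 2 → Y ≠ N₂ → 3 ≤ len A (Y ⊔ N₂ : Submodule A M) :=
    fun Y hY hYN => by
      have := len_lt_of_lt (lt_of_le_of_ne le_sup_right fun h =>
        hYN (eq_of_le_of_len_le (sup_eq_right.1 h.symm) (by omega)) : N₂ < Y ⊔ N₂)
      omega
  have hsupl : ∀ Y : Submodule A M, len A Y = 2 → Y ≠ N₂ → len A (Y ⊔ N₂ : Submodule A M) = 3 :=
    fun Y hY hYN => by
      have e1 := hsup Y hY hYN
      have e2 := len_sup_add_inf Y N₂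
      have e3 := len_mono (le_inf (hge Y fun h => by rw [h, len_bot] at hY; omega)
        (hge N₂ fun h => by rw [h, len_bot] at hN₂l; omega))
      omega
  -- For such Y the submodule Y + N₂ is maximal, so it contains the radical. By the modular law it
  -- meets M₁ in Y, hence rad M ⊆ Y.
  have htwo : ∀ Y ≤ M₁, len A Y = 2 → Y = jacobson A M := by
    intro Y hY hYl
    by_contra hne'
    have hYN : Y ≠ N₂ := fun h => by
      rw [sup_eq_left.2 (h ▸ hY)] at hs
      rw [hs, len_top] at hM₁l
      omega
    have e1 := hJC _ (hsupl Y hYl hYN)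
    have e2 : (Y ⊔ N₂) ⊓ M₁ = Y := by
      rw [sup_inf_assoc_of_le _ hY, inf_comm, hi, sup_eq_left]
      exact hge Y fun h => by rw [h, len_bot] at hYl; omega
    exact hne' (eq_of_le_of_len_le (e2 ▸ le_inf e1 hJM₁) (by omega)).symm
  have hM₁u : IsUniserial A M₁ := by
    have hloc : IsLocalModule A M₁ := by
      by_contra h
      obtain ⟨C, hC, D, hD, hCl, hDl, hCD⟩ := exists_coatoms_sub_of_not_isLocal
        (fun h => by rw [h, len_bot] at hM₁l; omega) h
      exact hCD ((htwo C hC (by omega)).trans (htwo D hD (by omega)).symm)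
    refine isUniserial_of_jacobson hloc ?_
    have e := len_jacobson_of_isLocal hloc
    have := huni ((jacobson A M₁).map M₁.subtype)
      (by rw [len_map_of_injective M₁.injective_subtype]; omega)
    exact isUniserial_of_injective
      (Submodule.equivMapOfInjective M₁.subtype M₁.injective_subtype _).injective this
  have hM₂l := hsupl _ hJl hJN
  have hM₂n : ¬ IsLocalModule A (jacobson A M ⊔ N₂ : Submodule A M) :=
    not_isLocal_sub le_sup_left le_sup_right (by omega) (by omega) hJN
  refine ⟨M₁, jacobson A M ⊔ N₂, jacobson A M, N₂, hM₁l, hM₁u, hM₂l, hM₂n, hJl, hN₂l, hJN, hJM₁,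
    le_sup_left, le_sup_right, fun h => ?_, fun Y hYl => ?_, fun Y hYl => ?_⟩
  · rw [sup_eq_left.2 (le_sup_right.trans h.ge)] at hs
    rw [hs, len_top] at hM₁l
    omega
  · by_cases hYN : Y = N₂
    · exact Or.inr hYN
    -- The maximal submodule Y + N₂ contains rad M + N₂ and equals it. So Y is one of the two
    -- maximal submodules of a non-local indecomposable module of length three.
    have e1 := hJC _ (hsupl Y hYl hYN)
    have e2 : jacobson A M ⊔ N₂ = Y ⊔ N₂ := eq_of_le_of_len_le (sup_le e1 le_sup_right)
      (by rw [hM₂l, hsupl Y hYl hYN])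
    have hYM₂ : Y ≤ jacobson A M ⊔ N₂ := e2 ▸ le_sup_left
    obtain ⟨-, -, D₁, D₂, hD₁, hD₂, hD₁₂, hD⟩ := hA.nonlocal_len_three (hind _ hM₂l) hM₂l hM₂n
    have hmap : ∀ C ≤ jacobson A M ⊔ N₂, len A C = 2 →
        C = D₁.map (jacobson A M ⊔ N₂).subtype ∨ C = D₂.map (jacobson A M ⊔ N₂).subtype := by
      intro C hC hCl
      have e : (C.comap (jacobson A M ⊔ N₂).subtype).map (jacobson A M ⊔ N₂).subtype = C := by
        rw [Submodule.map_comap_subtype, inf_eq_right.2 hC]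
      rcases hD (C.comap (jacobson A M ⊔ N₂).subtype) (by rwa [len_comap_subtype hC]) with h | h
      · exact Or.inl (by rw [← h, e])
      · exact Or.inr (by rw [← h, e])
    rcases hmap Y hYM₂ hYl, hmap _ le_sup_left hJl, hmap _ le_sup_right hN₂l with
      ⟨h | h, h' | h', h'' | h''⟩
    all_goals first
      | exact Or.inl (h.trans h'.symm)
      | exact Or.inr (h.trans h''.symm)
      | exact absurd (h'.trans h''.symm) hJN
  · by_cases hYM₁ : Y = M₁
    · exact Or.inl hYM₁
    by_cases hNY : N₂ ≤ Y
    · exact Or.inr (Or.inl (eq_of_le_of_len_le (sup_le (hJC Y hYl) hNY) (by omega)).symm)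
    · exact Or.inr (Or.inr (hA.equiv_of_coatom hl hS hatom hM₁u hM₁l (huni N₂ hN₂l) hN₂l hJl hJM₁
        hJN (hJC Y hYl) hYl hYM₁ hNY))

end ColocalModules

/-! ### Non-local indecomposable modules of length four whose socle is not simple. -/

section NonColocalModules

variable {A : Type u} [Ring A] [IsArtinianRing A]
variable {M N : Type u} [AddCommGroup M] [Module A M] [Module.Finite A M]
  [AddCommGroup N] [Module A N] [Module.Finite A N]

/-- As neither module maps nontrivially to the top of the other, the pair of maps to the tops
reduces to one central multiple. It is bijective unless it is zero, and then its image in V is that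
of the whole radical. -/
theorem IsFourNakayama.false_of_glue_injective (hA : IsFourNakayama A) {V : Type u}
    [AddCommGroup V] [Module A V] [Module.Finite A V] (hM : IsLocalModule A M)
    (hN : IsLocalModule A N) [IsSemisimpleModule A V] (hV : len A V = 3)
    {φ : jacobson A M →ₗ[A] V} {ψ : jacobson A N →ₗ[A] V} (hφ : Function.Injective φ)
    (hψ : Function.Injective ψ) (hs : ∀ v, ∃ x y, φ x + ψ y = v)
    (hMl : 2 ≤ len A (jacobson A M)) (hNl : 2 ≤ len A (jacobson A N))
    (hMN : ∀ f : M →ₗ[A] N ⧸ jacobson A N, f = 0)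
    (hNM : ∀ f : N →ₗ[A] M ⧸ jacobson A M, f = 0) : False := by
  refine hA.false_of_glue hM hN hV φ ψ hs (fun f₁ f₂ hf => ?_) fun f₁ f₂ hf => ?_
  · obtain ⟨a, ha⟩ := hA.exists_scalar_top hM f₁
    have hb : Function.Bijective (centralMul M a) := by
      refine (central_smul_cases hM a).resolve_left fun h => hf ⟨?_, hMN f₂⟩
      ext m
      rw [ha, ← map_central_smul]
      exact (Submodule.Quotient.mk_eq_zero _).2 (h m)
    refine ⟨centralMul M a, 0, fun x hx => central_smul_mem _ a hx, fun x _ => zero_mem _,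
      fun m => ha m, fun m => by rw [hMN f₂]; rfl, ?_⟩
    rw [len_range_of_injective]
    · exact hMl
    · intro x y h
      have h' : φ _ + ψ 0 = φ _ + ψ 0 := h
      exact Subtype.ext (hb.1 (congrArg Subtype.val (hφ (add_right_cancel h'))))
  · obtain ⟨a, ha⟩ := hA.exists_scalar_top hN f₂
    have hb : Function.Bijective (centralMul N a) := by
      refine (central_smul_cases hN a).resolve_left fun h => hf ⟨hNM f₁, ?_⟩
      ext m
      rw [ha, ← map_central_smul]
      exact (Submodule.Quotient.mk_eq_zero _).2 (h m)
    refine ⟨0, centralMul N a, fun x _ => zero_mem _, fun x hx => central_smul_mem _ a hx,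
      fun m => by rw [hNM f₁]; rfl, fun m => ha m, ?_⟩
    rw [len_range_of_injective]
    · exact hNl
    · intro x y h
      have h' : φ 0 + ψ _ = φ 0 + ψ _ := h
      exact Subtype.ext (hb.1 (congrArg Subtype.val (hψ (add_left_cancel h'))))

/-- Two distinct maximal submodules with isomorphic quotients give rise to a third one. -/
theorem exists_third_coatom {C₁ C₂ : Submodule A M} (h₁ : len A C₁ + 1 = len A M)
    (h₂ : len A C₂ + 1 = len A M) (h₁₂ : C₁ ≠ C₂) {u : N →ₗ[A] M ⧸ C₁} {v : N →ₗ[A] M ⧸ C₂}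
    (hu : Function.Surjective u) (hv : Function.Surjective v)
    (huv : LinearMap.ker u = LinearMap.ker v) :
    ∃ C₃ : Submodule A M, len A C₃ + 1 = len A M ∧ C₃ ≠ C₁ ∧ C₃ ≠ C₂ := by
  let θ : (M ⧸ C₁) ≃ₗ[A] M ⧸ C₂ := (u.quotKerEquivOfSurjective hu).symm.trans
    ((Submodule.quotEquivOfEq _ _ huv).trans (v.quotKerEquivOfSurjective hv))
  have hl₁ := len_quot_add C₁
  have hl₂ := len_quot_add C₂
  -- The third maximal submodule is where the two projections agree under the identification θ of
  -- their targets.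
  let f : M →ₗ[A] M ⧸ C₂ := θ.toLinearMap.comp C₁.mkQ - C₂.mkQ
  have hf : ∀ m, f m = θ (C₁.mkQ m) - C₂.mkQ m := fun m => rfl
  have hC₂ : ∀ m, C₂.mkQ m = 0 → m ∈ C₂ := fun m => (Submodule.Quotient.mk_eq_zero C₂).1
  have hC₁ : ∀ m, C₁.mkQ m = 0 → m ∈ C₁ := fun m => (Submodule.Quotient.mk_eq_zero C₁).1
  have hC₂' : ∀ m ∈ C₂, C₂.mkQ m = 0 := fun m => (Submodule.Quotient.mk_eq_zero C₂).2
  have hC₁' : ∀ m ∈ C₁, C₁.mkQ m = 0 := fun m => (Submodule.Quotient.mk_eq_zero C₁).2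
  have e1 : LinearMap.ker f ≠ C₁ := fun h => h₁₂ (eq_of_le_of_len_le (fun m hm => hC₂ m (by
    have h1 := hf m
    rw [hC₁' m hm, map_zero, zero_sub, LinearMap.mem_ker.1 (h.ge hm)] at h1
    exact neg_eq_zero.1 h1.symm)) (by omega))
  have e2 : LinearMap.ker f ≠ C₂ := fun h => h₁₂ (eq_of_le_of_len_le (fun m hm => hC₁ m (by
    have h1 := hf m
    rw [hC₂' m hm, sub_zero, LinearMap.mem_ker.1 (h.ge hm)] at h1
    exact θ.map_eq_zero_iff.1 h1.symm)) (by omega)).symm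
  have : IsSimpleModule A (M ⧸ C₂) := len_eq_one_iff.1 (by omega)
  have hfs : Function.Surjective f := by
    refine LinearMap.surjective_of_ne_zero fun h0 => h₁₂ (eq_of_le_of_len_le (fun m hm => ?_)
      (by omega))
    have h1 := hf m
    rw [h0, hC₁' m hm, map_zero, zero_sub] at h1
    exact hC₂ m (neg_eq_zero.1 h1.symm)
  have h3 := len_range_add_ker f
  rw [LinearMap.range_eq_top.2 hfs, len_top] at h3
  exact ⟨LinearMap.ker f, by omega, e1, e2⟩

/-- Both are isomorphic to their common image modulo `S`. -/
theorem nonempty_equiv_of_sup_eq {X Y S : Submodule A M} (hX : X ⊓ S = ⊥) (hY : Y ⊓ S = ⊥)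
    (h : X ⊔ S = Y ⊔ S) : Nonempty (X ≃ₗ[A] Y) := by
  have hinj : ∀ Z : Submodule A M, Z ⊓ S = ⊥ → Function.Injective (S.mkQ.comp Z.subtype) := by
    intro Z hZ
    refine (injective_iff_map_eq_zero _).2 fun z hz => ?_
    have h1 : (z : M) ∈ Z ⊓ S := ⟨z.2, (Submodule.Quotient.mk_eq_zero S).1 hz⟩
    rw [hZ] at h1
    exact Subtype.ext h1
  have hr : ∀ Z : Submodule A M, LinearMap.range (S.mkQ.comp Z.subtype) = (Z ⊔ S).map S.mkQ := by
    intro Z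
    rw [LinearMap.range_comp, Submodule.range_subtype, Submodule.map_sup, Submodule.mkQ_map_self,
      sup_bot_eq]
  exact ⟨(LinearEquiv.ofInjective _ (hinj X hX)).trans
    ((LinearEquiv.ofEq _ _ ((hr X).trans (h ▸ (hr Y).symm))).trans
      (LinearEquiv.ofInjective _ (hinj Y hY)).symm)⟩

/-- The radical of a local submodule, seen in the whole module. -/
theorem map_jacobson_eq_of_forall {X J : Submodule A M} (hX : IsLocalModule A X)
    (h : ∀ C ≤ X, len A C + 1 = len A X → C = J) :
    (jacobson A X).map X.subtype = J :=
  h _ (Submodule.map_subtype_le X _)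
    (by rw [len_map_of_injective X.injective_subtype]; exact len_jacobson_of_isLocal hX)

theorem isLocal_sub_of_forall {X J : Submodule A M} (hX : X ≠ ⊥)
    (h : ∀ C ≤ X, len A C + 1 = len A X → C = J) : IsLocalModule A X := by
  by_contra hn
  obtain ⟨C, hC, D, hD, hCl, hDl, hCD⟩ := exists_coatoms_sub_of_not_isLocal hX hn
  exact hCD ((h C hC hCl).trans (h D hD hDl).symm)

theorem map_mkQ_inj {K X Y : Submodule A M} (hX : K ≤ X) (hY : K ≤ Y)
    (h : X.map K.mkQ = Y.map K.mkQ) : X = Y := by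
  have := congrArg (Submodule.comap K.mkQ) h
  rwa [Submodule.comap_map_mkQ, Submodule.comap_map_mkQ, sup_eq_right.2 hX,
    sup_eq_right.2 hY] at this

/-- Submodules of length two between `S` and `M`, when `M / S` has length three and is
indecomposable but not local. -/
theorem IsFourNakayama.quot_len_three (hA : IsFourNakayama A) (hl : len A M = 4)
    {S : Submodule A M} (hS : len A S = 1) (hMS : IsIndecomposableModule A (M ⧸ S))
    {C₁ C₂ : Submodule A M} (h₁ : len A C₁ = 3) (h₂ : len A C₂ = 3) (h₁₂ : C₁ ≠ C₂)
    (hS₁ : S ≤ C₁) (hS₂ : S ≤ C₂) :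
    (∀ X Y : Submodule A M, S ≤ X → S ≤ Y → len A X = 2 → len A Y = 2 → X = Y) ∧
      ∀ C : Submodule A M, S ≤ C → len A C = 3 → C = C₁ ∨ C = C₂ := by
  have hQl := len_quot_add S
  have hmapl : ∀ X : Submodule A M, S ≤ X → len A (X.map S.mkQ) + 1 = len A X := fun X hX => by
    rw [← len_mapQ_add hX, hS]
  have e1 := hmapl C₁ hS₁
  have e2 := hmapl C₂ hS₂
  have hQn : ¬ IsLocalModule A (M ⧸ S) :=
    not_isLocal_of_coatoms (C := C₁.map S.mkQ) (D := C₂.map S.mkQ) (by omega) (by omega)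
      fun h => h₁₂ (map_mkQ_inj hS₁ hS₂ h)
  obtain ⟨hJQl, hatomQ, D₁, D₂, hD₁, hD₂, hD₁₂, hD⟩ := hA.nonlocal_len_three hMS (by omega) hQn
  refine ⟨fun X Y hX hY hXl hYl => map_mkQ_inj hX hY ?_, fun C hC hCl => ?_⟩
  · have e3 := hmapl X hX
    have e4 := hmapl Y hY
    rw [hatomQ _ (by omega : len A (X.map S.mkQ) = 1), hatomQ _ (by omega : len A (Y.map S.mkQ) = 1)]
  · have e3 := hmapl C hC
    have hne : C₁.map S.mkQ ≠ C₂.map S.mkQ := fun h => h₁₂ (map_mkQ_inj hS₁ hS₂ h)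
    have : C.map S.mkQ = C₁.map S.mkQ ∨ C.map S.mkQ = C₂.map S.mkQ := by
      rcases hD _ (by omega : len A (C.map S.mkQ) = 2) with h | h <;>
      rcases hD _ (by omega : len A (C₁.map S.mkQ) = 2) with h' | h' <;>
      rcases hD _ (by omega : len A (C₂.map S.mkQ) = 2) with h'' | h''
      all_goals first
        | exact Or.inl (h.trans h'.symm)
        | exact Or.inr (h.trans h''.symm)
        | exact absurd (h'.trans h''.symm) hne
    exact this.imp (map_mkQ_inj hC hS₁) (map_mkQ_inj hC hS₂)

/-- The top of C₁ is M/C₂ and the top of C₂ is M/C₁. A nonzero map would make these quotients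
isomorphic and create a third maximal submodule of M. -/
theorem hom_quot_jacobson_eq_zero {C₁ C₂ J : Submodule A M} (h₁ : len A C₁ + 1 = len A M)
    (h₂ : len A C₂ + 1 = len A M) (h₁₂ : C₁ ≠ C₂)
    (hC : ∀ C : Submodule A M, len A C + 1 = len A M → C = C₁ ∨ C = C₂)
    (hJ₁ : J ≤ C₁)
    (hl₁ : IsLocalModule A C₁) (hl₂ : IsLocalModule A C₂)
    (hj₂ : (jacobson A C₂).map C₂.subtype = J)
    (f : C₁ →ₗ[A] C₂ ⧸ jacobson A C₂) : f = 0 := by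
  by_contra hf
  have : IsSimpleModule A (C₂ ⧸ jacobson A C₂) := isSimple_quot_jacobson hl₂
  have hfs : Function.Surjective f := LinearMap.surjective_of_ne_zero hf
  have hk₁ : ¬ C₁ ≤ C₂ := fun h => h₁₂ (eq_of_le_of_len_le h (by omega))
  have hk₂ : ¬ C₂ ≤ C₁ := fun h => h₁₂ (eq_of_le_of_len_le h (by omega)).symm
  have hv := mkQ_comp_subtype_surjective h₂ hk₁
  have hw := mkQ_comp_subtype_surjective h₁ hk₂
  have hle : jacobson A C₂ ≤ LinearMap.ker (C₁.mkQ.comp C₂.subtype) := fun x hx =>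
    (Submodule.Quotient.mk_eq_zero C₁).2 (hJ₁ (hj₂ ▸ Submodule.mem_map_of_mem hx))
  let t := (jacobson A C₂).liftQ (C₁.mkQ.comp C₂.subtype) hle
  have ht : Function.Surjective t := fun y => by
    obtain ⟨x, hx⟩ := hw y
    exact ⟨(jacobson A C₂).mkQ x, hx⟩
  have hker : ∀ {T : Type u} [AddCommGroup T] [Module A T] [Module.Finite A T] (g : C₁ →ₗ[A] T),
      len A T = 1 → Function.Surjective g → LinearMap.ker g = jacobson A C₁ := by
    intro T _ _ _ g hT hg
    have e := len_range_add_ker g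
    rw [LinearMap.range_eq_top.2 hg, len_top] at e
    exact coatom_eq_jacobson hl₁ (by omega)
  have e1 := len_quot_add C₁
  have e2 := len_quot_add C₂
  obtain ⟨C₃, h₃, h₃₁, h₃₂⟩ := exists_third_coatom h₁ h₂ h₁₂ (u := t.comp f)
    (v := C₂.mkQ.comp C₁.subtype) (ht.comp hfs) hv
    ((hker _ (by omega) (ht.comp hfs)).trans (hker _ (by omega) hv).symm)
  exact (hC C₃ h₃).elim h₃₁ h₃₂

theorem eq_sup_of_atoms {J S T : Submodule A M} (hJ : len A J = 2) (hS : len A S = 1)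
    (hT : len A T = 1) (hSJ : S ≤ J) (hTJ : T ≤ J) (h : S ≠ T) : J = S ⊔ T := by
  have e1 := len_lt_of_lt (lt_of_le_of_ne le_sup_left fun h' =>
    h (eq_of_le_of_len_le (sup_eq_left.1 h'.symm) (by omega)).symm : S < S ⊔ T)
  exact (eq_of_le_of_len_le (sup_le hSJ hTJ) (by omega)).symm

theorem isSemisimple_of_atoms {J S T : Submodule A M} (hS : len A S = 1)
    (hT : len A T = 1) (h : J = S ⊔ T) : IsSemisimpleModule A J := by
  have := isSemisimple_socle (A := A) (M := M)
  exact isSemisimple_of_le (h.le.trans (sup_le (le_socle_of_len hS) (le_socle_of_len hT)))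

/-- A nonlocal indecomposable module of length four that is not colocal has a simple submodule
with decomposable quotient. -/
theorem IsFourNakayama.exists_atom_decomposable (hA : IsFourNakayama A)
    (hM : IsIndecomposableModule A M) (hn : ¬ IsLocalModule A M) (hl : len A M = 4)
    {S T : Submodule A M} (hS : len A S = 1) (hT : len A T = 1) (hST : S ≠ T) :
    ∃ U : Submodule A M, len A U = 1 ∧ ¬ IsIndecomposableModule A (M ⧸ U) := by
  by_contra! hind
  have := hM.1
  obtain ⟨C₁, C₂, h₁, h₂, h₁₂⟩ := exists_coatoms_of_not_isLocal hn
  obtain ⟨hJ, hJl⟩ := hA.jacobson_eq_inf hM hl (by omega) (by omega) h₁₂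
  obtain ⟨J, hJdef⟩ : ∃ J, J = jacobson A M := ⟨_, rfl⟩
  rw [← hJdef] at hJ hJl
  have hatom : ∀ Z : Submodule A M, len A Z = 1 → Z ≤ J := fun Z hZ =>
    hJdef ▸ atom_le_jacobson_of_isIndecomposable hM (by omega) hZ
  have hJ₁ : J ≤ C₁ := hJ ▸ inf_le_left
  have hJ₂ : J ≤ C₂ := hJ ▸ inf_le_right
  have hJC : ∀ C : Submodule A M, len A C = 3 → J ≤ C := fun C hC =>
    hJdef ▸ jacobson_le_of_len (by omega)
  -- For every simple Z the module M/Z has a single simple submodule, so a submodule of length two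
  -- containing Z coincides with J. Consequently C₁ and C₂ are local with radical J.
  have htwo : ∀ X : Submodule A M, len A X = 2 → X = J := fun X hX => by
    obtain ⟨Z, hZ, hZl⟩ := exists_atom_le (X := X) fun h => by rw [h, len_bot] at hX; omega
    exact (hA.quot_len_three hl hZl (hind Z hZl) (by omega) (by omega) h₁₂
      ((hatom Z hZl).trans hJ₁) ((hatom Z hZl).trans hJ₂)).1 X J hZ (hatom Z hZl) hX hJl
  have hcoat := (hA.quot_len_three hl hS (hind S hS) (by omega) (by omega) h₁₂
      ((hatom S hS).trans hJ₁) ((hatom S hS).trans hJ₂)).2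
  have hcoat' : ∀ C : Submodule A M, len A C + 1 = len A M → C = C₁ ∨ C = C₂ := fun C hC =>
    hcoat C ((hatom S hS).trans (hJC C (by omega))) (by omega)
  have hloc : ∀ C : Submodule A M, len A C = 3 → IsLocalModule A C ∧
      (jacobson A C).map C.subtype = J := fun C hC => by
    have h1 : ∀ D ≤ C, len A D + 1 = len A C → D = J := fun D _ hD => htwo D (by omega)
    have h2 := isLocal_sub_of_forall (fun h => by rw [h, len_bot] at hC; omega) h1
    exact ⟨h2, map_jacobson_eq_of_forall h2 h1⟩
  obtain ⟨hl₁, hj₁⟩ := hloc C₁ (by omega)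
  obtain ⟨hl₂, hj₂⟩ := hloc C₂ (by omega)
  have hJs : IsSemisimpleModule A J :=
    isSemisimple_of_atoms hS hT (eq_sup_of_atoms hJl hS hT (hatom S hS) (hatom T hT) hST)
  have hJJ := isSemisimple_prod hJs hJs
  -- C₁ and C₂ are glued along S only, not along the whole of J, which would return M. The
  -- semisimple module V = (J × J)/S has length three, as the glueing lemma demands.
  let a : S →ₗ[A] J × J :=
    (Submodule.inclusion (hatom S hS)).prod (-Submodule.inclusion (hatom S hS))
  have ha : Function.Injective a := fun x y h =>
    Submodule.inclusion_injective (hatom S hS) (congrArg Prod.fst h)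
  have hal := len_range_of_injective ha
  have hVl := len_quot_add (LinearMap.range a)
  rw [len_prod] at hVl
  have hmem₁ : ∀ x : jacobson A C₁, ((x : C₁) : M) ∈ J := fun x =>
    hj₁ ▸ Submodule.mem_map_of_mem x.2
  have hmem₂ : ∀ x : jacobson A C₂, ((x : C₂) : M) ∈ J := fun x =>
    hj₂ ▸ Submodule.mem_map_of_mem x.2
  let j₁ : jacobson A C₁ →ₗ[A] J :=
    (C₁.subtype.comp (jacobson A C₁).subtype).codRestrict J hmem₁
  let j₂ : jacobson A C₂ →ₗ[A] J :=
    (C₂.subtype.comp (jacobson A C₂).subtype).codRestrict J hmem₂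
  have hj₁i : Function.Injective j₁ := fun x y h => by
    have h' : (j₁ x : M) = j₁ y := congrArg Subtype.val h
    exact Subtype.ext (Subtype.ext h')
  have hj₂i : Function.Injective j₂ := fun x y h => by
    have h' : (j₂ x : M) = j₂ y := congrArg Subtype.val h
    exact Subtype.ext (Subtype.ext h')
  have hj₁l : len A (jacobson A C₁) = 2 := by have := len_jacobson_of_isLocal hl₁; omega
  have hj₂l : len A (jacobson A C₂) = 2 := by have := len_jacobson_of_isLocal hl₂; omega
  have hj₁b := bijective_of_injective_of_len hj₁i (by omega)
  have hj₂b := bijective_of_injective_of_len hj₂i (by omega)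
  refine hA.false_of_glue_injective (V := (J × J) ⧸ LinearMap.range a) hl₁ hl₂ (by omega)
    (φ := (LinearMap.range a).mkQ.comp ((LinearMap.inl A J J).comp j₁))
    (ψ := (LinearMap.range a).mkQ.comp ((LinearMap.inr A J J).comp j₂)) ?_ ?_ ?_ hj₁l.ge hj₂l.ge
    (hom_quot_jacobson_eq_zero h₁ h₂ h₁₂ hcoat' hJ₁ hl₁ hl₂ hj₂)
    (hom_quot_jacobson_eq_zero h₂ h₁ h₁₂.symm (fun C hC => (hcoat' C hC).symm) hJ₂ hl₂ hl₁ hj₁)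
  · refine (injective_iff_map_eq_zero _).2 fun x hx => ?_
    obtain ⟨s, hs⟩ := (Submodule.Quotient.mk_eq_zero (LinearMap.range a)).1 hx
    have e1 : -Submodule.inclusion (hatom S hS) s = 0 := congrArg Prod.snd hs
    have e2 : Submodule.inclusion (hatom S hS) s = j₁ x := congrArg Prod.fst hs
    rw [neg_eq_zero.1 e1] at e2
    exact hj₁i (e2.symm.trans (map_zero j₁).symm)
  · refine (injective_iff_map_eq_zero _).2 fun x hx => ?_
    obtain ⟨s, hs⟩ := (Submodule.Quotient.mk_eq_zero (LinearMap.range a)).1 hx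
    have e1 : Submodule.inclusion (hatom S hS) s = 0 := congrArg Prod.fst hs
    have e2 : -Submodule.inclusion (hatom S hS) s = j₂ x := congrArg Prod.snd hs
    rw [e1, neg_zero] at e2
    exact hj₂i (e2.symm.trans (map_zero j₂).symm)
  · intro v
    obtain ⟨⟨y, z⟩, rfl⟩ := (LinearMap.range a).mkQ_surjective v
    obtain ⟨x, rfl⟩ := hj₁b.2 y
    obtain ⟨w, rfl⟩ := hj₂b.2 z
    exact ⟨x, w, (map_add (LinearMap.range a).mkQ _ _).symm.trans
      (congrArg (LinearMap.range a).mkQ (Prod.ext (add_zero _) (zero_add _)))⟩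

/-- The submodules of nonlocal indecomposable modules of length four that are not colocal. -/
theorem IsFourNakayama.noncolocal_len_four (hA : IsFourNakayama A)
    (hM : IsIndecomposableModule A M) (hn : ¬ IsLocalModule A M) (hl : len A M = 4)
    {S T : Submodule A M} (hS : len A S = 1) (hT : len A T = 1) (hST : S ≠ T) :
    ∃ N₁ N₂ S₁ S₂ : Submodule A M, len A N₁ = 3 ∧ IsLocalModule A N₁ ∧ ¬ IsUniserial A N₁ ∧
      (jacobson A N₁).map N₁.subtype = S₁ ⊔ S₂ ∧ len A N₂ = 2 ∧ IsUniserial A N₂ ∧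
      len A S₁ = 1 ∧ len A S₂ = 1 ∧ S₁ ≠ S₂ ∧ S₁ ⊓ S₂ = ⊥ ∧ socle A M = S₁ ⊔ S₂ ∧ S₂ ≤ N₂ ∧
      S₁ ≤ N₁ ∧ S₂ ≤ N₁ ∧
      (∀ X : Submodule A M, len A X = 1 → X = S₁ ∨ X = S₂) ∧
      (∀ X : Submodule A M, len A X = 2 → X = S₁ ⊔ S₂ ∨
        (S₂ ≤ X ∧ ¬ S₁ ≤ X ∧ Nonempty (X ≃ₗ[A] N₂))) ∧
      ∀ X : Submodule A M, len A X = 3 → X = N₁ ∨ X = N₂ ⊔ S₁ := by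
  have := hM.1
  obtain ⟨C₁, C₂, h₁, h₂, h₁₂⟩ := exists_coatoms_of_not_isLocal hn
  obtain ⟨hJ, hJl⟩ := hA.jacobson_eq_inf hM hl (by omega) (by omega) h₁₂
  obtain ⟨J, hJdef⟩ : ∃ J, J = jacobson A M := ⟨_, rfl⟩
  rw [← hJdef] at hJ hJl
  have hatom : ∀ Z : Submodule A M, len A Z = 1 → Z ≤ J := fun Z hZ =>
    hJdef ▸ atom_le_jacobson_of_isIndecomposable hM (by omega) hZ
  have hJC : ∀ C : Submodule A M, len A C = 3 → J ≤ C := fun C hC =>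
    hJdef ▸ jacobson_le_of_len (by omega)
  have hcompl : ∀ X Y : Submodule A M, len A X = 2 → len A Y = 2 → X ⊓ Y ≠ ⊥ := by
    intro X Y hX hY hi
    have e := len_sup_add_inf X Y
    rw [hi, len_bot] at e
    exact not_isCompl_of_isIndecomposable hM (fun h => by rw [h, len_bot] at hX; omega)
      (fun h => by rw [h, len_bot] at hY; omega) (eq_top_of_len (by omega)) hi
  obtain ⟨S₂, hS₂, hdec⟩ := hA.exists_atom_decomposable hM hn hl hS hT hST
  -- X and Y are the preimages of the summands of M/U. The maximal X contains the radical, so Y in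
  -- the radical would give X + Y = X.
  have hsplit : ∀ U : Submodule A M, len A U = 1 → ¬ IsIndecomposableModule A (M ⧸ U) →
      ∃ X Y : Submodule A M, X ⊔ Y = ⊤ ∧ X ⊓ Y = U ∧ len A X = 3 ∧ len A Y = 2 ∧ ¬ Y ≤ J := by
    intro U hU hdec
    have key : ∀ X Y : Submodule A M, X ⊔ Y = ⊤ → len A X = 3 → ¬ Y ≤ J := fun X Y hs hX h => by
      rw [sup_eq_left.2 (h.trans (hJC X hX))] at hs
      rw [hs, len_top] at hX
      omega
    obtain ⟨Y, Z, hs, hi, hY, hZ⟩ := exists_of_not_isIndecomposable_quot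
      (fun h => by rw [h, len_top] at hU; omega) hdec
    have e1 := len_sup_add_inf Y Z
    rw [hs, hi, len_top] at e1
    have e2 := len_lt_of_lt (lt_of_le_of_ne (hi ▸ inf_le_left) hY.symm)
    have e3 := len_lt_of_lt (lt_of_le_of_ne (hi ▸ inf_le_right) hZ.symm)
    rcases (by omega : (len A Y = 3 ∧ len A Z = 2) ∨ (len A Z = 3 ∧ len A Y = 2)) with e | e
    · exact ⟨Y, Z, hs, hi, e.1, e.2, key Y Z hs e.1⟩
    · exact ⟨Z, Y, sup_comm Y Z ▸ hs, inf_comm Y Z ▸ hi, e.1, e.2, key Z Y (sup_comm Y Z ▸ hs) e.1⟩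
  obtain ⟨N₁, N₂, hs, hi, hN₁l, hN₂l, hNJ⟩ := hsplit S₂ hS₂ hdec
  have hS₂N₂ : S₂ ≤ N₂ := hi ▸ inf_le_right
  have hS₂N₁ : S₂ ≤ N₁ := hi ▸ inf_le_left
  have hJN₁ := hJC N₁ hN₁l
  obtain ⟨S₁, hS₁, hS₁₂⟩ : ∃ S₁ : Submodule A M, len A S₁ = 1 ∧ S₁ ≠ S₂ := by
    by_cases h : S = S₂
    · exact ⟨T, hT, h ▸ hST.symm⟩
    · exact ⟨S, hS, h⟩
  have hsup : ∀ Z : Submodule A M, len A Z = 1 → Z ≠ S₂ → J = Z ⊔ S₂ := fun Z hZ hne =>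
    eq_sup_of_atoms hJl hZ hS₂ (hatom Z hZ) (hatom S₂ hS₂) hne
  have hJS := hsup S₁ hS₁ hS₁₂
  have hN₂a : ∀ Z ≤ N₂, len A Z = 1 → Z = S₂ := fun Z hZ hZl => by
    by_contra hne
    have h1 : J ≤ N₂ := (hsup Z hZl hne).le.trans (sup_le hZ hS₂N₂)
    exact hNJ (eq_of_le_of_len_le h1 (by omega)).ge
  have hN₂u := isUniserial_of_len_two hN₂l hN₂a
  -- Y meets N₂ by indecomposability, exactly in S₂, so Y + N₂ is maximal and contains the radical.
  -- By the modular law it meets N₁ in Y.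
  have hN₁two : ∀ Y ≤ N₁, len A Y + 1 = len A N₁ → Y = J := fun Y hY hYl => by
    have h1 : Y ⊓ N₂ ≤ S₂ := (inf_le_inf_right N₂ hY).trans hi.le
    have h2 := len_pos_of_ne_bot (hcompl Y N₂ (by omega) hN₂l)
    have h3 := eq_of_le_of_len_le h1 (by omega)
    have h4 := len_sup_add_inf Y N₂
    rw [h3] at h4
    have h5 : (Y ⊔ N₂) ⊓ N₁ = Y := by
      rw [sup_inf_assoc_of_le _ hY, inf_comm, hi, sup_eq_left]
      exact h3 ▸ inf_le_left
    exact (eq_of_le_of_len_le (h5 ▸ le_inf (hJC _ (by omega)) hJN₁) (by omega)).symm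
  have hN₁loc := isLocal_sub_of_forall (fun h => by rw [h, len_bot] at hN₁l; omega) hN₁two
  have hN₁J := map_jacobson_eq_of_forall hN₁loc hN₁two
  have hJN₁l := len_jacobson_of_isLocal hN₁loc
  -- Simple submodules of M are maximal submodules of J, the radical of the local module N₁; there
  -- are at most two of those.
  have hatoms : ∀ Z : Submodule A M, len A Z = 1 → Z = S₁ ∨ Z = S₂ := by
    have hle : ∀ Z : Submodule A M, len A Z = 1 → Z ≤ N₁ := fun Z hZ => (hatom Z hZ).trans hJN₁
    have hle' : ∀ Z : Submodule A M, len A Z = 1 → Z.comap N₁.subtype ≤ jacobson A N₁ := by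
      intro Z hZ x hx
      have h1 : (x : M) ∈ (jacobson A N₁).map N₁.subtype := hN₁J ▸ hatom Z hZ hx
      obtain ⟨y, hy, hyx⟩ := h1
      rwa [← Subtype.ext hyx]
    have hmap : ∀ Z : Submodule A M, len A Z = 1 → (Z.comap N₁.subtype).map N₁.subtype = Z :=
      fun Z hZ => by rw [Submodule.map_comap_subtype, inf_eq_right.2 (hle Z hZ)]
    have hlc : ∀ Z : Submodule A M, len A Z = 1 →
        len A (Z.comap N₁.subtype) + 1 = len A (jacobson A N₁) := fun Z hZ => by
      rw [len_comap_subtype (hle Z hZ)]; omega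
    intro Z hZ
    refine (hA.jacobson_coatom_le hN₁loc (hle' S₁ hS₁) (hle' S₂ hS₂) (hle' Z hZ) (hlc S₁ hS₁)
      (hlc S₂ hS₂) (hlc Z hZ) fun h => hS₁₂ ?_).imp (fun h => ?_) fun h => ?_
    · rw [← hmap S₁ hS₁, h, hmap S₂ hS₂]
    · rw [← hmap Z hZ, h, hmap S₁ hS₁]
    · rw [← hmap Z hZ, h, hmap S₂ hS₂]
  have hS₁N₁ : S₁ ≤ N₁ := (hatom S₁ hS₁).trans hJN₁
  have hS₁N₂ : ¬ S₁ ≤ N₂ := fun h => hS₁₂ (hN₂a S₁ h hS₁)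
  have hinf : ∀ X : Submodule A M, ¬ S₁ ≤ X → X ⊓ S₁ = ⊥ := fun X hX =>
    inf_comm X S₁ ▸ (disjoint_or_le (X := X) hS₁).resolve_right hX
  have hsupl : ∀ X : Submodule A M, len A X = 2 → ¬ S₁ ≤ X → len A (X ⊔ S₁ : Submodule A M) = 3 :=
    fun X hX h => by
      have e := len_sup_add_inf X S₁
      rw [hinf X h, len_bot] at e
      omega
  have hEl := hsupl N₂ hN₂l hS₁N₂
  have hEN : N₂ ⊔ S₁ ≠ N₁ := fun h => by
    rw [sup_eq_left.2 (le_sup_left.trans h.le)] at hs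
    rw [hs, len_top] at hN₁l
    omega
  have hge : ∀ X : Submodule A M, len A X = 2 → ¬ S₁ ≤ X → S₂ ≤ X := fun X hX h => by
    obtain ⟨Z, hZ, hZl⟩ := exists_atom_le (X := X) fun h => by rw [h, len_bot] at hX; omega
    rcases hatoms Z hZl with rfl | rfl
    · exact absurd hZ h
    · exact hZ
  have hS₁X : ∀ X : Submodule A M, len A X = 2 → S₁ ≤ X → X = J := fun X hX h => by
    obtain ⟨Z, hZ, hZl⟩ := exists_atom_le (hcompl X N₂ hX hN₂l)
    have h1 := hN₂a Z (hZ.trans inf_le_right) hZl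
    exact (eq_of_le_of_len_le (hJS.le.trans (sup_le h (h1 ▸ hZ.trans inf_le_left)))
      (by omega)).symm
  have hthree : ∀ X : Submodule A M, len A X = 3 → X = N₁ ∨ X = N₂ ⊔ S₁ := by
    intro X hX
    -- If M/S₁ decomposed, there would be a submodule of length two containing S₁ outside the
    -- radical, contrary to `hS₁X`. So M/S₁ is indecomposable with exactly two maximal submodules.
    by_cases hd : IsIndecomposableModule A (M ⧸ S₁)
    · exact (hA.quot_len_three hl hS₁ hd hN₁l hEl hEN.symm hS₁N₁ le_sup_right).2 X
        ((hatom S₁ hS₁).trans (hJC X hX)) hX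
    · exfalso
      obtain ⟨Y, Z, -, hi', -, hZl, hZJ⟩ := hsplit S₁ hS₁ hd
      exact hZJ (hS₁X Z hZl (hi' ▸ inf_le_right)).le
  refine ⟨N₁, N₂, S₁, S₂, hN₁l, hN₁loc, fun h => hS₁₂ (eq_of_isUniserial_of_len h hS₁N₁ hS₂N₁
    (by omega)), hN₁J.trans hJS, hN₂l, hN₂u, hS₁, hS₂, hS₁₂,
    (disjoint_or_le hS₁).resolve_right fun h => hS₁₂ (eq_of_le_of_len_le h (by omega)),
    le_antisymm (socle_le fun Z hZ => hJS ▸ hatom Z hZ)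
      (sup_le (le_socle_of_len hS₁) (le_socle_of_len hS₂)), hS₂N₂, hS₁N₁, hS₂N₁, hatoms,
    fun X hX => ?_, hthree⟩
  by_cases hSX : S₁ ≤ X
  · exact Or.inl ((hS₁X X hX hSX).trans hJS)
  have hS₂X := hge X hX hSX
  refine Or.inr ⟨hS₂X, hSX, ?_⟩
  -- If X + S₁ = N₁, then X = J contains S₁. If X + S₁ = N₂ + S₁, then X and N₂ are complements of
  -- S₁ in the same module.
  rcases hthree _ (hsupl X hX hSX) with h | h
  · exact absurd ((hatom S₁ hS₁).trans (hN₁two X (h ▸ le_sup_left) (by omega)).ge) hSX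
  · exact nonempty_equiv_of_sup_eq (hinf X hSX) (hinf N₂ hS₁N₂) h

end NonColocalModules

/-! ### Local modules of length three and four, and decomposable radicals. -/

section LocalModules

variable {A : Type u} [Ring A] [IsArtinianRing A]
variable {M N : Type u} [AddCommGroup M] [Module A M] [Module.Finite A M]
  [AddCommGroup N] [Module A N] [Module.Finite A N]

theorem not_isSimple_of_len_two {X : Submodule A M} (h : len A X = 2) : ¬ IsSimpleModule A X :=
  fun hs => by rw [len_eq_one_iff.2 hs] at h; omega

theorem len_sup_of_inf {X Y : Submodule A M} (h : X ⊓ Y = ⊥) :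
    len A (X ⊔ Y : Submodule A M) = len A X + len A Y := by
  rw [← len_sup_add_inf, h, len_bot, add_zero]

theorem ne_bot_of_len {X : Submodule A M} (h : 1 ≤ len A X) : X ≠ ⊥ := fun h0 => by
  rw [h0, len_bot] at h; omega

theorem ne_top_of_len {X : Submodule A M} (h : len A X < len A M) : X ≠ ⊤ := fun h0 => by
  rw [h0, len_top] at h; omega

theorem inf_eq_bot_of_atoms {X Y : Submodule A M} (hX : len A X = 1) (hY : len A Y = 1)
    (h : X ≠ Y) : X ⊓ Y = ⊥ :=
  (disjoint_or_le hX).resolve_right fun h' => h (eq_of_le_of_len_le h' (by omega))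

theorem exists_coatom_sub {X : Submodule A M} (h : X ≠ ⊥) : ∃ C ≤ X, len A C + 1 = len A X := by
  have h0 : (⊥ : Submodule A X) ≠ ⊤ := fun h0 => h (by
    have := congrArg (Submodule.map X.subtype) h0
    rw [Submodule.map_bot, Submodule.map_top, Submodule.range_subtype] at this
    exact this.symm)
  obtain ⟨C, -, hC⟩ := exists_coatom_ge h0
  exact ⟨C.map X.subtype, Submodule.map_subtype_le X C,
    by rwa [len_map_of_injective X.injective_subtype]⟩

theorem isUniserial_congr (e : M ≃ₗ[A] N) (h : IsUniserial A N) : IsUniserial A M :=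
  isUniserial_of_injective (f := e.toLinearMap) e.injective h

theorem nonempty_equiv_of_range_eq {L : Type u} [AddCommGroup L] [Module A L] {f : M →ₗ[A] L}
    {g : N →ₗ[A] L} (hf : Function.Injective f) (hg : Function.Injective g)
    (h : LinearMap.range f = LinearMap.range g) : Nonempty (M ≃ₗ[A] N) :=
  ⟨(LinearEquiv.ofInjective f hf).trans
    ((LinearEquiv.ofEq _ _ h).trans (LinearEquiv.ofInjective g hg).symm)⟩

theorem injective_mkQ_comp_subtype {X S : Submodule A M} (h : X ⊓ S = ⊥) :
    Function.Injective (S.mkQ.comp X.subtype) := by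
  refine (injective_iff_map_eq_zero _).2 fun z hz => ?_
  have h1 : (z : M) ∈ X ⊓ S := ⟨z.2, (Submodule.Quotient.mk_eq_zero S).1 hz⟩
  rw [h] at h1
  exact Subtype.ext h1

/-- Direct summands of the radical of a decomposable radical are local. -/
theorem IsFourNakayama.isLocal_of_jacobson_eq_sup (hA : IsFourNakayama A) (hM : IsLocalModule A M)
    {X Y : Submodule A M} (hs : X ⊔ Y = jacobson A M) (hi : X ⊓ Y = ⊥) (hX : X ≠ ⊥) (hY : Y ≠ ⊥) :
    IsLocalModule A X := by
  by_contra hn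
  -- Then C + Y, D + Y and X + E are three maximal submodules of the radical, where E is maximal in
  -- Y.
  obtain ⟨C, hC, D, hD, hCl, hDl, hCD⟩ := exists_coatoms_sub_of_not_isLocal hX hn
  obtain ⟨E, hE, hEl⟩ := exists_coatom_sub hY
  have e0 := len_sup_of_inf hi
  rw [hs] at e0
  have hinf : ∀ Z ≤ X, Z ⊓ Y = ⊥ := fun Z hZ => by
    rw [eq_bot_iff, ← hi]; exact inf_le_inf_right Y hZ
  have e1 := len_sup_of_inf (hinf C hC)
  have e2 := len_sup_of_inf (hinf D hD)
  have e3 := len_sup_of_inf (X := X) (Y := E)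
    (by rw [eq_bot_iff, ← hi]; exact inf_le_inf_left X hE)
  have hmod : ∀ Z ≤ X, (Z ⊔ Y) ⊓ X = Z := fun Z hZ => by
    rw [sup_inf_assoc_of_le _ hZ, inf_comm, hi, sup_bot_eq]
  have hne : ∀ Z ≤ X, len A Z + 1 = len A X → X ⊔ E ≠ Z ⊔ Y := fun Z hZ hZl h => by
    have h1 : X ≤ (Z ⊔ Y) ⊓ X := le_inf (h ▸ le_sup_left) le_rfl
    rw [hmod Z hZ] at h1
    have := len_mono h1
    omega
  rcases hA.jacobson_coatom_le hM (hs ▸ sup_le_sup_right hC Y) (hs ▸ sup_le_sup_right hD Y)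
    (hs ▸ sup_le_sup_left hE X) (by omega) (by omega) (by omega)
    (fun h => hCD (by rw [← hmod C hC, h, hmod D hD])) with h | h
  · exact hne C hC hCl h
  · exact hne D hD hDl h

/-- The radical of the local module `M ⧸ S` is isomorphic to `X`, which is local as a direct summand
of the radical. A local module with local radical is uniserial. -/
theorem IsFourNakayama.isUniserial_of_jacobson_eq_sup (hA : IsFourNakayama A)
    (hM : IsLocalModule A M) {X S : Submodule A M} (hs : X ⊔ S = jacobson A M) (hi : X ⊓ S = ⊥)
    (hX : X ≠ ⊥) (hS : len A S = 1) : IsUniserial A X := by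
  have hloc := hA.isLocal_of_jacobson_eq_sup hM hs hi hX (ne_bot_of_len hS.ge)
  have hSJ : S ≤ jacobson A M := hs ▸ le_sup_right
  have hJl := len_jacobson_of_isLocal hM
  have hXl := len_sup_of_inf hi
  rw [hs] at hXl
  have hX1 := len_pos_of_ne_bot hX
  have hQl := len_quot_add S
  have : Nontrivial (M ⧸ S) := by
    by_contra h
    rw [not_nontrivial_iff_subsingleton, ← len_eq_zero_iff (A := A)] at h
    omega
  have hQ := isLocal_of_surjective S.mkQ_surjective hM
  have hXm := len_range_of_injective (injective_mkQ_comp_subtype hi)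
  have hr : LinearMap.range (S.mkQ.comp X.subtype) = jacobson A (M ⧸ S) :=
    coatom_eq_jacobson hQ (by omega)
  have hne : Nontrivial (LinearMap.range (S.mkQ.comp X.subtype)) := by
    by_contra h
    rw [not_nontrivial_iff_subsingleton, ← len_eq_zero_iff (A := A)] at h
    omega
  have hrl := isLocal_of_surjective (S.mkQ.comp X.subtype).surjective_rangeRestrict hloc
  rw [hr] at hrl
  by_contra hu
  exact hA.not_isLocal_jacobson hQ
    (fun h => hu (isUniserial_of_injective (injective_mkQ_comp_subtype hi) h)) hrl

/-- The two maximal submodules of the radical are simple here, so the radical is their sum and is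
the socle. -/
theorem IsFourNakayama.local_len_three (hA : IsFourNakayama A) (hM : IsLocalModule A M)
    (hu : ¬ IsUniserial A M) (hl : len A M = 3) :
    ∃ S₁ S₂ : Submodule A M,
      IsSimpleModule A S₁ ∧ IsSimpleModule A S₂ ∧ Disjoint S₁ S₂ ∧
      jacobson A M = socle A M ∧ socle A M = S₁ ⊔ S₂ ∧
      ∀ X : Submodule A M, X ∈ ({⊥, S₁, S₂, jacobson A M, ⊤} : Set (Submodule A M)) := by
  have hJl := len_jacobson_of_isLocal hM
  obtain ⟨S₁, S₂, h₁, h₂, h₁l, h₂l, h₁₂, hC⟩ := hA.exists_jacobson_coatoms hM hu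
  have hJ := eq_sup_of_atoms (by omega) (by omega) (by omega) h₁ h₂ h₁₂
  have hatom : ∀ Z : Submodule A M, len A Z = 1 → Z ≤ jacobson A M := fun Z hZ =>
    atom_le_jacobson_of_isLocal hM (by omega) hZ
  have hsoc : socle A M = jacobson A M := le_antisymm (socle_le hatom)
    (hJ.le.trans (sup_le (le_socle_of_len (by omega)) (le_socle_of_len (by omega))))
  refine ⟨S₁, S₂, len_eq_one_iff.1 (by omega), len_eq_one_iff.1 (by omega),
    disjoint_iff.2 (inf_eq_bot_of_atoms (by omega) (by omega) h₁₂), hsoc.symm, hsoc.trans hJ,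
    fun X => ?_⟩
  simp only [Set.mem_insert_iff, Set.mem_singleton_iff]
  have hX := len_le X
  rcases (by omega : len A X = 0 ∨ len A X = 1 ∨ len A X = 2 ∨ len A X = 3) with h | h | h | h
  · exact Or.inl (len_sub_eq_zero_iff.1 h)
  · rcases hC X (hatom X h) (by omega) with h | h <;> tauto
  · have := coatom_eq_jacobson hM (C := X) (by omega)
    tauto
  · have := eq_top_of_len (X := X) (by omega)
    tauto

/-- Decomposable radicals of local modules of length four. -/
theorem IsFourNakayama.local_len_four_of_sup (hA : IsFourNakayama A) (hM : IsLocalModule A M)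
    (hl : len A M = 4) {N S₁ : Submodule A M} (hs : N ⊔ S₁ = jacobson A M) (hi : N ⊓ S₁ = ⊥)
    (hNl : len A N = 2) (hS₁ : len A S₁ = 1) :
    IsUniserial A N ∧ ∃ S₂ ≤ N, len A S₂ = 1 ∧ socle A M = S₁ ⊔ S₂ ∧ S₁ ⊓ S₂ = ⊥ ∧
      (∀ Z : Submodule A M, len A Z = 1 → Z = S₂ ∨ Nonempty (Z ≃ₗ[A] S₁)) ∧
      ∀ X : Submodule A M, len A X = 2 → X = N ∨ X = S₁ ⊔ S₂ := by
  have hN := hA.isUniserial_of_jacobson_eq_sup hM hs hi (ne_bot_of_len (by omega)) hS₁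
  obtain ⟨S₂, hS₂N, hS₂⟩ := exists_atom_le (X := N) (ne_bot_of_len (by omega))
  have hJl := len_jacobson_of_isLocal hM
  have hd : S₁ ⊓ S₂ = ⊥ := by
    rw [eq_bot_iff, ← hi, inf_comm]; exact inf_le_inf_right S₁ hS₂N
  have hsl := len_sup_of_inf hd
  have hS₁N : ¬ S₁ ≤ N := fun h => ne_bot_of_len hS₁.ge (by rw [← hi, inf_eq_right.2 h])
  have hNJ : N ≤ jacobson A M := hs ▸ le_sup_left
  have hS₁J : S₁ ≤ jacobson A M := hs ▸ le_sup_right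
  have htwo : ∀ X : Submodule A M, len A X = 2 → X = N ∨ X = S₁ ⊔ S₂ := fun X hX =>
    hA.jacobson_coatom_le hM hNJ (sup_le hS₁J (hS₂N.trans hNJ))
      (le_jacobson_of_isLocal hM (ne_top_of_len (by omega))) (by omega) (by omega) (by omega)
      fun h => hS₁N (h ▸ le_sup_left)
  -- For Z ≠ S₁ the sum Z + S₁ has length two and is not N, which misses S₁; so it is S₁ + S₂.
  have hatom : ∀ Z : Submodule A M, len A Z = 1 → Z ≤ S₁ ⊔ S₂ := fun Z hZ => by
    by_cases h : Z = S₁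
    · exact h ▸ le_sup_left
    have h1 := len_sup_of_inf (inf_eq_bot_of_atoms hZ hS₁ h)
    rcases htwo (Z ⊔ S₁) (by omega) with h2 | h2
    · exact absurd (h2 ▸ le_sup_right) hS₁N
    · exact h2 ▸ le_sup_left
  refine ⟨hN, S₂, hS₂N, hS₂, le_antisymm (socle_le hatom)
    (sup_le (le_socle_of_len hS₁) (le_socle_of_len hS₂)), hd, fun Z hZ => ?_, htwo⟩
  by_cases h : Z ≤ N
  · exact Or.inl (eq_of_isUniserial_of_len hN h hS₂N (by omega))
  · have h1 := (disjoint_or_le hZ).resolve_right h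
    have h2 := len_sup_of_inf h1
    refine Or.inr (nonempty_equiv_of_sup_eq h1 (inf_comm N S₁ ▸ hi) ?_)
    rw [sup_comm S₁, hs]
    exact eq_of_le_of_len_le
      (sup_le (atom_le_jacobson_of_isLocal hM (by omega) hZ) hNJ) (by omega)

/-- The alternatives are an indecomposable radical, which is then a non-local indecomposable module
of length three, and a decomposable one with summands of length two and one. -/
theorem IsFourNakayama.local_len_four (hA : IsFourNakayama A) (hM : IsLocalModule A M)
    (hu : ¬ IsUniserial A M) (hl : len A M = 4) :
    (IsLocalModule A M ∧ IsColocalModule A M ∧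
        ¬ IsLocalModule A (jacobson A M) ∧
        IsFactorSerial 3 A (jacobson A M) ∧
        Module.length A (jacobson A M) = 3 ∧
        ∃ N₁ N₂ : Submodule A M,
          Module.length A N₁ = 2 ∧ IsUniserial A N₁ ∧
          Module.length A N₂ = 2 ∧ IsUniserial A N₂ ∧ N₁ ≠ N₂ ∧
          ∀ X : Submodule A M,
            X ∈ ({⊥, socle A M, N₁, N₂, jacobson A M, ⊤} : Set (Submodule A M))) ∨
    (IsLocalModule A M ∧ ¬ IsSimpleModule A (socle A M) ∧
        ∃ N S₁ S₂ : Submodule A M,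
          jacobson A M = N ⊔ S₁ ∧ Disjoint N S₁ ∧
          Module.length A N = 2 ∧ IsUniserial A N ∧
          IsSimpleModule A S₁ ∧ IsSimpleModule A S₂ ∧
          socle A M = S₁ ⊔ S₂ ∧ Disjoint S₁ S₂ ∧ socleOf A N = S₂ ∧
          ∀ X : Submodule A M,
            X ∈ ({⊥, S₁, S₂, socle A M, N, jacobson A M, ⊤} :
              Set (Submodule A M)) ∨ Nonempty (X ≃ₗ[A] S₁)) := by
  have hJl := len_jacobson_of_isLocal hM
  have hJn := hA.not_isLocal_jacobson hM hu
  have hatom : ∀ Z : Submodule A M, len A Z = 1 → Z ≤ jacobson A M := fun Z hZ =>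
    atom_le_jacobson_of_isLocal hM (by omega) hZ
  by_cases hind : IsIndecomposableModule A (jacobson A M)
  · left
    obtain ⟨S, -, hS⟩ := exists_atom_le (X := jacobson A M) (ne_bot_of_len (by omega))
    have hatoms : ∀ Z : Submodule A M, len A Z = 1 → Z = S := by
      have h := (hA.nonlocal_len_three hind (by omega) hJn).2.1
      have h' : ∀ Z : Submodule A M, len A Z = 1 →
          Z = (jacobson A (jacobson A M)).map (jacobson A M).subtype := fun Z hZ => by
        rw [← h (Z.comap (jacobson A M).subtype) (by rwa [len_comap_subtype (hatom Z hZ)]),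
          Submodule.map_comap_subtype, inf_eq_right.2 (hatom Z hZ)]
      exact fun Z hZ => (h' Z hZ).trans (h' S hS).symm
    have hsoc := socle_eq_of_forall hS hatoms
    obtain ⟨C₁, C₂, h₁, h₂, h₁l, h₂l, h₁₂, hC⟩ := hA.exists_jacobson_coatoms hM hu
    have := hind.1
    refine ⟨hM, ?_, hJn, isFactorSerial_of_not_isLocal (by omega) hJn (by omega),
      (length_eq_iff (n := 3)).2 (by omega), C₁, C₂, (length_eq_iff (n := 2)).2 (by omega),
      isUniserial_of_len_two (by omega) fun Z _ hZ => hatoms Z hZ, (length_eq_iff (n := 2)).2 (by omega),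
      isUniserial_of_len_two (by omega) fun Z _ hZ => hatoms Z hZ, h₁₂, fun X => ?_⟩
    · rw [IsColocalModule, hsoc]
      exact len_eq_one_iff.1 hS
    simp only [Set.mem_insert_iff, Set.mem_singleton_iff]
    have hX := len_le X
    rcases (by omega : len A X = 0 ∨ len A X = 1 ∨ len A X = 2 ∨ len A X = 3 ∨ len A X = 4)
      with h | h | h | h | h
    · exact Or.inl (len_sub_eq_zero_iff.1 h)
    · exact Or.inr (Or.inl ((hatoms X h).trans hsoc.symm))
    · rcases hC X (le_jacobson_of_isLocal hM (ne_top_of_len (by omega))) (by omega) with h | h <;>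
      tauto
    · have := coatom_eq_jacobson hM (C := X) (by omega)
      tauto
    · have := eq_top_of_len (X := X) (by omega)
      tauto
  · right
    obtain ⟨N, S₁, hs, hi, hNl, hS₁⟩ : ∃ N S₁ : Submodule A M, N ⊔ S₁ = jacobson A M ∧
        N ⊓ S₁ = ⊥ ∧ len A N = 2 ∧ len A S₁ = 1 := by
      obtain ⟨Y, Z, hs, hi, hY, hZ⟩ :=
        exists_of_not_isIndecomposable_sub (ne_bot_of_len (by omega)) hind
      have e1 := len_sup_of_inf hi
      rw [hs] at e1
      have e2 := len_pos_of_ne_bot hY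
      have e3 := len_pos_of_ne_bot hZ
      rcases (by omega : (len A Y = 2 ∧ len A Z = 1) ∨ (len A Z = 2 ∧ len A Y = 1)) with e | e
      · exact ⟨Y, Z, hs, hi, e.1, e.2⟩
      · exact ⟨Z, Y, sup_comm Y Z ▸ hs, inf_comm Y Z ▸ hi, e.1, e.2⟩
    obtain ⟨hN, S₂, hS₂N, hS₂, hsoc, hd, hone, htwo⟩ :=
      hA.local_len_four_of_sup hM hl hs hi hNl hS₁
    refine ⟨hM, ?_, N, S₁, S₂, hs.symm, disjoint_iff.2 hi, length_eq_iff.2 hNl, hN,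
      len_eq_one_iff.1 hS₁, len_eq_one_iff.1 hS₂, hsoc, disjoint_iff.2 hd,
      socleOf_eq_of_isUniserial hS₂ hS₂N hN, fun X => ?_⟩
    · rw [hsoc]
      exact not_isSimple_of_len_two (by have := len_sup_of_inf hd; omega)
    simp only [Set.mem_insert_iff, Set.mem_singleton_iff]
    have hX := len_le X
    rcases (by omega : len A X = 0 ∨ len A X = 1 ∨ len A X = 2 ∨ len A X = 3 ∨ len A X = 4)
      with h | h | h | h | h
    · exact Or.inl (Or.inl (len_sub_eq_zero_iff.1 h))
    · rcases hone X h with h | h <;> tauto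
    · rcases htwo X h with h | h
      · tauto
      · rw [← hsoc] at h; tauto
    · have := coatom_eq_jacobson hM (C := X) (by omega)
      tauto
    · have := eq_top_of_len (X := X) (by omega)
      tauto

end LocalModules

/-! ### Local modules of length five. -/

section LocalModulesOfLengthFive

variable {A : Type u} [Ring A] [IsArtinianRing A]
variable {M N : Type u} [AddCommGroup M] [Module A M] [Module.Finite A M]
  [AddCommGroup N] [Module A N] [Module.Finite A N]

theorem nontrivial_of_len (h : 1 ≤ len A M) : Nontrivial M := by
  by_contra h'
  rw [not_nontrivial_iff_subsingleton, ← len_eq_zero_iff (A := A)] at h'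
  omega

theorem isUniserial_range {f : M →ₗ[A] N} (hf : Function.Injective f) (h : IsUniserial A M) :
    IsUniserial A (LinearMap.range f) :=
  isUniserial_congr (LinearEquiv.ofInjective f hf).symm h

theorem not_isUniserial_of_atoms {S T : Submodule A M} (hS : len A S = 1) (hT : len A T = 1)
    (hST : S ≠ T) {X : Submodule A M} (hSX : S ≤ X) (hTX : T ≤ X) : ¬ IsUniserial A X := fun h =>
  hST (eq_of_isUniserial_of_len h hSX hTX (by omega))

/-- An additional simple submodule of a local module of length four. -/
theorem IsFourNakayama.exists_equiv_of_atom (hA : IsFourNakayama A) (hM : IsLocalModule A M)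
    (hl : len A M = 4) {X S Z : Submodule A M} (hs : X ⊔ S = jacobson A M) (hi : X ⊓ S = ⊥)
    (hX : len A X = 2) (hS : len A S = 1) (hZ : len A Z = 1) (hZS : Z ≠ S) (hZX : ¬ Z ≤ X) :
    Nonempty ((M ⧸ X) ≃ₗ[A] X) := by
  obtain ⟨hXu, T, hTX, hT, hsoc, hd, -, htwo⟩ := hA.local_len_four_of_sup hM hl hs hi hX hS
  have hZT : Z ≠ T := fun h => hZX (h ▸ hTX)
  have hST : S ≠ T := fun h => by rw [h, inf_idem] at hd; exact ne_bot_of_len hT.ge hd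
  have hZs : Z ≤ S ⊔ T := hsoc ▸ le_socle_of_len hZ
  have hl2 := len_sup_of_inf hd
  have hSZ := eq_sup_of_atoms (by omega) hS hZ le_sup_left hZs hZS.symm
  have hTZ := eq_sup_of_atoms (by omega) hT hZ le_sup_right hZs hZT.symm
  -- S and T are both complements of Z in the socle, hence isomorphic.
  obtain ⟨e⟩ := nonempty_equiv_of_sup_eq (inf_eq_bot_of_atoms hS hZ hZS.symm)
    (inf_eq_bot_of_atoms hT hZ hZT.symm) (hSZ.symm.trans hTZ)
  have hQl := len_quot_add X
  have hi' : Function.Injective (T.subtype.comp e.toLinearMap) :=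
    T.injective_subtype.comp e.injective
  have hr : LinearMap.range (T.subtype.comp e.toLinearMap) ≤ T := by
    rintro _ ⟨s, rfl⟩
    exact (e s).2
  have hj := injective_mkQ_comp_subtype (inf_comm X S ▸ hi)
  have hle : ∀ Y : Submodule A M, len A Y = 2 → T ≤ Y := fun Y hY => by
    rcases htwo Y hY with rfl | rfl
    · exact hTX
    · exact le_sup_right
  have hJl := len_jacobson_of_isLocal hM
  -- The embedding S ≅ T ⊆ M is extended along S → M/X, the socle of a uniserial module of length
  -- two. The image is uniserial of length two, so it is X and not the socle S + T.
  obtain ⟨h, hh⟩ := hA.exists_extension hM (by omega) (by omega : len A (M ⧸ X) = 2) hS _ hi' _ hj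
    (fun Y₁ Y₂ hs hd hY₁ hY₂ => by
      have e1 := len_sup_of_inf hd
      rw [hs] at e1
      have e2 := len_pos_of_ne_bot hY₁
      have e3 := len_pos_of_ne_bot hY₂
      rcases (by omega : len A Y₁ = 2 ∨ len A Y₂ = 2) with e | e
      · exact Or.inl ⟨hr.trans (hle Y₁ e), e.ge⟩
      · exact Or.inr ⟨hr.trans (hle Y₂ e), e.ge⟩)
  have := nontrivial_of_len (by omega : 1 ≤ len A (M ⧸ X))
  have hQu : IsUniserial A (M ⧸ X) := isUniserial_of_isLocal_of_len_two
    (isLocal_of_surjective X.mkQ_surjective hM) (by omega)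
  have hhi : Function.Injective h := injective_of_comp_injective hQu hS hj (by
    rwa [show h.comp (X.mkQ.comp S.subtype) = T.subtype.comp e.toLinearMap from LinearMap.ext hh])
  have hru := isUniserial_range hhi hQu
  have hrl := len_range_of_injective hhi
  rcases htwo (LinearMap.range h) (by omega) with h1 | h1
  · exact ⟨(LinearEquiv.ofInjective h hhi).trans (LinearEquiv.ofEq _ _ h1)⟩
  · rw [h1] at hru
    exact absurd hru (not_isUniserial_of_atoms hS hT hST le_sup_left le_sup_right)

/-- The fibre product has length 5 + 3 − 2 = 6 and maps onto the non-uniserial `M`. A local module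
that is not uniserial has length at most five, so the projection to `M` splits and gives a lift of
`p`. The lift is onto because the kernel of `q` is small. -/
theorem IsFourNakayama.exists_surjective_of_len_five (hA : IsFourNakayama A)
    (hM : IsLocalModule A M) (hu : ¬ IsUniserial A M) (hl : len A M = 5) (hN : IsUniserial A N)
    (hNl : len A N = 3) {T : Type u} [AddCommGroup T] [Module A T] [Module.Finite A T]
    (hT : len A T = 2) {p : M →ₗ[A] T} {q : N →ₗ[A] T} (hp : Function.Surjective p)
    (hq : Function.Surjective q) :
    ∃ g : M →ₗ[A] N, Function.Surjective g ∧ ∀ m, q (g m) = p m := by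
  have hPl := len_fiberProduct (f := p) hq
  rcases isLocal_fiberProduct_or_exists_hom (u := p) hM hq (by omega) with h | ⟨g, hg⟩
  · have := hA.len_le_of_isLocal h
      fun h' => hu (isUniserial_of_surjective (fiberFst_surjective hq) h')
    omega
  · refine ⟨g, LinearMap.range_eq_top.1 (eq_top_of_len ?_), hg⟩
    have e1 : (LinearMap.range g).map q = ⊤ := by
      rw [← LinearMap.range_comp, show q.comp g = p from LinearMap.ext hg,
        LinearMap.range_eq_top.2 hp]
    have e2 := len_map_add q (LinearMap.range g)
    have e3 := len_range_add_ker q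
    rw [LinearMap.range_eq_top.2 hq, len_top] at e3
    rw [e1, len_top] at e2
    rcases hN (LinearMap.ker q) (LinearMap.range g) with h | h
    · rw [inf_eq_left.2 h] at e2
      omega
    · have h1 := len_mono h
      rw [inf_eq_right.2 h] at e2
      omega

/-- Local modules of length five whose radical has a simple direct summand. -/
theorem IsFourNakayama.local_len_five_of_sup_simple (hA : IsFourNakayama A)
    (hM : IsLocalModule A M) (hu : ¬ IsUniserial A M) (hl : len A M = 5) {N S₁ : Submodule A M}
    (hs : N ⊔ S₁ = jacobson A M) (hi : N ⊓ S₁ = ⊥) (hNl : len A N = 3) (hS₁ : len A S₁ = 1) :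
    IsUniserial A N ∧ ∃ S₂ N₁ : Submodule A M, S₂ ≤ N₁ ∧ N₁ ≤ N ∧ len A S₂ = 1 ∧ len A N₁ = 2 ∧
      socle A M = S₁ ⊔ S₂ ∧ S₁ ⊓ S₂ = ⊥ ∧
      (∀ Z : Submodule A M, len A Z = 1 → Z = S₂ ∨ Nonempty (Z ≃ₗ[A] S₁)) ∧
      (∀ X : Submodule A M, len A X = 2 → X = N₁ ∨ X = S₁ ⊔ S₂) ∧
      ∀ X : Submodule A M, len A X = 3 → X = N ∨ X = N₁ ⊔ S₁ := by
  have hN := hA.isUniserial_of_jacobson_eq_sup hM hs hi (ne_bot_of_len (by omega)) hS₁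
  obtain ⟨N₁, hN₁N, hN₁⟩ := exists_coatom_sub (X := N) (ne_bot_of_len (by omega))
  replace hN₁ : len A N₁ = 2 := by omega
  obtain ⟨S₂, hS₂N₁, hS₂⟩ := exists_atom_le (X := N₁) (ne_bot_of_len (by omega))
  have hS₂N := hS₂N₁.trans hN₁N
  have hJl := len_jacobson_of_isLocal hM
  have hdisj : ∀ X ≤ N, X ⊓ S₁ = ⊥ := fun X hX => by
    rw [eq_bot_iff, ← hi]; exact inf_le_inf_right S₁ hX
  have hd : S₁ ⊓ S₂ = ⊥ := inf_comm S₁ S₂ ▸ hdisj S₂ hS₂N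
  have hsl := len_sup_of_inf hd
  have hS₁N : ¬ S₁ ≤ N := fun h => ne_bot_of_len hS₁.ge (by rw [← hi, inf_eq_right.2 h])
  have hNJ : N ≤ jacobson A M := hs ▸ le_sup_left
  have hS₁J : S₁ ≤ jacobson A M := hs ▸ le_sup_right
  have hDl := len_sup_of_inf (hdisj N₁ hN₁N)
  have hND : N ≠ N₁ ⊔ S₁ := fun h => hS₁N (h ▸ le_sup_right)
  have hthree : ∀ X : Submodule A M, len A X = 3 → X = N ∨ X = N₁ ⊔ S₁ := fun X hX =>
    hA.jacobson_coatom_le hM hNJ (sup_le (hN₁N.trans hNJ) hS₁J)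
      (le_jacobson_of_isLocal hM (ne_top_of_len (by omega))) (by omega) (by omega) (by omega) hND
  have htwo : ∀ X : Submodule A M, len A X = 2 → X = N₁ ∨ X = S₁ ⊔ S₂ := by
    intro X hX
    by_cases hXN : X ≤ N
    · exact Or.inl (eq_of_isUniserial_of_len hN hXN hN₁N (by omega))
    right
    -- Modulo S₂ such an X is an additional simple submodule of a local module of length four with
    -- radical N/S₂ ⊕ S₁. This makes M/N isomorphic to N/S₂.
    by_contra hne
    have hXJ : X ≤ jacobson A M := le_jacobson_of_isLocal hM (ne_top_of_len (by omega))
    have e1 := len_sup_add_inf X N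
    have e2 := len_lt_of_lt (right_lt_sup.2 hXN : N < X ⊔ N)
    have e3 := len_mono (sup_le hXJ hNJ)
    have hS₂X : S₂ ≤ X := by
      have := eq_of_isUniserial_of_len hN (inf_le_right : X ⊓ N ≤ N) hS₂N (by omega)
      exact this ▸ inf_le_left
    have hQl := len_quot_add S₂
    have := nontrivial_of_len (by omega : 1 ≤ len A (M ⧸ S₂))
    have hQ := isLocal_of_surjective S₂.mkQ_surjective hM
    have hNm := len_mapQ_add hS₂N
    have hXm := len_mapQ_add hS₂X
    have hJm := len_mapQ_add (hS₂N.trans hNJ)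
    have hSm := len_map_add S₂.mkQ S₁
    rw [Submodule.ker_mkQ, inf_comm, hd, len_bot] at hSm
    have hJQ : N.map S₂.mkQ ⊔ S₁.map S₂.mkQ = jacobson A (M ⧸ S₂) := by
      rw [← Submodule.map_sup, hs]
      exact coatom_eq_jacobson hQ (by omega)
    have hJQ' := len_sup_add_inf (N.map S₂.mkQ) (S₁.map S₂.mkQ)
    rw [← Submodule.map_sup, hs] at hJQ'
    have hXS : X.map S₂.mkQ ≠ S₁.map S₂.mkQ := fun h => hne (by
      have := congrArg (Submodule.comap S₂.mkQ) h
      rwa [Submodule.comap_map_mkQ, Submodule.comap_map_mkQ, sup_eq_right.2 hS₂X,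
        sup_comm] at this)
    have hXN' : ¬ X.map S₂.mkQ ≤ N.map S₂.mkQ := fun h => hXN (by
      have := Submodule.comap_mono (f := S₂.mkQ) h
      rwa [Submodule.comap_map_mkQ, Submodule.comap_map_mkQ, sup_eq_right.2 hS₂X,
        sup_eq_right.2 hS₂N] at this)
    obtain ⟨e⟩ := hA.exists_equiv_of_atom hQ (by omega) (X := N.map S₂.mkQ) (S := S₁.map S₂.mkQ)
      (Z := X.map S₂.mkQ) hJQ (len_sub_eq_zero_iff.1 (by omega)) (by omega) (by omega) (by omega)
      hXS hXN'
    have hp : Function.Surjective (e.toLinearMap.comp ((N.map S₂.mkQ).mkQ.comp S₂.mkQ)) :=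
      e.surjective.comp ((N.map S₂.mkQ).mkQ_surjective.comp S₂.mkQ_surjective)
    -- The map M → M/N ≅ N/S₂ lifts to an epimorphism M → N, whose kernel lies in N and so equals
    -- N₁. Then M/N₁ ≅ N is uniserial, although N and N₁ + S₁ are distinct of the same length over
    -- N₁.
    obtain ⟨g, hgs, hg⟩ := hA.exists_surjective_of_len_five hM hu hl hN hNl
      (by omega : len A (N.map S₂.mkQ) = 2) hp (S₂.mkQ.submoduleMap_surjective N)
    have hk : LinearMap.ker g ≤ N := by
      intro m hm
      have h1 := hg m
      rw [LinearMap.mem_ker.1 hm, map_zero] at h1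
      have h2 := (Submodule.Quotient.mk_eq_zero (N.map S₂.mkQ)).1 (e.map_eq_zero_iff.1 h1.symm)
      obtain ⟨n, hn, hnm⟩ := h2
      have h3 := hS₂N ((Submodule.Quotient.eq S₂).1 hnm)
      have := N.sub_mem hn h3
      rwa [sub_sub_cancel] at this
    have hkl := len_range_add_ker g
    rw [LinearMap.range_eq_top.2 hgs, len_top] at hkl
    have hkN := eq_of_isUniserial_of_len hN hk hN₁N (by omega)
    refine not_isUniserial_quot (K := LinearMap.ker g) hk (hkN.le.trans le_sup_left) (by omega)
      hND ?_
    exact isUniserial_congr (g.quotKerEquivOfSurjective hgs) hN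
  have hatom : ∀ Z : Submodule A M, len A Z = 1 → Z ≤ S₁ ⊔ S₂ := fun Z hZ => by
    by_cases h : Z = S₁
    · exact h ▸ le_sup_left
    have h1 := len_sup_of_inf (inf_eq_bot_of_atoms hZ hS₁ h)
    rcases htwo (Z ⊔ S₁) (by omega) with h2 | h2
    · exact absurd ((h2 ▸ le_sup_right : S₁ ≤ N₁).trans hN₁N) hS₁N
    · exact h2 ▸ le_sup_left
  refine ⟨hN, S₂, N₁, hS₂N₁, hN₁N, hS₂, hN₁, le_antisymm (socle_le hatom)
    (sup_le (le_socle_of_len hS₁) (le_socle_of_len hS₂)), hd, fun Z hZ => ?_, htwo, hthree⟩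
  by_cases h : Z ≤ N
  · exact Or.inl (eq_of_isUniserial_of_len hN h hS₂N (by omega))
  · have h1 := (disjoint_or_le hZ).resolve_right h
    have h2 := len_sup_of_inf h1
    refine Or.inr (nonempty_equiv_of_sup_eq h1 (inf_comm N S₁ ▸ hi) ?_)
    rw [sup_comm S₁, hs]
    exact eq_of_le_of_len_le
      (sup_le (atom_le_jacobson_of_isLocal hM (by omega) hZ) hNJ) (by omega)

/-- In the radical of a local module, complementary uniserial submodules of length two are not
isomorphic. -/
theorem IsFourNakayama.false_of_equiv (hA : IsFourNakayama A) (hM : IsLocalModule A M)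
    (hl : len A M = 5) {N₁ N₂ S₁ S₂ : Submodule A M} (hs : N₁ ⊔ N₂ = jacobson A M)
    (hi : N₁ ⊓ N₂ = ⊥) (hN₁ : len A N₁ = 2) (hN₂ : len A N₂ = 2) (hS₁ : len A S₁ = 1)
    (hS₂ : len A S₂ = 1) (hS₁N : S₁ ≤ N₁) (hS₂N : S₂ ≤ N₂)
    (ε : N₁ ≃ₗ[A] N₂) : False := by
  have hJl := len_jacobson_of_isLocal hM
  have hN₁J : N₁ ≤ jacobson A M := hs ▸ le_sup_left
  have hN₂J : N₂ ≤ jacobson A M := hs ▸ le_sup_right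
  have hd : ∀ X ≤ N₁, ∀ Y ≤ N₂, X ⊓ Y = ⊥ := fun X hX Y hY => by
    rw [eq_bot_iff, ← hi]; exact inf_le_inf hX hY
  have e1 := len_sup_of_inf (hd N₁ le_rfl S₂ hS₂N)
  have e2 := len_sup_of_inf (hd S₁ hS₁N N₂ le_rfl)
  have hne : N₁ ⊔ S₂ ≠ S₁ ⊔ N₂ := fun h => by
    have h1 : N₁ ⊔ N₂ ≤ S₁ ⊔ N₂ := sup_le (h ▸ le_sup_left) le_sup_right
    have h2 := len_mono h1
    have h3 := len_sup_of_inf hi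
    omega
  -- The range of f is the graph of ε. Together with S₁ it would be a third maximal submodule of the
  -- radical, besides N₁ + S₂ and S₁ + N₂.
  let f : N₁ →ₗ[A] M := N₁.subtype + N₂.subtype.comp ε.toLinearMap
  have hf : ∀ x, f x = (x : M) + ε x := fun x => rfl
  have hfi : Function.Injective f := by
    refine (injective_iff_map_eq_zero f).2 fun x hx => ?_
    rw [hf] at hx
    have h1 : (x : M) ∈ N₁ ⊓ N₂ := ⟨x.2, by rw [eq_neg_of_add_eq_zero_left hx]; exact neg_mem (ε x).2⟩
    rw [hi] at h1
    exact Subtype.ext h1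
  have hfl := len_range_of_injective hfi
  have hfS : LinearMap.range f ⊓ S₁ = ⊥ := by
    rw [eq_bot_iff]
    rintro _ ⟨⟨x, rfl⟩, hx⟩
    rw [hf] at hx ⊢
    have h1 : (ε x : M) ∈ N₁ ⊓ N₂ :=
      ⟨by have := N₁.sub_mem (hS₁N hx) x.2; rwa [add_sub_cancel_left] at this, (ε x).2⟩
    rw [hi, Submodule.mem_bot] at h1
    have h2 : ε x = 0 := Subtype.ext h1
    rw [h1, ε.map_eq_zero_iff.1 h2, add_zero]
    exact zero_mem _
  have e3 := len_sup_of_inf hfS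
  have hfJ : LinearMap.range f ≤ jacobson A M := by
    rintro _ ⟨x, rfl⟩
    exact add_mem (hN₁J x.2) (hN₂J (ε x).2)
  rcases hA.jacobson_coatom_le hM (sup_le hN₁J (hS₂N.trans hN₂J)) (sup_le (hS₁N.trans hN₁J) hN₂J)
    (sup_le hfJ (hS₁N.trans hN₁J)) (by omega) (by omega) (by omega) hne with h | h
  · have h1 : N₂ ≤ S₂ := by
      intro y hy
      obtain ⟨x, hx⟩ := ε.surjective ⟨y, hy⟩
      have h2 : f x ∈ N₁ ⊔ S₂ := h ▸ Submodule.mem_sup_left (LinearMap.mem_range_self f x)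
      rw [hf, hx] at h2
      have h3 := sub_mem h2 (Submodule.mem_sup_left x.2 : (x : M) ∈ N₁ ⊔ S₂)
      rw [add_sub_cancel_left] at h3
      have h4 : (S₂ ⊔ N₁) ⊓ N₂ = S₂ := by
        rw [sup_inf_assoc_of_le _ hS₂N, hi, sup_bot_eq]
      rw [← h4, sup_comm]
      exact ⟨h3, hy⟩
    have := len_mono h1
    omega
  · have h1 : N₁ ≤ S₁ := by
      intro x hx
      have h2 : f ⟨x, hx⟩ ∈ S₁ ⊔ N₂ := h ▸ Submodule.mem_sup_left (LinearMap.mem_range_self f _)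
      rw [hf] at h2
      have h3 := sub_mem h2 (Submodule.mem_sup_right (ε ⟨x, hx⟩).2 : _ ∈ S₁ ⊔ N₂)
      rw [add_sub_cancel_right] at h3
      have h4 : (S₁ ⊔ N₂) ⊓ N₁ = S₁ := by
        rw [sup_inf_assoc_of_le _ hS₁N, inf_comm, hi, sup_bot_eq]
      rw [← h4]
      exact ⟨h3, hx⟩
    have := len_mono h1
    omega

/-- Local modules of length five whose radical is a direct sum of modules of length two. -/
theorem IsFourNakayama.local_len_five_of_sup (hA : IsFourNakayama A)
    (hM : IsLocalModule A M) (hl : len A M = 5) {N₁ N₂ : Submodule A M}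
    (hs : N₁ ⊔ N₂ = jacobson A M) (hi : N₁ ⊓ N₂ = ⊥) (hN₁ : len A N₁ = 2) (hN₂ : len A N₂ = 2) :
    IsUniserial A N₁ ∧ IsUniserial A N₂ ∧ ∃ S₁ S₂ : Submodule A M, S₁ ≤ N₁ ∧ S₂ ≤ N₂ ∧
      len A S₁ = 1 ∧ len A S₂ = 1 ∧ socle A M = S₁ ⊔ S₂ ∧ S₁ ⊓ S₂ = ⊥ ∧
      (∀ Z : Submodule A M, len A Z = 1 → Z = S₁ ∨ Z = S₂) ∧
      (∀ X : Submodule A M, len A X = 2 → X = S₁ ⊔ S₂ ∨ Nonempty (X ≃ₗ[A] N₁) ∨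
        Nonempty (X ≃ₗ[A] N₂)) ∧
      ∀ X : Submodule A M, len A X = 3 → X = N₁ ⊔ S₂ ∨ X = S₁ ⊔ N₂ := by
  have hs' : N₂ ⊔ N₁ = jacobson A M := sup_comm N₁ N₂ ▸ hs
  have hi' : N₂ ⊓ N₁ = ⊥ := inf_comm N₁ N₂ ▸ hi
  have hN₁b : N₁ ≠ ⊥ := ne_bot_of_len (by omega)
  have hN₂b : N₂ ≠ ⊥ := ne_bot_of_len (by omega)
  have hN₁u : IsUniserial A N₁ := isUniserial_of_isLocal_of_len_two
    (hA.isLocal_of_jacobson_eq_sup hM hs hi hN₁b hN₂b) hN₁.le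
  have hN₂u : IsUniserial A N₂ := isUniserial_of_isLocal_of_len_two
    (hA.isLocal_of_jacobson_eq_sup hM hs' hi' hN₂b hN₁b) hN₂.le
  obtain ⟨S₁, hS₁N, hS₁⟩ := exists_atom_le hN₁b
  obtain ⟨S₂, hS₂N, hS₂⟩ := exists_atom_le hN₂b
  have hJl := len_jacobson_of_isLocal hM
  have hN₁J : N₁ ≤ jacobson A M := hs ▸ le_sup_left
  have hN₂J : N₂ ≤ jacobson A M := hs ▸ le_sup_right
  have hdis : ∀ X ≤ N₁, ∀ Y ≤ N₂, X ⊓ Y = ⊥ := fun X hX Y hY => by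
    rw [eq_bot_iff, ← hi]; exact inf_le_inf hX hY
  have hd := hdis S₁ hS₁N S₂ hS₂N
  have hdl := len_sup_of_inf hd
  have e1 := len_sup_of_inf (hdis N₁ le_rfl S₂ hS₂N)
  have e2 := len_sup_of_inf (hdis S₁ hS₁N N₂ le_rfl)
  have e12 := len_sup_of_inf hi
  have hC₁ : ¬ N₂ ≤ N₁ ⊔ S₂ := fun h => by
    have := len_mono (sup_le le_sup_left h : N₁ ⊔ N₂ ≤ N₁ ⊔ S₂)
    omega
  have hC₂ : ¬ N₁ ≤ S₁ ⊔ N₂ := fun h => by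
    have := len_mono (sup_le h le_sup_right : N₁ ⊔ N₂ ≤ S₁ ⊔ N₂)
    omega
  have hS₁₂ : S₁ ≠ S₂ := fun h => by rw [h, inf_idem] at hd; exact ne_bot_of_len hS₂.ge hd
  have hthree : ∀ X : Submodule A M, len A X = 3 → X = N₁ ⊔ S₂ ∨ X = S₁ ⊔ N₂ := fun X hX =>
    hA.jacobson_coatom_le hM (sup_le hN₁J (hS₂N.trans hN₂J)) (sup_le (hS₁N.trans hN₁J) hN₂J)
      (le_jacobson_of_isLocal hM (ne_top_of_len (by omega))) (by omega) (by omega) (by omega)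
      fun h => hC₂ (h ▸ le_sup_left)
  have hone : ∀ Z : Submodule A M, len A Z = 1 → Z = S₁ ∨ Z = S₂ := by
    intro Z hZ
    by_contra! hne
    obtain ⟨hZ₁, hZ₂⟩ := hne
    have hZN₁ : Z ⊓ N₁ = ⊥ := (disjoint_or_le hZ).resolve_right fun h =>
      hZ₁ (eq_of_isUniserial_of_len hN₁u h hS₁N (by omega))
    have hZN₂ : Z ⊓ N₂ = ⊥ := (disjoint_or_le hZ).resolve_right fun h =>
      hZ₂ (eq_of_isUniserial_of_len hN₂u h hS₂N (by omega))
    have hZC₁ : Z ≤ N₁ ⊔ S₂ := by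
      have h := len_sup_of_inf hZN₁
      rcases hthree (Z ⊔ N₁) (by omega) with h | h
      · exact h ▸ le_sup_left
      · exact absurd (h ▸ le_sup_right) hC₂
    have hZC₂ : Z ≤ S₁ ⊔ N₂ := by
      have h := len_sup_of_inf hZN₂
      rcases hthree (Z ⊔ N₂) (by omega) with h | h
      · exact absurd (h ▸ le_sup_right) hC₁
      · exact h ▸ le_sup_left
    have hZS : Z ≤ S₁ ⊔ S₂ := by
      have h1 : (S₂ ⊔ N₁) ⊓ (S₁ ⊔ N₂) = S₂ ⊔ S₁ := by
        rw [sup_inf_assoc_of_le _ (hS₂N.trans le_sup_right), inf_comm,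
          sup_inf_assoc_of_le _ hS₁N, hi', sup_bot_eq]
      rw [sup_comm S₁, ← h1]
      exact le_inf (sup_comm N₁ S₂ ▸ hZC₁) hZC₂
    have h1 := eq_sup_of_atoms (by omega) hS₁ hZ le_sup_left hZS hZ₁.symm
    have h2 := eq_sup_of_atoms (by omega) hS₂ hZ le_sup_right hZS hZ₂.symm
    -- A third simple submodule Z of the socle makes S₂ isomorphic to S₁.
    obtain ⟨e⟩ := nonempty_equiv_of_sup_eq (inf_eq_bot_of_atoms hS₂ hZ hZ₂.symm)
      (inf_eq_bot_of_atoms hS₁ hZ hZ₁.symm) (h2.symm.trans h1)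
    have hQl := len_quot_add S₂
    have := nontrivial_of_len (by omega : 1 ≤ len A (M ⧸ S₂))
    have hQ := isLocal_of_surjective S₂.mkQ_surjective hM
    have hQJ := len_jacobson_of_isLocal hQ
    have hei : Function.Injective ((S₂.mkQ.comp S₁.subtype).comp e.toLinearMap) :=
      (injective_mkQ_comp_subtype hd).comp e.injective
    have hle : ∀ Y : Submodule A (M ⧸ S₂), len A Y = 2 →
        LinearMap.range ((S₂.mkQ.comp S₁.subtype).comp e.toLinearMap) ≤ Y := by
      intro Y hY
      have h3 := len_comap S₂.mkQ_surjective Y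
      rw [Submodule.ker_mkQ] at h3
      have h4 : S₁ ≤ Y.comap S₂.mkQ := by
        rcases hthree _ (by omega : len A (Y.comap S₂.mkQ) = 3) with h | h
        · rw [h]; exact hS₁N.trans le_sup_left
        · rw [h]; exact le_sup_left
      rintro _ ⟨s, rfl⟩
      exact h4 (e s).2
    -- The embedding S₂ ≅ S₁ → M/S₂ extends to N₂. Composed with M/S₂ → M/N₂ it stays injective, and
    -- its image is the radical of M/N₂, which is a copy of N₁. So N₁ ≅ N₂, which is excluded.
    obtain ⟨h, hh⟩ := hA.exists_extension hQ (by omega) hN₂ hS₂ _ hei (Submodule.inclusion hS₂N)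
      (Submodule.inclusion_injective hS₂N) (fun Y₁ Y₂ hs hd hY₁ hY₂ => by
        have e1 := len_sup_of_inf hd
        rw [hs] at e1
        have e2 := len_pos_of_ne_bot hY₁
        have e3 := len_pos_of_ne_bot hY₂
        rcases (by omega : len A Y₁ = 2 ∨ len A Y₂ = 2) with e | e
        · exact Or.inl ⟨hle Y₁ e, e.ge⟩
        · exact Or.inr ⟨hle Y₂ e, e.ge⟩)
    let t : (M ⧸ S₂) →ₗ[A] M ⧸ N₂ := Submodule.factor hS₂N
    have hti : Function.Injective (t.comp h) := by
      refine injective_of_comp_injective hN₂u hS₂ (Submodule.inclusion_injective hS₂N) ?_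
      have h3 : (t.comp h).comp (Submodule.inclusion hS₂N) =
          (N₂.mkQ.comp S₁.subtype).comp e.toLinearMap := LinearMap.ext fun s => congrArg t (hh s)
      rw [h3]
      exact (injective_mkQ_comp_subtype (hdis S₁ hS₁N N₂ le_rfl)).comp e.injective
    have hRl := len_quot_add N₂
    have := nontrivial_of_len (by omega : 1 ≤ len A (M ⧸ N₂))
    have hR := isLocal_of_surjective N₂.mkQ_surjective hM
    have hN₁i := injective_mkQ_comp_subtype hi
    have h5 := len_range_of_injective hN₁i
    have h6 := len_range_of_injective hti
    obtain ⟨ε⟩ := nonempty_equiv_of_range_eq hN₁i hti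
      ((coatom_eq_jacobson hR (by omega)).trans (coatom_eq_jacobson hR (by omega)).symm)
    exact hA.false_of_equiv hM hl hs hi hN₁ hN₂ hS₁ hS₂ hS₁N hS₂N ε
  refine ⟨hN₁u, hN₂u, S₁, S₂, hS₁N, hS₂N, hS₁, hS₂, le_antisymm (socle_le fun Z hZ => ?_)
    (sup_le (le_socle_of_len hS₁) (le_socle_of_len hS₂)), hd, hone, fun X hX => ?_, hthree⟩
  · rcases hone Z hZ with rfl | rfl
    · exact le_sup_left
    · exact le_sup_right
  · have hXJ : X ≤ jacobson A M := le_jacobson_of_isLocal hM (ne_top_of_len (by omega))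
    -- If X misses the socle S of Q, it misses Q, so X and P are both complements of Q in the
    -- radical.
    have key : ∀ P Q S : Submodule A M, P ⊔ Q = jacobson A M → P ⊓ Q = ⊥ → len A Q = 2 →
        (∀ Z ≤ Q, len A Z = 1 → Z = S) → ¬ S ≤ X → Nonempty (X ≃ₗ[A] P) := by
      intro P Q S hs hi hQ hQS hSX
      have h1 : X ⊓ Q = ⊥ := by
        by_contra h
        obtain ⟨Z, hZ, hZl⟩ := exists_atom_le h
        exact hSX (hQS Z (hZ.trans inf_le_right) hZl ▸ hZ.trans inf_le_left)
      have h2 := len_sup_of_inf h1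
      refine nonempty_equiv_of_sup_eq h1 hi ?_
      rw [hs]
      exact eq_of_le_of_len_le (sup_le hXJ (hs ▸ le_sup_right)) (by omega)
    by_cases h1 : S₁ ≤ X
    · by_cases h2 : S₂ ≤ X
      · exact Or.inl (eq_sup_of_atoms hX hS₁ hS₂ h1 h2 hS₁₂)
      · exact Or.inr (Or.inl (key N₁ N₂ S₂ hs hi hN₂ (fun Z hZ hZl =>
          eq_of_isUniserial_of_len hN₂u hZ hS₂N (by omega)) h2))
    · exact Or.inr (Or.inr (key N₂ N₁ S₁ hs' hi' hN₁ (fun Z hZ hZl =>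
          eq_of_isUniserial_of_len hN₁u hZ hS₁N (by omega)) h1))

/-- The radical of a local module of length five is colocal if it is indecomposable. -/
theorem IsFourNakayama.atom_unique_of_isIndecomposable_jacobson (hA : IsFourNakayama A)
    (hM : IsLocalModule A M) (hu : ¬ IsUniserial A M) (hl : len A M = 5)
    (hind : IsIndecomposableModule A (jacobson A M)) {S T : Submodule A M} (hS : len A S = 1)
    (hT : len A T = 1) : S = T := by
  by_contra hST
  have hJl := len_jacobson_of_isLocal hM
  have hJn := hA.not_isLocal_jacobson hM hu
  have hatom : ∀ Z : Submodule A M, len A Z = 1 → Z ≤ jacobson A M := fun Z hZ =>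
    atom_le_jacobson_of_isLocal hM (by omega) hZ
  have hmap : ∀ Z : Submodule A M, len A Z = 1 →
      (Z.comap (jacobson A M).subtype).map (jacobson A M).subtype = Z :=
    fun Z hZ => by rw [Submodule.map_comap_subtype, inf_eq_right.2 (hatom Z hZ)]
  obtain ⟨N₁, N₂, S₁, S₂, hN₁l, hN₁, -, -, -, -, hS₁, hS₂, hS₁₂, hd, -, -, hS₁N, hS₂N, -, htwo, -⟩ :=
    hA.noncolocal_len_four hind hJn (by omega)
      (S := S.comap (jacobson A M).subtype) (T := T.comap (jacobson A M).subtype)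
      (by rwa [len_comap_subtype (hatom S hS)]) (by rwa [len_comap_subtype (hatom T hT)])
      (fun h => hST (by rw [← hmap S hS, h, hmap T hT]))
  -- The quotient N₁/S₂ is uniserial of length two with socle S₁, so the inclusion of S₁ into M
  -- extends to it; the decomposition condition is vacuous because the radical is indecomposable.
  -- The image contains S₁ and is uniserial of length two, but the socle of the radical is its only
  -- submodule of length two containing S₁.
  let K := S₂.comap N₁.subtype
  have hQl := len_quot_add K
  have hKl : len A K = 1 := (len_comap_subtype hS₂N).trans hS₂
  have hj : Function.Injective (K.mkQ.comp (Submodule.inclusion hS₁N)) := by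
    refine (injective_iff_map_eq_zero _).2 fun s hs => ?_
    have h1 : (s : jacobson A M) ∈ S₁ ⊓ S₂ := ⟨s.2, (Submodule.Quotient.mk_eq_zero K).1 hs⟩
    rw [hd] at h1
    exact Subtype.ext h1
  have hi : Function.Injective ((jacobson A M).subtype.comp S₁.subtype) :=
    (jacobson A M).injective_subtype.comp S₁.injective_subtype
  obtain ⟨h, hh⟩ := hA.exists_extension hM (by omega) (by omega : len A (N₁ ⧸ K) = 2) hS₁ _ hi _ hj
    (fun Y₁ Y₂ hs hd hY₁ hY₂ =>
      (((isIndecomposable_sub_iff.1 hind).2 Y₁ Y₂ hs hd).elim hY₁ hY₂).elim)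
  have := nontrivial_of_len (by omega : 1 ≤ len A (N₁ ⧸ K))
  have hQu : IsUniserial A (N₁ ⧸ K) := isUniserial_of_isLocal_of_len_two
    (isLocal_of_surjective K.mkQ_surjective hN₁) (by omega)
  have hhi : Function.Injective h := injective_of_comp_injective hQu hS₁ hj (by
    rwa [show h.comp (K.mkQ.comp (Submodule.inclusion hS₁N)) =
      (jacobson A M).subtype.comp S₁.subtype from LinearMap.ext hh])
  have hrl := len_range_of_injective hhi
  have hrJ : LinearMap.range h ≤ jacobson A M :=
    le_jacobson_of_isLocal hM (ne_top_of_len (by omega))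
  have hSr : S₁ ≤ (LinearMap.range h).comap (jacobson A M).subtype := fun s hs => ⟨_, hh ⟨s, hs⟩⟩
  rcases htwo ((LinearMap.range h).comap (jacobson A M).subtype)
    (by rw [len_comap_subtype hrJ]; omega) with h1 | ⟨-, h1, -⟩
  · refine not_isUniserial_of_atoms hS₁ hS₂ hS₁₂ le_sup_left le_sup_right (X := S₁ ⊔ S₂) ?_
    rw [← h1]
    refine isUniserial_congr (Submodule.submoduleOfEquivOfLe hrJ) (isUniserial_range hhi hQu)
  · exact h1 hSr

end LocalModulesOfLengthFive

/-! ### Assembling the lists of submodules. -/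

section Classification

variable {A : Type u} [Ring A] [IsArtinianRing A]
variable {M : Type u} [AddCommGroup M] [Module A M] [Module.Finite A M]

theorem isIndecomposable_sub_of_atom {S : Submodule A M} (hS : len A S = 1)
    (hatom : ∀ Z : Submodule A M, len A Z = 1 → Z = S) {X : Submodule A M} (hX : X ≠ ⊥) :
    IsIndecomposableModule A X := by
  refine isIndecomposable_sub_iff.2 ⟨hX, fun Y Z _ hi => ?_⟩
  by_contra! h0
  obtain ⟨Y', hY', hY'l⟩ := exists_atom_le h0.1
  obtain ⟨Z', hZ', hZ'l⟩ := exists_atom_le h0.2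
  have h1 : S ≤ Y ⊓ Z := le_inf (hatom Y' hY'l ▸ hY') (hatom Z' hZ'l ▸ hZ')
  rw [hi, le_bot_iff] at h1
  exact ne_bot_of_len hS.ge h1

theorem isIndecomposable_of_isUniserial_sub {X : Submodule A M} (h : IsUniserial A X)
    (hX : 1 ≤ len A X) : IsIndecomposableModule A X := by
  have := nontrivial_of_len hX
  exact isIndecomposable_of_isLocal (isLocal_of_isUniserial h)

theorem IsFourNakayama.nonlocal_len_three_cases (hA : IsFourNakayama A)
    (hM : IsIndecomposableModule A M) (hn : ¬ IsLocalModule A M) (hl : len A M = 3) :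
    (¬ IsLocalModule A M ∧ Module.length A M = 3 ∧ IsSimpleModule A (socle A M) ∧
        ∃ N₁ N₂ : Submodule A M,
          Module.length A N₁ = 2 ∧ IsUniserial A N₁ ∧
          Module.length A N₂ = 2 ∧ IsUniserial A N₂ ∧ N₁ ≠ N₂ ∧
          ∀ X : Submodule A M, X ∈ ({⊥, socle A M, N₁, N₂, ⊤} : Set (Submodule A M))) := by
  obtain ⟨hJ, hatom, C₁, C₂, h₁, h₂, h₁₂, hC⟩ := hA.nonlocal_len_three hM hl hn
  have hsoc := socle_eq_of_forall hJ hatom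
  refine ⟨hn, length_eq_iff.2 hl, ?_, C₁, C₂, length_eq_iff.2 h₁,
    isUniserial_of_len_two h₁ fun Z _ hZ => hatom Z hZ, length_eq_iff.2 h₂,
    isUniserial_of_len_two h₂ fun Z _ hZ => hatom Z hZ, h₁₂, fun X => ?_⟩
  · rw [hsoc]
    exact len_eq_one_iff.1 hJ
  simp only [Set.mem_insert_iff, Set.mem_singleton_iff]
  have hX := len_le X
  rcases (by omega : len A X = 0 ∨ len A X = 1 ∨ len A X = 2 ∨ len A X = 3) with h | h | h | h
  · exact Or.inl (len_sub_eq_zero_iff.1 h)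
  · exact Or.inr (Or.inl ((hatom X h).trans hsoc.symm))
  · rcases hC X h with h | h <;> tauto
  · have := eq_top_of_len (X := X) (by omega)
    tauto

theorem IsFourNakayama.nonlocal_len_four_cases (hA : IsFourNakayama A)
    (hM : IsIndecomposableModule A M) (hn : ¬ IsLocalModule A M) (hl : len A M = 4) :
    (¬ IsLocalModule A M ∧ Module.length A M = 4 ∧ IsSimpleModule A (socle A M) ∧
        ∃ M₁ M₂ N₁ N₂ : Submodule A M,
          Module.length A M₁ = 3 ∧ IsUniserial A M₁ ∧
          Module.length A M₂ = 3 ∧ ¬ IsLocalModule A M₂ ∧ IsFactorSerial 3 A M₂ ∧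
          Module.length A N₁ = 2 ∧ IsIndecomposableModule A N₁ ∧ IsUniserial A N₁ ∧
          Module.length A N₂ = 2 ∧ IsIndecomposableModule A N₂ ∧ IsUniserial A N₂ ∧
          N₁ ≠ N₂ ∧ N₁ ≤ M₁ ∧ N₁ ≤ M₂ ∧ N₂ ≤ M₂ ∧
          ∀ X : Submodule A M,
            X ∈ ({⊥, socle A M, N₁, N₂, M₁, M₂, ⊤} : Set (Submodule A M)) ∨
            Nonempty (X ≃ₗ[A] M₁)) ∨
    (¬ IsLocalModule A M ∧ Module.length A M = 4 ∧ ¬ IsSimpleModule A (socle A M) ∧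
        ∃ N₁ N₂ S₁ S₂ : Submodule A M,
          Module.length A N₁ = 3 ∧ IsIndecomposableModule A N₁ ∧
          IsFactorSerial 2 A N₁ ∧
          Module.length A N₂ = 2 ∧ IsIndecomposableModule A N₂ ∧ IsUniserial A N₂ ∧
          IsSimpleModule A S₁ ∧ IsSimpleModule A S₂ ∧
          socle A M = S₁ ⊔ S₂ ∧ Disjoint S₁ S₂ ∧ socleOf A N₂ = S₂ ∧
          ∀ X : Submodule A M,
            X ∈ ({⊥, S₁, S₂, socle A M, N₂, N₂ ⊔ S₁, N₁, ⊤} : Set (Submodule A M)) ∨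
            Nonempty (X ≃ₗ[A] N₂)) := by
  have := hM.1
  obtain ⟨S, -, hS⟩ := exists_atom_le (X := (⊤ : Submodule A M)) top_ne_bot
  by_cases hatom : ∀ Z : Submodule A M, len A Z = 1 → Z = S
  · left
    obtain ⟨M₁, M₂, N₁, N₂, hM₁, hM₁u, hM₂, hM₂n, hN₁, hN₂, hN₁₂, h₁₁, h₁₂, h₂₂, -, htwo, hthree⟩ :=
      hA.colocal_len_four hn hl hS hatom
    have huni : ∀ C : Submodule A M, len A C = 2 → IsUniserial A C := fun C hC =>
      isUniserial_of_len_two hC fun Z _ hZ => hatom Z hZ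
    have := nontrivial_of_len (by omega : 1 ≤ len A M₂)
    have hsoc := socle_eq_of_forall hS hatom
    refine ⟨hn, length_eq_iff.2 hl, ?_, M₁, M₂, N₁, N₂, length_eq_iff.2 hM₁, hM₁u,
      length_eq_iff.2 hM₂, hM₂n, isFactorSerial_of_not_isLocal (by omega) hM₂n hM₂,
      length_eq_iff.2 hN₁, isIndecomposable_of_isUniserial_sub (huni N₁ hN₁) (by omega),
      huni N₁ hN₁, length_eq_iff.2 hN₂, isIndecomposable_of_isUniserial_sub (huni N₂ hN₂) (by omega),
      huni N₂ hN₂, hN₁₂, h₁₁, h₁₂, h₂₂, fun X => ?_⟩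
    · rw [hsoc]
      exact len_eq_one_iff.1 hS
    simp only [Set.mem_insert_iff, Set.mem_singleton_iff]
    have hX := len_le X
    rcases (by omega : len A X = 0 ∨ len A X = 1 ∨ len A X = 2 ∨ len A X = 3 ∨ len A X = 4)
      with h | h | h | h | h
    · exact Or.inl (Or.inl (len_sub_eq_zero_iff.1 h))
    · exact Or.inl (Or.inr (Or.inl ((hatom X h).trans hsoc.symm)))
    · rcases htwo X h with h | h <;> tauto
    · rcases hthree X h with h | h | h <;> tauto
    · have := eq_top_of_len (X := X) (by omega)
      tauto
  · right
    push Not at hatom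
    obtain ⟨T, hT, hTS⟩ := hatom
    obtain ⟨N₁, N₂, S₁, S₂, hN₁, hN₁loc, hN₁u, -, hN₂, hN₂u, hS₁, hS₂, -, hd, hsoc, hS₂N, -, -, hone,
      htwo, hthree⟩ := hA.noncolocal_len_four hM hn hl hT hS hTS
    have := nontrivial_of_len (by omega : 1 ≤ len A N₁)
    refine ⟨hn, length_eq_iff.2 hl, ?_, N₁, N₂, S₁, S₂, length_eq_iff.2 hN₁,
      isIndecomposable_of_isLocal hN₁loc,
      isFactorSerial_of_isLocal le_rfl hN₁loc (hA.not_isLocal_jacobson hN₁loc hN₁u) hN₁,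
      length_eq_iff.2 hN₂, isIndecomposable_of_isUniserial_sub hN₂u (by omega), hN₂u,
      len_eq_one_iff.1 hS₁, len_eq_one_iff.1 hS₂, hsoc, disjoint_iff.2 hd,
      socleOf_eq_of_isUniserial hS₂ hS₂N hN₂u, fun X => ?_⟩
    · rw [hsoc]
      exact not_isSimple_of_len_two (by have := len_sup_of_inf hd; omega)
    simp only [Set.mem_insert_iff, Set.mem_singleton_iff]
    have hX := len_le X
    rcases (by omega : len A X = 0 ∨ len A X = 1 ∨ len A X = 2 ∨ len A X = 3 ∨ len A X = 4)
      with h | h | h | h | h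
    · exact Or.inl (Or.inl (len_sub_eq_zero_iff.1 h))
    · rcases hone X h with h | h <;> tauto
    · rcases htwo X h with h | ⟨-, -, h⟩
      · rw [← hsoc] at h; tauto
      · exact Or.inr h
    · rcases hthree X h with h | h <;> tauto
    · have := eq_top_of_len (X := X) (by omega)
      tauto

theorem IsFourNakayama.local_len_five_cases (hA : IsFourNakayama A)
    (hM : IsLocalModule A M) (hu : ¬ IsUniserial A M) (hl : len A M = 5) :
    (IsLocalModule A M ∧ IsColocalModule A M ∧
        IsIndecomposableModule A (jacobson A M) ∧
        ¬ IsLocalModule A (jacobson A M) ∧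
        IsFactorSerial 4 A (jacobson A M) ∧
        ∃ M₁ M₂ N₁ N₂ : Submodule A M,
          Module.length A M₁ = 3 ∧ IsIndecomposableModule A M₁ ∧ IsUniserial A M₁ ∧
          Module.length A M₂ = 3 ∧ IsIndecomposableModule A M₂ ∧
          ¬ IsLocalModule A M₂ ∧ IsFactorSerial 3 A M₂ ∧
          Module.length A N₁ = 2 ∧ IsIndecomposableModule A N₁ ∧ IsUniserial A N₁ ∧
          Module.length A N₂ = 2 ∧ IsIndecomposableModule A N₂ ∧ IsUniserial A N₂ ∧
          N₁ ≠ N₂ ∧ N₁ ≤ M₁ ∧ N₁ ≤ M₂ ∧ N₂ ≤ M₂ ∧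
          ∀ X : Submodule A M,
            X ∈ ({⊥, socle A M, N₁, N₂, M₁, M₂, jacobson A M, ⊤} :
              Set (Submodule A M))) ∨
    (IsLocalModule A M ∧ ¬ IsColocalModule A M ∧
        ∃ N N₁ S₁ S₂ : Submodule A M,
          jacobson A M = N ⊔ S₁ ∧ Disjoint N S₁ ∧
          Module.length A N = 3 ∧ IsUniserial A N ∧
          IsSimpleModule A S₁ ∧ IsSimpleModule A S₂ ∧
          Module.length A N₁ = 2 ∧ IsUniserial A N₁ ∧ N₁ ≤ N ∧
          socle A M = S₁ ⊔ S₂ ∧ Disjoint S₁ S₂ ∧ socleOf A N = S₂ ∧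
          ∀ X : Submodule A M,
            X ∈ ({⊥, S₁, S₂, socle A M, N₁, N₁ ⊔ S₁, N, jacobson A M, ⊤} :
              Set (Submodule A M)) ∨ Nonempty (X ≃ₗ[A] S₁)) ∨
    (IsLocalModule A M ∧ ¬ IsColocalModule A M ∧
        ∃ N₁ N₂ S₁ S₂ : Submodule A M,
          jacobson A M = N₁ ⊔ N₂ ∧ Disjoint N₁ N₂ ∧
          Module.length A N₁ = 2 ∧ IsUniserial A N₁ ∧
          Module.length A N₂ = 2 ∧ IsUniserial A N₂ ∧
          IsSimpleModule A S₁ ∧ IsSimpleModule A S₂ ∧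
          socle A M = S₁ ⊔ S₂ ∧ Disjoint S₁ S₂ ∧
          socleOf A N₁ = S₁ ∧ socleOf A N₂ = S₂ ∧
          ∀ X : Submodule A M,
            X ∈ ({⊥, S₁, S₂, socle A M, N₁, N₂, N₁ ⊔ S₂, S₁ ⊔ N₂,
              jacobson A M, ⊤} : Set (Submodule A M)) ∨
            Nonempty (X ≃ₗ[A] N₁) ∨ Nonempty (X ≃ₗ[A] N₂)) := by
  have hJl := len_jacobson_of_isLocal hM
  have hJn := hA.not_isLocal_jacobson hM hu
  have hle : ∀ X : Submodule A M, len A X < 5 → X ≤ jacobson A M := fun X hX =>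
    le_jacobson_of_isLocal hM (ne_top_of_len (by omega))
  have hcases : ∀ X : Submodule A M, len A X = 0 ∨ len A X = 1 ∨ len A X = 2 ∨ len A X = 3 ∨
      len A X = 4 ∨ len A X = 5 := fun X => by
    have := len_le X
    omega
  by_cases hind : IsIndecomposableModule A (jacobson A M)
  · left
    obtain ⟨S, -, hS⟩ := exists_atom_le (X := jacobson A M) (ne_bot_of_len (by omega))
    have hatom : ∀ Z : Submodule A M, len A Z = 1 → Z = S := fun Z hZ =>
      hA.atom_unique_of_isIndecomposable_jacobson hM hu hl hind hZ hS
    have hsoc := socle_eq_of_forall hS hatom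
    have hmapl : ∀ X : Submodule A (jacobson A M), len A (X.map (jacobson A M).subtype) = len A X :=
      len_map_of_injective (jacobson A M).injective_subtype
    have hmapi := Submodule.map_injective_of_injective (jacobson A M).injective_subtype
    have hmap : ∀ X : Submodule A M, X ≤ jacobson A M →
        (X.comap (jacobson A M).subtype).map (jacobson A M).subtype = X := fun X hX => by
      rw [Submodule.map_comap_subtype, inf_eq_right.2 hX]
    -- The radical is a colocal non-local module of length four. Of its submodules of length three
    -- only M₁ and M₂ occur, since the radical of a local module has at most two maximal submodules;
    -- no alternative up to isomorphism is needed.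
    obtain ⟨M₁, M₂, N₁, N₂, hM₁, hM₁u, hM₂, hM₂n, hN₁, hN₂, hN₁₂, h₁₁, h₁₂, h₂₂, hM₁₂, htwo, -⟩ :=
      hA.colocal_len_four hJn (by omega) (S := S.comap (jacobson A M).subtype)
        (by rwa [len_comap_subtype (hle S (by omega))])
        (fun Z hZ => hmapi ((hatom _ ((hmapl Z).trans hZ)).trans (hmap S (hle S (by omega))).symm))
    have huni : ∀ C : Submodule A M, len A C = 2 → IsUniserial A C := fun C hC =>
      isUniserial_of_len_two hC fun Z _ hZ => hatom Z hZ
    have hindS : ∀ C : Submodule A M, 2 ≤ len A C → IsIndecomposableModule A C := fun C hC =>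
      isIndecomposable_sub_of_atom hS hatom (ne_bot_of_len (by omega))
    rw [← hmapl] at hM₁ hM₂ hN₁ hN₂
    have hM₂n' : ¬ IsLocalModule A (M₂.map (jacobson A M).subtype) :=
      not_isLocal_sub (Submodule.map_mono h₁₂) (Submodule.map_mono h₂₂) (by omega) (by omega)
        fun h => hN₁₂ (hmapi h)
    have := hind.1
    have := nontrivial_of_len (by omega : 1 ≤ len A (M₂.map (jacobson A M).subtype))
    refine ⟨hM, ?_, hind, hJn, isFactorSerial_of_not_isLocal (by omega) hJn (by omega),
      M₁.map (jacobson A M).subtype, M₂.map (jacobson A M).subtype,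
      N₁.map (jacobson A M).subtype, N₂.map (jacobson A M).subtype, length_eq_iff.2 hM₁,
      hindS _ (by omega), isUniserial_congr (Submodule.equivMapOfInjective _
        (jacobson A M).injective_subtype M₁).symm hM₁u, length_eq_iff.2 hM₂, hindS _ (by omega),
      hM₂n', isFactorSerial_of_not_isLocal (by omega) hM₂n' hM₂, length_eq_iff.2 hN₁,
      hindS _ (by omega), huni _ hN₁, length_eq_iff.2 hN₂, hindS _ (by omega), huni _ hN₂,
      fun h => hN₁₂ (hmapi h), Submodule.map_mono h₁₁, Submodule.map_mono h₁₂,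
      Submodule.map_mono h₂₂, fun X => ?_⟩
    · rw [IsColocalModule, hsoc]
      exact len_eq_one_iff.1 hS
    simp only [Set.mem_insert_iff, Set.mem_singleton_iff]
    rcases hcases X with h | h | h | h | h | h
    · exact Or.inl (len_sub_eq_zero_iff.1 h)
    · exact Or.inr (Or.inl ((hatom X h).trans hsoc.symm))
    · have hXJ := hle X (by omega)
      rcases htwo (X.comap (jacobson A M).subtype) (by rwa [len_comap_subtype hXJ]) with h' | h'
      · have := (hmap X hXJ).symm.trans (congrArg (Submodule.map (jacobson A M).subtype) h')
        tauto
      · have := (hmap X hXJ).symm.trans (congrArg (Submodule.map (jacobson A M).subtype) h')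
        tauto
    · rcases hA.jacobson_coatom_le hM (hle _ (by omega)) (hle _ (by omega)) (hle X (by omega))
        (by omega) (by omega) (by omega) fun h => hM₁₂ (hmapi h) with h | h <;> tauto
    · have := coatom_eq_jacobson hM (C := X) (by omega)
      tauto
    · have := eq_top_of_len (X := X) (by omega)
      tauto
  right
  obtain ⟨Y, Z, hs, hi, hY, hZ⟩ :=
    exists_of_not_isIndecomposable_sub (ne_bot_of_len (by omega)) hind
  have e1 := len_sup_of_inf hi
  rw [hs] at e1
  have e2 := len_pos_of_ne_bot hY
  have e3 := len_pos_of_ne_bot hZ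
  have hcol : ∀ S₁ S₂ : Submodule A M, len A S₁ = 1 → len A S₂ = 1 → socle A M = S₁ ⊔ S₂ →
      S₁ ⊓ S₂ = ⊥ → ¬ IsColocalModule A M := fun S₁ S₂ h₁ h₂ hsoc hd => by
    rw [IsColocalModule, hsoc]
    exact not_isSimple_of_len_two (by have := len_sup_of_inf hd; omega)
  by_cases h22 : len A Y = 2
  · right
    obtain ⟨hYu, hZu, S₁, S₂, hS₁Y, hS₂Z, hS₁, hS₂, hsoc, hd, hone, htwo, hthree⟩ :=
      hA.local_len_five_of_sup hM hl hs hi h22 (by omega)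
    refine ⟨hM, hcol S₁ S₂ hS₁ hS₂ hsoc hd, Y, Z, S₁, S₂, hs.symm, disjoint_iff.2 hi,
      length_eq_iff.2 h22, hYu, (length_eq_iff (n := 2)).2 (by omega), hZu, len_eq_one_iff.1 hS₁,
      len_eq_one_iff.1 hS₂, hsoc, disjoint_iff.2 hd, socleOf_eq_of_isUniserial hS₁ hS₁Y hYu,
      socleOf_eq_of_isUniserial hS₂ hS₂Z hZu, fun X => ?_⟩
    simp only [Set.mem_insert_iff, Set.mem_singleton_iff]
    rcases hcases X with h | h | h | h | h | h
    · exact Or.inl (Or.inl (len_sub_eq_zero_iff.1 h))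
    · rcases hone X h with h | h <;> tauto
    · rcases htwo X h with h | h
      · rw [← hsoc] at h; tauto
      · exact Or.inr h
    · rcases hthree X h with h | h <;> tauto
    · have := coatom_eq_jacobson hM (C := X) (by omega)
      tauto
    · have := eq_top_of_len (X := X) (by omega)
      tauto
  · left
    obtain ⟨N, S₁, hs, hi, hNl, hS₁⟩ : ∃ N S₁ : Submodule A M, N ⊔ S₁ = jacobson A M ∧
        N ⊓ S₁ = ⊥ ∧ len A N = 3 ∧ len A S₁ = 1 := by
      rcases (by omega : (len A Y = 3 ∧ len A Z = 1) ∨ (len A Z = 3 ∧ len A Y = 1)) with e | e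
      · exact ⟨Y, Z, hs, hi, e.1, e.2⟩
      · exact ⟨Z, Y, sup_comm Y Z ▸ hs, inf_comm Y Z ▸ hi, e.1, e.2⟩
    obtain ⟨hN, S₂, N₁, hS₂N₁, hN₁N, hS₂, hN₁, hsoc, hd, hone, htwo, hthree⟩ :=
      hA.local_len_five_of_sup_simple hM hu hl hs hi hNl hS₁
    refine ⟨hM, hcol S₁ S₂ hS₁ hS₂ hsoc hd, N, N₁, S₁, S₂, hs.symm, disjoint_iff.2 hi,
      length_eq_iff.2 hNl, hN, len_eq_one_iff.1 hS₁, len_eq_one_iff.1 hS₂, length_eq_iff.2 hN₁,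
      isUniserial_of_le hN₁N hN, hN₁N, hsoc, disjoint_iff.2 hd,
      socleOf_eq_of_isUniserial hS₂ (hS₂N₁.trans hN₁N) hN, fun X => ?_⟩
    simp only [Set.mem_insert_iff, Set.mem_singleton_iff]
    rcases hcases X with h | h | h | h | h | h
    · exact Or.inl (Or.inl (len_sub_eq_zero_iff.1 h))
    · rcases hone X h with h | h <;> tauto
    · rcases htwo X h with h | h
      · tauto
      · rw [← hsoc] at h; tauto
    · rcases hthree X h with h | h <;> tauto
    · have := coatom_eq_jacobson hM (C := X) (by omega)
      tauto
    · have := eq_top_of_len (X := X) (by omega)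
      tauto

end Classification

/-! ### Artin algebras with algebraically closed residue fields: the scalar property. -/

section ArtinAlgebras

/-- A domain that is integral over a ring `R` acting through an algebraically closed quotient
field of `R` is a quotient of `R`. -/
theorem algebraMap_surjective_of_isAlgClosed {R K D : Type*} [CommRing R] [Field K] [IsAlgClosed K]
    [Ring D] [IsDomain D] [Algebra R D] [Algebra.IsIntegral R D] (π : R →+* K)
    (hπ : Function.Surjective π) (h : ∀ r, π r = 0 → algebraMap R D r = 0) :
    Function.Surjective (algebraMap R D) := by
  let φ : K →+* D := π.liftOfSurjective hπ ⟨algebraMap R D, fun r hr => h r hr⟩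
  have hφ : ∀ r, φ (π r) = algebraMap R D r := fun r =>
    RingHom.liftOfRightInverse_comp_apply π _ _ ⟨algebraMap R D, fun r hr => h r hr⟩ r
  let : Algebra R K := π.toAlgebra
  let : Algebra K D := φ.toAlgebra' fun c x => by
    obtain ⟨r, rfl⟩ := hπ c
    rw [hφ]
    exact Algebra.commutes r x
  have : IsScalarTower R K D := IsScalarTower.of_algebraMap_eq fun r => (hφ r).symm
  have : Algebra.IsIntegral K D := ⟨fun x => (Algebra.IsIntegral.isIntegral (R := R) x).tower_top⟩
  intro d
  obtain ⟨c, rfl⟩ := (IsAlgClosed.algebraMap_bijective_of_isIntegral (k := K) (K := D)).2 d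
  obtain ⟨r, rfl⟩ := hπ c
  exact ⟨r, (hφ r).symm⟩

/-- By Schur's lemma the endomorphism ring is a domain, and it is integral over R because T is
finite over R. The annihilator of T in R is prime, hence maximal, and the residue field is
algebraically closed, so every endomorphism comes from R, which is central in A. -/
theorem exists_central_smul {R : Type v} [CommRing R] [IsArtinianRing R]
    (hR : ∀ (m : Ideal R) [m.IsMaximal], @IsAlgClosed (R ⧸ m) (Ideal.Quotient.field m))
    {A : Type u} [Ring A] [Algebra R A] [Module.Finite R A] (T : Type u) [AddCommGroup T]
    [Module A T] [IsSimpleModule A T] (f : T →ₗ[A] T) :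
    ∃ a : Subsemiring.center A, ∀ t, f t = a • t := by
  classical
  let : Module R T := Module.compHom T (algebraMap R A)
  have hsmul : ∀ (r : R) (t : T), r • t = algebraMap R A r • t := fun _ _ => rfl
  have : IsScalarTower R A T := ⟨fun r a t => by
    rw [hsmul, smul_smul, Algebra.smul_def]⟩
  have : SMulCommClass A R T := ⟨fun a r t => by
    rw [hsmul, hsmul, smul_smul, smul_smul, Algebra.commutes]⟩
  have : Module.Finite R T := Module.Finite.trans A T
  have : Nontrivial T := IsSimpleModule.nontrivial A T
  let p : Ideal R := RingHom.ker (algebraMap R (Module.End A T))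
  have hp : p.IsPrime := RingHom.ker_isPrime _
  have hpm : p.IsMaximal := IsArtinianRing.isMaximal_of_isPrime p
  have hint : Algebra.IsIntegral R (Module.End A T) := by
    refine ⟨fun x => ?_⟩
    let ι : Module.End A T →ₐ[R] Module.End R T :=
      AlgHom.ofLinearMap (LinearMap.restrictScalarsₗ R A T T R) rfl fun _ _ => rfl
    have hι : Function.Injective ι := fun x y h => LinearMap.ext fun t => LinearMap.congr_fun h t
    exact (isIntegral_algHom_iff ι hι).1 (Algebra.IsIntegral.isIntegral _)
  let := Ideal.Quotient.field p
  have := hR p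
  obtain ⟨r, hr⟩ := algebraMap_surjective_of_isAlgClosed (K := R ⧸ p) (Ideal.Quotient.mk p)
    Ideal.Quotient.mk_surjective (fun r hr => Ideal.Quotient.eq_zero_iff_mem.1 hr) f
  refine ⟨⟨algebraMap R A r, Subsemiring.mem_center_iff.2 fun a => (Algebra.commutes r a).symm⟩,
    fun t => ?_⟩
  rw [← hr]
  rfl

end ArtinAlgebras

end NakayamaFour

theorem theorem3p3 (R : Type v) [CommRing R] [IsArtinianRing R]
    (hR : ∀ (m : Ideal R) [m.IsMaximal], @IsAlgClosed (R ⧸ m) (Ideal.Quotient.field m))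
    (Λ : Type u) [Ring Λ] [Algebra R Λ] [Module.Finite R Λ]
    (hΛ : IsRightNakayama 4 Λ)
    (M : Type u) [AddCommGroup M] [Module Λᵐᵒᵖ M] [Module.Finite Λᵐᵒᵖ M]
    (hM : IsIndecomposableModule Λᵐᵒᵖ M) :
    -- (a)
    (IsFactorSerial 4 Λᵐᵒᵖ M →
      -- (a)(i)
      (IsLocalModule Λᵐᵒᵖ M ∧ IsColocalModule Λᵐᵒᵖ M ∧
        IsIndecomposableModule Λᵐᵒᵖ (Module.jacobson Λᵐᵒᵖ M) ∧
        ¬ IsLocalModule Λᵐᵒᵖ (Module.jacobson Λᵐᵒᵖ M) ∧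
        IsFactorSerial 4 Λᵐᵒᵖ (Module.jacobson Λᵐᵒᵖ M) ∧
        ∃ M₁ M₂ N₁ N₂ : Submodule Λᵐᵒᵖ M,
          Module.length Λᵐᵒᵖ M₁ = 3 ∧ IsIndecomposableModule Λᵐᵒᵖ M₁ ∧ IsUniserial Λᵐᵒᵖ M₁ ∧
          Module.length Λᵐᵒᵖ M₂ = 3 ∧ IsIndecomposableModule Λᵐᵒᵖ M₂ ∧
          ¬ IsLocalModule Λᵐᵒᵖ M₂ ∧ IsFactorSerial 3 Λᵐᵒᵖ M₂ ∧
          Module.length Λᵐᵒᵖ N₁ = 2 ∧ IsIndecomposableModule Λᵐᵒᵖ N₁ ∧ IsUniserial Λᵐᵒᵖ N₁ ∧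
          Module.length Λᵐᵒᵖ N₂ = 2 ∧ IsIndecomposableModule Λᵐᵒᵖ N₂ ∧ IsUniserial Λᵐᵒᵖ N₂ ∧
          N₁ ≠ N₂ ∧ N₁ ≤ M₁ ∧ N₁ ≤ M₂ ∧ N₂ ≤ M₂ ∧
          ∀ X : Submodule Λᵐᵒᵖ M,
            X ∈ ({⊥, socle Λᵐᵒᵖ M, N₁, N₂, M₁, M₂, Module.jacobson Λᵐᵒᵖ M, ⊤} :
              Set (Submodule Λᵐᵒᵖ M))) ∨
      -- (a)(ii)
      (IsLocalModule Λᵐᵒᵖ M ∧ ¬ IsColocalModule Λᵐᵒᵖ M ∧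
        ∃ N N₁ S₁ S₂ : Submodule Λᵐᵒᵖ M,
          Module.jacobson Λᵐᵒᵖ M = N ⊔ S₁ ∧ Disjoint N S₁ ∧
          Module.length Λᵐᵒᵖ N = 3 ∧ IsUniserial Λᵐᵒᵖ N ∧
          IsSimpleModule Λᵐᵒᵖ S₁ ∧ IsSimpleModule Λᵐᵒᵖ S₂ ∧
          Module.length Λᵐᵒᵖ N₁ = 2 ∧ IsUniserial Λᵐᵒᵖ N₁ ∧ N₁ ≤ N ∧
          socle Λᵐᵒᵖ M = S₁ ⊔ S₂ ∧ Disjoint S₁ S₂ ∧ socleOf Λᵐᵒᵖ N = S₂ ∧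
          ∀ X : Submodule Λᵐᵒᵖ M,
            X ∈ ({⊥, S₁, S₂, socle Λᵐᵒᵖ M, N₁, N₁ ⊔ S₁, N, Module.jacobson Λᵐᵒᵖ M, ⊤} :
              Set (Submodule Λᵐᵒᵖ M)) ∨ Nonempty (X ≃ₗ[Λᵐᵒᵖ] S₁)) ∨
      -- (a)(iii)
      (IsLocalModule Λᵐᵒᵖ M ∧ ¬ IsColocalModule Λᵐᵒᵖ M ∧
        ∃ N₁ N₂ S₁ S₂ : Submodule Λᵐᵒᵖ M,
          Module.jacobson Λᵐᵒᵖ M = N₁ ⊔ N₂ ∧ Disjoint N₁ N₂ ∧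
          Module.length Λᵐᵒᵖ N₁ = 2 ∧ IsUniserial Λᵐᵒᵖ N₁ ∧
          Module.length Λᵐᵒᵖ N₂ = 2 ∧ IsUniserial Λᵐᵒᵖ N₂ ∧
          IsSimpleModule Λᵐᵒᵖ S₁ ∧ IsSimpleModule Λᵐᵒᵖ S₂ ∧
          socle Λᵐᵒᵖ M = S₁ ⊔ S₂ ∧ Disjoint S₁ S₂ ∧
          socleOf Λᵐᵒᵖ N₁ = S₁ ∧ socleOf Λᵐᵒᵖ N₂ = S₂ ∧
          ∀ X : Submodule Λᵐᵒᵖ M,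
            X ∈ ({⊥, S₁, S₂, socle Λᵐᵒᵖ M, N₁, N₂, N₁ ⊔ S₂, S₁ ⊔ N₂,
              Module.jacobson Λᵐᵒᵖ M, ⊤} : Set (Submodule Λᵐᵒᵖ M)) ∨
            Nonempty (X ≃ₗ[Λᵐᵒᵖ] N₁) ∨ Nonempty (X ≃ₗ[Λᵐᵒᵖ] N₂)) ∨
      -- (a)(iv)
      (¬ IsLocalModule Λᵐᵒᵖ M ∧ Module.length Λᵐᵒᵖ M = 4 ∧ IsSimpleModule Λᵐᵒᵖ (socle Λᵐᵒᵖ M) ∧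
        ∃ M₁ M₂ N₁ N₂ : Submodule Λᵐᵒᵖ M,
          Module.length Λᵐᵒᵖ M₁ = 3 ∧ IsUniserial Λᵐᵒᵖ M₁ ∧
          Module.length Λᵐᵒᵖ M₂ = 3 ∧ ¬ IsLocalModule Λᵐᵒᵖ M₂ ∧ IsFactorSerial 3 Λᵐᵒᵖ M₂ ∧
          Module.length Λᵐᵒᵖ N₁ = 2 ∧ IsIndecomposableModule Λᵐᵒᵖ N₁ ∧ IsUniserial Λᵐᵒᵖ N₁ ∧
          Module.length Λᵐᵒᵖ N₂ = 2 ∧ IsIndecomposableModule Λᵐᵒᵖ N₂ ∧ IsUniserial Λᵐᵒᵖ N₂ ∧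
          N₁ ≠ N₂ ∧ N₁ ≤ M₁ ∧ N₁ ≤ M₂ ∧ N₂ ≤ M₂ ∧
          ∀ X : Submodule Λᵐᵒᵖ M,
            X ∈ ({⊥, socle Λᵐᵒᵖ M, N₁, N₂, M₁, M₂, ⊤} : Set (Submodule Λᵐᵒᵖ M)) ∨
            Nonempty (X ≃ₗ[Λᵐᵒᵖ] M₁)) ∨
      -- (a)(v)
      (¬ IsLocalModule Λᵐᵒᵖ M ∧ Module.length Λᵐᵒᵖ M = 4 ∧
        ¬ IsSimpleModule Λᵐᵒᵖ (socle Λᵐᵒᵖ M) ∧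
        ∃ N₁ N₂ S₁ S₂ : Submodule Λᵐᵒᵖ M,
          Module.length Λᵐᵒᵖ N₁ = 3 ∧ IsIndecomposableModule Λᵐᵒᵖ N₁ ∧
          IsFactorSerial 2 Λᵐᵒᵖ N₁ ∧
          Module.length Λᵐᵒᵖ N₂ = 2 ∧ IsIndecomposableModule Λᵐᵒᵖ N₂ ∧ IsUniserial Λᵐᵒᵖ N₂ ∧
          IsSimpleModule Λᵐᵒᵖ S₁ ∧ IsSimpleModule Λᵐᵒᵖ S₂ ∧
          socle Λᵐᵒᵖ M = S₁ ⊔ S₂ ∧ Disjoint S₁ S₂ ∧ socleOf Λᵐᵒᵖ N₂ = S₂ ∧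
          ∀ X : Submodule Λᵐᵒᵖ M,
            X ∈ ({⊥, S₁, S₂, socle Λᵐᵒᵖ M, N₂, N₂ ⊔ S₁, N₁, ⊤} : Set (Submodule Λᵐᵒᵖ M)) ∨
            Nonempty (X ≃ₗ[Λᵐᵒᵖ] N₂))) ∧
    -- (b)
    (IsFactorSerial 3 Λᵐᵒᵖ M →
      -- (b)(i)
      (IsLocalModule Λᵐᵒᵖ M ∧ IsColocalModule Λᵐᵒᵖ M ∧
        ¬ IsLocalModule Λᵐᵒᵖ (Module.jacobson Λᵐᵒᵖ M) ∧
        IsFactorSerial 3 Λᵐᵒᵖ (Module.jacobson Λᵐᵒᵖ M) ∧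
        Module.length Λᵐᵒᵖ (Module.jacobson Λᵐᵒᵖ M) = 3 ∧
        ∃ N₁ N₂ : Submodule Λᵐᵒᵖ M,
          Module.length Λᵐᵒᵖ N₁ = 2 ∧ IsUniserial Λᵐᵒᵖ N₁ ∧
          Module.length Λᵐᵒᵖ N₂ = 2 ∧ IsUniserial Λᵐᵒᵖ N₂ ∧ N₁ ≠ N₂ ∧
          ∀ X : Submodule Λᵐᵒᵖ M,
            X ∈ ({⊥, socle Λᵐᵒᵖ M, N₁, N₂, Module.jacobson Λᵐᵒᵖ M, ⊤} :
              Set (Submodule Λᵐᵒᵖ M))) ∨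
      -- (b)(ii)
      (IsLocalModule Λᵐᵒᵖ M ∧ ¬ IsSimpleModule Λᵐᵒᵖ (socle Λᵐᵒᵖ M) ∧
        ∃ N S₁ S₂ : Submodule Λᵐᵒᵖ M,
          Module.jacobson Λᵐᵒᵖ M = N ⊔ S₁ ∧ Disjoint N S₁ ∧
          Module.length Λᵐᵒᵖ N = 2 ∧ IsUniserial Λᵐᵒᵖ N ∧
          IsSimpleModule Λᵐᵒᵖ S₁ ∧ IsSimpleModule Λᵐᵒᵖ S₂ ∧
          socle Λᵐᵒᵖ M = S₁ ⊔ S₂ ∧ Disjoint S₁ S₂ ∧ socleOf Λᵐᵒᵖ N = S₂ ∧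
          ∀ X : Submodule Λᵐᵒᵖ M,
            X ∈ ({⊥, S₁, S₂, socle Λᵐᵒᵖ M, N, Module.jacobson Λᵐᵒᵖ M, ⊤} :
              Set (Submodule Λᵐᵒᵖ M)) ∨ Nonempty (X ≃ₗ[Λᵐᵒᵖ] S₁)) ∨
      -- (b)(iii)
      (¬ IsLocalModule Λᵐᵒᵖ M ∧ Module.length Λᵐᵒᵖ M = 3 ∧ IsSimpleModule Λᵐᵒᵖ (socle Λᵐᵒᵖ M) ∧
        ∃ N₁ N₂ : Submodule Λᵐᵒᵖ M,
          Module.length Λᵐᵒᵖ N₁ = 2 ∧ IsUniserial Λᵐᵒᵖ N₁ ∧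
          Module.length Λᵐᵒᵖ N₂ = 2 ∧ IsUniserial Λᵐᵒᵖ N₂ ∧ N₁ ≠ N₂ ∧
          ∀ X : Submodule Λᵐᵒᵖ M,
            X ∈ ({⊥, socle Λᵐᵒᵖ M, N₁, N₂, ⊤} : Set (Submodule Λᵐᵒᵖ M)))) ∧
    -- (c)
    (IsFactorSerial 2 Λᵐᵒᵖ M → IsLocalModule Λᵐᵒᵖ M →
      ∃ S₁ S₂ : Submodule Λᵐᵒᵖ M,
        IsSimpleModule Λᵐᵒᵖ S₁ ∧ IsSimpleModule Λᵐᵒᵖ S₂ ∧ Disjoint S₁ S₂ ∧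
        Module.jacobson Λᵐᵒᵖ M = socle Λᵐᵒᵖ M ∧ socle Λᵐᵒᵖ M = S₁ ⊔ S₂ ∧
        ∀ X : Submodule Λᵐᵒᵖ M,
          X ∈ ({⊥, S₁, S₂, Module.jacobson Λᵐᵒᵖ M, ⊤} : Set (Submodule Λᵐᵒᵖ M))) := by
  -- From here on only the module theory of the ring Λᵐᵒᵖ matters; R has served its purpose once
  -- `hA` is known.
  have : IsArtinianRing Λᵐᵒᵖ := IsArtinianRing.of_finite R Λᵐᵒᵖ
  have hA : NakayamaFour.IsFourNakayama Λᵐᵒᵖ :=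
    ⟨fun M _ _ => hΛ.1 M, fun T _ _ _ => NakayamaFour.exists_central_smul hR T⟩
  have := hM.1
  refine ⟨fun h => ?_, fun h => ?_, fun h hloc => ?_⟩
  · rcases hA.isFactorSerial_cases (by omega) h with ⟨hn, hl⟩ | ⟨hloc, hu, hl⟩
    · exact (hA.nonlocal_len_four_cases hM hn hl).elim
        (fun h => Or.inr (Or.inr (Or.inr (Or.inl h)))) fun h => Or.inr (Or.inr (Or.inr (Or.inr h)))
    · exact (hA.local_len_five_cases hloc hu hl).elim Or.inl
        fun h => Or.inr (h.elim Or.inl fun h => Or.inr (Or.inl h))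
  · rcases hA.isFactorSerial_cases (by omega) h with ⟨hn, hl⟩ | ⟨hloc, hu, hl⟩
    · exact Or.inr (Or.inr (hA.nonlocal_len_three_cases hM hn hl))
    · exact (hA.local_len_four hloc hu hl).elim Or.inl fun h => Or.inr (Or.inl h)
  · rcases hA.isFactorSerial_cases (by omega) h with ⟨hn, -⟩ | ⟨-, hu, hl⟩
    · exact absurd hloc hn
    · exact hA.local_len_three hloc hu hl
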